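/- **Setting.** Graphs are finite and connected, with a basepoint vertex $p$; loops and multiple edges are allowed. A graph $\Gamma$ is *reduced* if $p$ is at least 2-valent, all other vertices are at least 3-valent, and no edge is separating. It is a *cactus graph* if every edge lies in a unique reduced cycle (embedded circle). For $n\ge 1$ let $R_n$ be the rose with $n$ petals, with $\pi_1(R_n)=F_n$. A *marking* of $(\Gamma,p)$ is a pointed homotopy equivalence $\rho:R_n\to\Gamma$ up to pointed homotopy; equivalently, an isomorphism $F_n\to\pi_1(\Gamma,p)$. The spine $K_n$ of Auter space is the simplicial complex whose vertices are the reduced marked graphs $(\Gamma,p,\rho)$ of rank $n$, up to pointed isomorphisms compatible with the markings, and whose simplices are the finite chains of forest collapses compatible with the markings. An automorphism of $F_n=\langle x_1,\dots,x_n\rangle$ is *symmetric* if it maps each $x_i$ to a conjugate of some $x_j^{\pm1}$; these form the group $\Sigma\mathrm{Aut}(F_n)$. A marking $\rho$ is *symmetric* if for every maximal tree $T$ of $\Gamma$, with collapse $\pi:\Gamma\to\Gamma/T=R_n$, one has $\pi\circ\rho\in\Sigma\mathrm{Aut}(F_n)$. The *coweight* of a cactus graph of rank $n$ is $n$ minus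 the number of reduced cycles through $p$. For $c\in\mathbb{N}_0$ let $\Sigma K_{n,c}$ be the full subcomplex of $K_n$ spanned by the cactus graphs of coweight at most $c$ with symmetric marking, and let $\Sigma Q_{n,c}=\Sigma K_{n,c}/\Sigma\mathrm{Aut}(F_n)$ be the orbit space (with the quotient topology from the geometric realization) of the action $(\Gamma,p,\rho)\cdot\varphi=(\Gamma,p,\rho\circ\varphi)$. Sending $(\Gamma,p,\rho)$ to $(\Gamma\vee S^1,p,\rho')$, where the circle is wedged on at $p$ and $\rho'$ extends $\rho$ by sending the new generator to the new loop, induces a map $\iota:\Sigma Q_{n,c}\to\Sigma Q_{n+1,c}$. **Proposition.** Let $n\ge 1$ and $c\ge 0$ be integers. The map $\iota:\Sigma Q_{n,c}\to\Sigma Q_{n+1,c}$ is a topological embedding. It is a homeomorphism if $2c<n+1$, and it is a homotopy equivalence if $\tfrac{3c}{2}<n+1$. -/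

import Mathlib

noncomputable section

namespace CactusSpace

/-! ### Finite pointed graphs -/

/-- A finite graph with a basepoint vertex; loops and multiple edges are allowed. Every edge carries
an auxiliary orientation, which isomorphisms need not preserve. -/
structure PointedGraph : Type 1 where
  V : Type
  E : Type
  [finV : Finite V]
  [finE : Finite E]
  src : E → V
  tgt : E → V
  base : V

attribute [instance] PointedGraph.finV PointedGraph.finE

namespace PointedGraph

variable (Γ : PointedGraph)

/-- The equivalence relation on vertices: `v` and `w` are joined by a path with edges in `S`. -/
def Conn (S : Set Γ.E) : Γ.V → Γ.V → Prop :=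
  Relation.EqvGen fun v w => ∃ e ∈ S, Γ.src e = v ∧ Γ.tgt e = w

/-- The valence of `v` in the subgraph with edge set `S` (a loop counts twice). -/
def valence (S : Set Γ.E) (v : Γ.V) : ℕ :=
  {e | e ∈ S ∧ Γ.src e = v}.ncard + {e | e ∈ S ∧ Γ.tgt e = v}.ncard

/-- `C` is the edge set of a reduced cycle, i.e. of a subgraph homeomorphic to a circle: it is
nonempty, connected, and every vertex on it has valence `2` in it. -/
structure IsReducedCycle (C : Set Γ.E) : Prop where
  nonempty : C.Nonempty
  conn : ∀ e ∈ C, ∀ e' ∈ C, Γ.Conn C (Γ.src e) (Γ.src e')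
  valence_src : ∀ e ∈ C, Γ.valence C (Γ.src e) = 2
  valence_tgt : ∀ e ∈ C, Γ.valence C (Γ.tgt e) = 2

/-- A set of edges that contains no reduced cycle. -/
def IsForest (F : Set Γ.E) : Prop := ∀ C, C ⊆ F → ¬ Γ.IsReducedCycle C

/-- A maximal tree: a forest that connects all vertices. -/
def IsMaximalTree (T : Set Γ.E) : Prop := Γ.IsForest T ∧ ∀ v w, Γ.Conn T v w

/-- Connected, the basepoint at least 2-valent, all other vertices at least 3-valent, and no
separating edges. -/
structure IsReduced : Prop where
  connected : ∀ v w, Γ.Conn Set.univ v w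
  base_valence : 2 ≤ Γ.valence Set.univ Γ.base
  other_valence : ∀ v, v ≠ Γ.base → 3 ≤ Γ.valence Set.univ v
  no_separating : ∀ e v w, Γ.Conn {e}ᶜ v w

/-- Every edge is contained in a unique reduced cycle. -/
def IsCactus : Prop := ∀ e : Γ.E, ∃! C : Set Γ.E, Γ.IsReducedCycle C ∧ e ∈ C

/-- The number of reduced cycles that contain the basepoint as a vertex. -/
def weight : ℕ :=
  {C : Set Γ.E | Γ.IsReducedCycle C ∧ ∃ e ∈ C, Γ.src e = Γ.base ∨ Γ.tgt e = Γ.base}.ncard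

/-- `PathClass v w g`: the element `g` of the free group on the (oriented) edges is spelled by an
edge path from `v` to `w`. Two edge paths with the same ends are homotopic relative to the ends if
and only if they spell the same element, so these `g` are the homotopy classes of paths. -/
inductive PathClass (v : Γ.V) : Γ.V → FreeGroup Γ.E → Prop
  | refl : PathClass v v 1
  | fwd (e : Γ.E) (g : FreeGroup Γ.E) :
      PathClass v (Γ.src e) g → PathClass v (Γ.tgt e) (g * FreeGroup.of e)
  | bwd (e : Γ.E) (g : FreeGroup Γ.E) :
      PathClass v (Γ.tgt e) g → PathClass v (Γ.src e) (g * (FreeGroup.of e)⁻¹)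

variable {Γ}

theorem PathClass.trans {u v w : Γ.V} {g h : FreeGroup Γ.E} (hg : Γ.PathClass u v g)
    (hh : Γ.PathClass v w h) : Γ.PathClass u w (g * h) := by
  induction hh with
  | refl => simpa using hg
  | fwd e k _ ih => rw [← mul_assoc]; exact .fwd e _ ih
  | bwd e k _ ih => rw [← mul_assoc]; exact .bwd e _ ih

theorem PathClass.symm {v w : Γ.V} {g : FreeGroup Γ.E} (hg : Γ.PathClass v w g) :
    Γ.PathClass w v g⁻¹ := by
  induction hg with
  | refl => rw [inv_one]; exact .refl
  | fwd e k _ ih =>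
    rw [mul_inv_rev]
    refine PathClass.trans ?_ ih
    have := PathClass.bwd e 1 (PathClass.refl (Γ := Γ) (v := Γ.tgt e))
    rwa [one_mul] at this
  | bwd e k _ ih =>
    rw [mul_inv_rev, inv_inv]
    refine PathClass.trans ?_ ih
    have := PathClass.fwd e 1 (PathClass.refl (Γ := Γ) (v := Γ.src e))
    rwa [one_mul] at this

variable (Γ)

/-- The fundamental group at the basepoint: homotopy classes of closed edge paths. -/
def pi1 : Subgroup (FreeGroup Γ.E) where
  carrier := {g | Γ.PathClass Γ.base Γ.base g}
  one_mem' := .refl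
  mul_mem' := fun ha hb => ha.trans hb
  inv_mem' := fun ha => ha.symm

/-- The graph obtained by collapsing every edge of `F` to a point. -/
abbrev collapse (F : Set Γ.E) : PointedGraph where
  V := Quotient (Relation.EqvGen.setoid fun v w => ∃ e ∈ F, Γ.src e = v ∧ Γ.tgt e = w)
  E := {e // e ∉ F}
  src := fun e => Quotient.mk _ (Γ.src e.1)
  tgt := fun e => Quotient.mk _ (Γ.tgt e.1)
  base := Quotient.mk _ Γ.base

variable {Γ}

open Classical in
/-- The effect of collapsing `F` on (homotopy classes of) edge paths: the edges in `F` are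
erased. -/
def collapseHom (F : Set Γ.E) : FreeGroup Γ.E →* FreeGroup {e // e ∉ F} :=
  FreeGroup.lift fun e => if h : e ∈ F then 1 else FreeGroup.of ⟨e, h⟩

/-- A basepoint-preserving isomorphism of graphs; `flip e` says that the edge `e` is mapped to
`edge e` with its orientation reversed. -/
structure Iso (Γ Δ : PointedGraph) where
  vert : Γ.V ≃ Δ.V
  edge : Γ.E ≃ Δ.E
  flip : Γ.E → Bool
  map_base : vert Γ.base = Δ.base
  src_edge : ∀ e, Δ.src (edge e) = vert (if flip e then Γ.tgt e else Γ.src e)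
  tgt_edge : ∀ e, Δ.tgt (edge e) = vert (if flip e then Γ.src e else Γ.tgt e)

namespace Iso

/-- The map that an isomorphism induces on (homotopy classes of) edge paths. -/
def hom {Γ Δ : PointedGraph} (α : Iso Γ Δ) : FreeGroup Γ.E →* FreeGroup Δ.E :=
  FreeGroup.lift fun e =>
    if α.flip e then (FreeGroup.of (α.edge e))⁻¹ else FreeGroup.of (α.edge e)

def refl (Γ : PointedGraph) : Iso Γ Γ where
  vert := Equiv.refl _
  edge := Equiv.refl _
  flip := fun _ => false
  map_base := rfl
  src_edge := fun _ => rfl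
  tgt_edge := fun _ => rfl

def symm {Γ Δ : PointedGraph} (α : Iso Γ Δ) : Iso Δ Γ where
  vert := α.vert.symm
  edge := α.edge.symm
  flip := fun e => α.flip (α.edge.symm e)
  map_base := by rw [← α.map_base, Equiv.symm_apply_apply]
  src_edge := fun e => by
    have h1 := α.src_edge (α.edge.symm e)
    have h2 := α.tgt_edge (α.edge.symm e)
    rw [Equiv.apply_symm_apply] at h1 h2
    rw [Equiv.eq_symm_apply]
    split_ifs at h1 h2 ⊢ <;> simp_all
  tgt_edge := fun e => by
    have h1 := α.src_edge (α.edge.symm e)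
    have h2 := α.tgt_edge (α.edge.symm e)
    rw [Equiv.apply_symm_apply] at h1 h2
    rw [Equiv.eq_symm_apply]
    split_ifs at h1 h2 ⊢ <;> simp_all

def trans {Γ Δ Θ : PointedGraph} (α : Iso Γ Δ) (β : Iso Δ Θ) : Iso Γ Θ where
  vert := α.vert.trans β.vert
  edge := α.edge.trans β.edge
  flip := fun e => xor (α.flip e) (β.flip (α.edge e))
  map_base := by simp [α.map_base, β.map_base]
  src_edge := fun e => by
    have h1 := α.src_edge e
    have h2 := α.tgt_edge e
    have h3 := β.src_edge (α.edge e)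
    cases hf : α.flip e <;> cases hg : β.flip (α.edge e) <;> simp_all
  tgt_edge := fun e => by
    have h1 := α.src_edge e
    have h2 := α.tgt_edge e
    have h3 := β.tgt_edge (α.edge e)
    cases hf : α.flip e <;> cases hg : β.flip (α.edge e) <;> simp_all

theorem refl_hom (Γ : PointedGraph) : (refl Γ).hom = MonoidHom.id _ := by
  ext e; simp [hom, refl]

theorem trans_hom {Γ Δ Θ : PointedGraph} (α : Iso Γ Δ) (β : Iso Δ Θ) :
    (α.trans β).hom = β.hom.comp α.hom := by
  ext e
  cases hf : α.flip e <;> cases hg : β.flip (α.edge e) <;> simp [hom, trans, hf, hg]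

theorem symm_hom_comp {Γ Δ : PointedGraph} (α : Iso Γ Δ) :
    α.symm.hom.comp α.hom = MonoidHom.id _ := by
  ext e
  cases hf : α.flip e <;> simp [hom, symm, hf]

end Iso

/-! ### Wedging on a loop at the basepoint -/

variable (Γ)

/-- The wedge of `Γ` with a circle at the basepoint; the new loop is the edge `none`. -/
abbrev wedgeLoop : PointedGraph where
  V := Γ.V
  E := Option Γ.E
  src := fun e => e.elim Γ.base Γ.src
  tgt := fun e => e.elim Γ.base Γ.tgt
  base := Γ.base

variable {Γ}

theorem conn_wedge_of {S : Set Γ.E} {S' : Set Γ.wedgeLoop.E} (h : ∀ e ∈ S, some e ∈ S')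
    {v w : Γ.V} (hc : Γ.Conn S v w) : Γ.wedgeLoop.Conn S' v w := by
  induction hc with
  | rel x y h' =>
    obtain ⟨e, he, h1, h2⟩ := h'
    exact .rel _ _ ⟨some e, h e he, h1, h2⟩
  | refl x => exact .refl _
  | symm x y _ ih => exact .symm _ _ ih
  | trans x y z _ _ ih1 ih2 => exact .trans _ _ _ ih1 ih2

theorem conn_of_wedge {S : Set Γ.E} {S' : Set Γ.wedgeLoop.E} (h : ∀ e, some e ∈ S' → e ∈ S)
    {v w : Γ.V} (hc : Γ.wedgeLoop.Conn S' v w) : Γ.Conn S v w := by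
  unfold Conn at hc
  induction hc with
  | rel x y h' =>
    obtain ⟨e, he, h1, h2⟩ := h'
    cases e with
    | none => subst h1; subst h2; exact .refl _
    | some e => exact .rel _ _ ⟨e, h e he, h1, h2⟩
  | refl x => exact .refl _
  | symm x y _ ih => exact .symm _ _ ih
  | trans x y z _ _ ih1 ih2 => exact .trans _ _ _ ih1 ih2

theorem valence_wedge_some (S : Set Γ.E) (v : Γ.V) :
    Γ.wedgeLoop.valence (some '' S : Set (Option Γ.E)) v = Γ.valence S v := by
  have key : ∀ (f : Γ.E → Γ.V), {e : Option Γ.E | e ∈ some '' S ∧ e.elim Γ.base f = v} =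
      some '' {e | e ∈ S ∧ f e = v} := by
    intro f
    ext e
    cases e <;> simp
  unfold valence
  erw [key Γ.src, key Γ.tgt, Set.ncard_image_of_injective _ (Option.some_injective _),
    Set.ncard_image_of_injective _ (Option.some_injective _)]

theorem valence_mono {S S' : Set Γ.E} (h : S ⊆ S') (v : Γ.V) :
    Γ.valence S v ≤ Γ.valence S' v :=
  Nat.add_le_add
    (Set.ncard_le_ncard (fun _ he => ⟨h he.1, he.2⟩) (Set.toFinite _))
    (Set.ncard_le_ncard (fun _ he => ⟨h he.1, he.2⟩) (Set.toFinite _))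

theorem isReducedCycle_some_iff (C : Set Γ.E) :
    Γ.wedgeLoop.IsReducedCycle (some '' C : Set (Option Γ.E)) ↔ Γ.IsReducedCycle C := by
  constructor
  · intro h
    refine ⟨Set.image_nonempty.1 h.nonempty, fun e he e' he' => ?_, fun e he => ?_, fun e he => ?_⟩
    · refine conn_of_wedge ?_ (h.conn (some e) ⟨e, he, rfl⟩ (some e') ⟨e', he', rfl⟩)
      rintro e ⟨a, ha, hae⟩
      exact (Option.some.inj hae) ▸ ha
    · exact (valence_wedge_some C _).symm.trans (h.valence_src (some e) ⟨e, he, rfl⟩)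
    · exact (valence_wedge_some C _).symm.trans (h.valence_tgt (some e) ⟨e, he, rfl⟩)
  · intro h
    refine ⟨h.nonempty.image _, ?_, ?_, ?_⟩
    · rintro _ ⟨e, he, rfl⟩ _ ⟨e', he', rfl⟩
      exact conn_wedge_of (S := C) (fun a ha => Set.mem_image_of_mem some ha) (h.conn e he e' he')
    · rintro _ ⟨e, he, rfl⟩
      exact (valence_wedge_some C _).trans (h.valence_src e he)
    · rintro _ ⟨e, he, rfl⟩
      exact (valence_wedge_some C _).trans (h.valence_tgt e he)

theorem isReducedCycle_loop : Γ.wedgeLoop.IsReducedCycle ({none} : Set (Option Γ.E)) := by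
  have hv : Γ.wedgeLoop.valence ({none} : Set (Option Γ.E)) Γ.base = 2 := by
    have key : ∀ (f : Γ.E → Γ.V),
        {e : Option Γ.E | e ∈ ({none} : Set (Option Γ.E)) ∧ e.elim Γ.base f = Γ.base} =
          {none} := by
      intro f
      ext e
      cases e <;> simp
    unfold valence
    erw [key Γ.src, key Γ.tgt, Set.ncard_singleton]
  refine ⟨⟨none, rfl⟩, ?_, ?_, ?_⟩
  · rintro _ rfl _ rfl
    exact .refl _
  · rintro _ rfl
    exact hv
  · rintro _ rfl
    exact hv

theorem eq_loop_of_none_mem {C : Set Γ.wedgeLoop.E} (hC : Γ.wedgeLoop.IsReducedCycle C)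
    (h : (none : Option Γ.E) ∈ C) : C = ({none} : Set (Option Γ.E)) := by
  have hv := hC.valence_src _ h
  unfold valence at hv
  set A := {e | e ∈ C ∧ Γ.wedgeLoop.src e = Γ.wedgeLoop.src (none : Option Γ.E)} with hA
  set B := {e | e ∈ C ∧ Γ.wedgeLoop.tgt e = Γ.wedgeLoop.src (none : Option Γ.E)} with hB
  have hA1 : (none : Option Γ.E) ∈ A := ⟨h, rfl⟩
  have hB1 : (none : Option Γ.E) ∈ B := ⟨h, rfl⟩
  have hA0 : 0 < A.ncard := (Set.ncard_pos (Set.toFinite _)).2 ⟨_, hA1⟩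
  have hB0 : 0 < B.ncard := (Set.ncard_pos (Set.toFinite _)).2 ⟨_, hB1⟩
  obtain ⟨a, ha⟩ := Set.ncard_eq_one.1 (show A.ncard = 1 by omega)
  obtain ⟨b, hb⟩ := Set.ncard_eq_one.1 (show B.ncard = 1 by omega)
  have ha' : a = none := by rw [ha] at hA1; exact hA1.symm
  have hb' : b = none := by rw [hb] at hB1; exact hB1.symm
  subst ha' hb'
  have step : ∀ v w, Γ.wedgeLoop.Conn C v w → (v = Γ.base ↔ w = Γ.base) := by
    intro v w hc
    unfold Conn at hc
    induction hc with
    | rel x y h' =>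
      obtain ⟨e, he, h1, h2⟩ := h'
      constructor
      · intro hx
        have : e ∈ A := ⟨he, h1.trans hx⟩
        rw [ha] at this
        rw [← h2, show e = none from this]; rfl
      · intro hy
        have : e ∈ B := ⟨he, h2.trans hy⟩
        rw [hb] at this
        rw [← h1, show e = none from this]; rfl
    | refl x => exact Iff.rfl
    | symm x y _ ih => exact ih.symm
    | trans x y z _ _ ih1 ih2 => exact ih1.trans ih2
  ext e
  constructor
  · intro he
    have h1 : Γ.wedgeLoop.src e = Γ.base := (step _ _ (hC.conn _ h e he)).1 rfl
    have : e ∈ A := ⟨he, h1⟩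
    rw [ha] at this
    exact this
  · intro he
    rw [show e = none from he]
    exact h

theorem eq_image_of_none_notMem {C : Set Γ.wedgeLoop.E} (h : (none : Option Γ.E) ∉ C) :
    C = (some '' {e | some e ∈ C} : Set (Option Γ.E)) := by
  ext e
  cases e with
  | none => simpa using h
  | some e => simp

theorem isForest_some {F : Set Γ.E} (hF : Γ.IsForest F) :
    Γ.wedgeLoop.IsForest (some '' F : Set (Option Γ.E)) := by
  intro C hCF hC
  have hn : (none : Option Γ.E) ∉ C := fun h => by
    obtain ⟨a, _, ha⟩ := hCF h
    exact Option.some_ne_none a ha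
  rw [eq_image_of_none_notMem hn] at hC
  refine hF _ ?_ ((isReducedCycle_some_iff _).1 hC)
  intro e he
  obtain ⟨a, ha, hae⟩ := hCF he
  exact (Option.some.inj hae) ▸ ha

theorem isMaximalTree_of_wedge {T : Set Γ.wedgeLoop.E} (hT : Γ.wedgeLoop.IsMaximalTree T) :
    Γ.IsMaximalTree {e | some e ∈ T} := by
  refine ⟨fun C hCT hC => ?_, fun v w => conn_of_wedge (fun e he => he) (hT.2 v w)⟩
  refine hT.1 (some '' C : Set (Option Γ.E)) ?_ ((isReducedCycle_some_iff C).2 hC)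
  rintro _ ⟨e, he, rfl⟩
  exact hCT he

theorem IsReduced.wedge (h : Γ.IsReduced) : Γ.wedgeLoop.IsReduced := by
  have hval : ∀ v : Γ.V, Γ.valence Set.univ v ≤ Γ.wedgeLoop.valence Set.univ v := fun v =>
    (valence_wedge_some Set.univ v).symm.le.trans (valence_mono (Set.subset_univ _) _)
  refine ⟨fun v w => conn_wedge_of (fun _ _ => Set.mem_univ _) (h.connected v w),
    h.base_valence.trans (hval _), fun v hv => (h.other_valence v hv).trans (hval v), ?_⟩
  intro e v w
  cases e with
  | none => exact conn_wedge_of (fun a _ => Option.some_ne_none a) (h.connected v w)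
  | some e =>
    exact conn_wedge_of (S := {e}ᶜ) (S' := ({some e}ᶜ : Set (Option Γ.E)))
      (fun a ha hae => ha (Option.some.inj hae)) (h.no_separating e v w)

theorem IsCactus.wedge (h : Γ.IsCactus) : Γ.wedgeLoop.IsCactus := by
  intro e
  cases e with
  | none =>
    exact ⟨({none} : Set (Option Γ.E)), ⟨isReducedCycle_loop, rfl⟩,
      fun C hC => eq_loop_of_none_mem hC.1 hC.2⟩
  | some e =>
    obtain ⟨C, hC, huniq⟩ := h e
    refine ⟨(some '' C : Set (Option Γ.E)), ⟨(isReducedCycle_some_iff C).2 hC.1, ⟨e, hC.2, rfl⟩⟩,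
      fun D hD => ?_⟩
    have hn : (none : Option Γ.E) ∉ D := fun hn => by
      have h2 := hD.2
      rw [eq_loop_of_none_mem hD.1 hn] at h2
      exact Option.some_ne_none e h2
    have hD1 := hD.1
    rw [eq_image_of_none_notMem hn] at hD1
    rw [eq_image_of_none_notMem hn, huniq _ ⟨(isReducedCycle_some_iff _).1 hD1, hD.2⟩]

theorem weight_wedge (Γ : PointedGraph) : Γ.weight + 1 ≤ Γ.wedgeLoop.weight := by
  unfold weight
  set A := {C : Set Γ.E | Γ.IsReducedCycle C ∧ ∃ e ∈ C, Γ.src e = Γ.base ∨ Γ.tgt e = Γ.base}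
  have himg : Function.Injective (fun C : Set Γ.E => (some '' C : Set (Option Γ.E))) :=
    Set.image_injective.2 (Option.some_injective _)
  have hn : ({none} : Set (Option Γ.E)) ∉
      (fun C : Set Γ.E => (some '' C : Set (Option Γ.E))) '' A := by
    rintro ⟨C, _, hC⟩
    have : (none : Option Γ.E) ∈ (some '' C : Set (Option Γ.E)) := by
      rw [show (some '' C : Set (Option Γ.E)) = {none} from hC]; rfl
    obtain ⟨a, _, ha⟩ := this
    exact Option.some_ne_none a ha
  rw [← Set.ncard_image_of_injective A himg, ← Set.ncard_insert_of_notMem hn (Set.toFinite _)]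
  refine Set.ncard_le_ncard ?_ (Set.toFinite _)
  rintro _ (rfl | ⟨C, ⟨hC, e, he, heb⟩, rfl⟩)
  · exact ⟨isReducedCycle_loop, none, rfl, Or.inl rfl⟩
  · exact ⟨(isReducedCycle_some_iff C).2 hC, some e, ⟨e, he, rfl⟩, heb⟩

/-- An isomorphism extends to the wedges with a circle. -/
def Iso.wedge {Γ Δ : PointedGraph} (α : Iso Γ Δ) : Iso Γ.wedgeLoop Δ.wedgeLoop where
  vert := α.vert
  edge := Equiv.optionCongr α.edge
  flip := fun e => e.elim false α.flip
  map_base := α.map_base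
  src_edge := fun e => by
    cases e with
    | none => exact α.map_base.symm
    | some e => exact α.src_edge e
  tgt_edge := fun e => by
    cases e with
    | none => exact α.map_base.symm
    | some e => exact α.tgt_edge e

theorem Iso.wedge_hom_map {Γ Δ : PointedGraph} (α : Iso Γ Δ) (g : FreeGroup Γ.E) :
    α.wedge.hom (FreeGroup.map some g) = FreeGroup.map some (α.hom g) := by
  have : α.wedge.hom.comp (FreeGroup.map (some : Γ.E → Option Γ.E)) =
      (FreeGroup.map some).comp α.hom := by
    ext e
    cases hf : α.flip e <;> simp [Iso.hom, Iso.wedge, hf]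
  exact DFunLike.congr_fun this g

theorem Iso.wedge_hom_none {Γ Δ : PointedGraph} (α : Iso Γ Δ) :
    α.wedge.hom (FreeGroup.of (none : Option Γ.E)) = FreeGroup.of (none : Option Δ.E) := by
  simp [Iso.hom, Iso.wedge]

/-- Collapsing a set of edges of `Γ` commutes with wedging on a loop. -/
def collapseWedge (Γ : PointedGraph) (F : Set Γ.E) :
    Iso (Γ.wedgeLoop.collapse (some '' F : Set (Option Γ.E))) (Γ.collapse F).wedgeLoop where
  vert := Quotient.congrRight fun v w =>
    ⟨fun h => conn_of_wedge (Γ := Γ) (S := F) (by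
        rintro e ⟨a, ha, hae⟩
        exact (Option.some.inj hae) ▸ ha) h,
      fun h => conn_wedge_of (Γ := Γ) (S := F) (fun _ he => Set.mem_image_of_mem some he) h⟩
  edge :=
    { toFun := fun e => match e with
        | ⟨none, _⟩ => none
        | ⟨some a, h⟩ => some ⟨a, fun ha => h ⟨a, ha, rfl⟩⟩
      invFun := fun e => match e with
        | none => ⟨none, fun h => by obtain ⟨a, _, ha⟩ := h; exact Option.some_ne_none a ha⟩
        | some a => ⟨some a.1, fun h => by
            obtain ⟨b, hb, hab⟩ := h
            exact a.2 ((Option.some.inj hab) ▸ hb)⟩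
      left_inv := by rintro ⟨_ | a, h⟩ <;> rfl
      right_inv := by rintro (_ | a) <;> rfl }
  flip := fun _ => false
  map_base := rfl
  src_edge := by rintro ⟨_ | a, h⟩ <;> rfl
  tgt_edge := by rintro ⟨_ | a, h⟩ <;> rfl

theorem collapseWedge_hom_map (F : Set Γ.E) (g : FreeGroup Γ.E) :
    (Γ.collapseWedge F).hom (collapseHom (Γ := Γ.wedgeLoop) (some '' F : Set (Option Γ.E))
      (FreeGroup.map some g)) = FreeGroup.map some (collapseHom F g) := by
  have : (Γ.collapseWedge F).hom.comp ((collapseHom (Γ := Γ.wedgeLoop)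
      (some '' F : Set (Option Γ.E))).comp (FreeGroup.map (some : Γ.E → Option Γ.E))) =
      (FreeGroup.map (some : {e // e ∉ F} → Option {e // e ∉ F})).comp (collapseHom F) := by
    ext e
    by_cases he : e ∈ F
    · have he' : (some e : Option Γ.E) ∈ (some '' F : Set (Option Γ.E)) := ⟨e, he, rfl⟩
      simp only [MonoidHom.comp_apply, collapseHom, FreeGroup.map.of]
      erw [FreeGroup.lift_apply_of, FreeGroup.lift_apply_of, dif_pos he', dif_pos he]
      rfl
    · have he' : (some e : Option Γ.E) ∉ (some '' F : Set (Option Γ.E)) := by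
        rintro ⟨a, ha, hae⟩
        exact he ((Option.some.inj hae) ▸ ha)
      simp only [MonoidHom.comp_apply, collapseHom, FreeGroup.map.of]
      erw [FreeGroup.lift_apply_of, FreeGroup.lift_apply_of, dif_neg he', dif_neg he,
        FreeGroup.map.of]
  exact DFunLike.congr_fun this g

theorem collapseWedge_hom_none (F : Set Γ.E) :
    (Γ.collapseWedge F).hom (collapseHom (Γ := Γ.wedgeLoop) (some '' F : Set (Option Γ.E))
      (FreeGroup.of (none : Option Γ.E))) = FreeGroup.of (none : Option {e // e ∉ F}) := by
  have hn : (none : Option Γ.E) ∉ (some '' F : Set (Option Γ.E)) := by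
    rintro ⟨a, _, ha⟩
    exact Option.some_ne_none a ha
  unfold collapseHom
  erw [FreeGroup.lift_apply_of, dif_neg hn]
  unfold Iso.hom
  erw [FreeGroup.lift_apply_of]
  rfl

end PointedGraph

/-! ### Marked graphs and the spine of Auter space -/

open PointedGraph

/-- A reduced pointed graph with a marking. A homotopy class of pointed homotopy equivalences from
the rose with `n` petals to the graph is the same as an isomorphism from the free group `F_n` onto
the fundamental group of the graph. -/
structure MarkedGraph (n : ℕ) : Type 1 where
  graph : PointedGraph
  reduced : graph.IsReduced
  marking : FreeGroup (Fin n) →* FreeGroup graph.E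
  marking_injective : Function.Injective marking
  marking_range : marking.range = graph.pi1

namespace MarkedGraph

variable {n : ℕ}

/-- Two marked graphs are equivalent if some pointed isomorphism carries one marking to the
other. -/
instance setoid (n : ℕ) : Setoid (MarkedGraph n) where
  r m m' := ∃ α : Iso m.graph m'.graph, α.hom.comp m.marking = m'.marking
  iseqv :=
    { refl := fun m => ⟨Iso.refl _, by rw [Iso.refl_hom, MonoidHom.id_comp]⟩
      symm := by
        rintro m m' ⟨α, h⟩
        exact ⟨α.symm, by rw [← h, ← MonoidHom.comp_assoc, α.symm_hom_comp, MonoidHom.id_comp]⟩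
      trans := by
        rintro m m' m'' ⟨α, h⟩ ⟨β, h'⟩
        exact ⟨α.trans β, by rw [Iso.trans_hom, MonoidHom.comp_assoc, h, h']⟩ }

/-- `m'` is obtained from `m` by a forest collapse that is compatible with the markings. -/
def CollapsesTo (m m' : MarkedGraph n) : Prop :=
  ∃ F : Set m.graph.E, m.graph.IsForest F ∧ ∃ α : Iso (m.graph.collapse F) m'.graph,
    α.hom.comp ((collapseHom F).comp m.marking) = m'.marking

/-- For each maximal tree `T`, the marking followed by the collapse of `T` to a rose is a symmetric
automorphism: it maps each generator to a conjugate of a petal or of the inverse of a petal. (The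
fundamental group of the rose is free on its petals, the edges outside `T`; how these are numbered
and oriented does not matter.) -/
def IsSymmetric (m : MarkedGraph n) : Prop :=
  ∀ T : Set m.graph.E, m.graph.IsMaximalTree T → ∀ i : Fin n, ∃ e : {e // e ∉ T},
    IsConj (collapseHom T (m.marking (FreeGroup.of i))) (FreeGroup.of e) ∨
      IsConj (collapseHom T (m.marking (FreeGroup.of i))) (FreeGroup.of e)⁻¹

/-- The coweight: the rank minus the weight. -/
def coweight (m : MarkedGraph n) : ℤ := (n : ℤ) - m.graph.weight

/-- Precomposition of the marking with an automorphism of `F_n`. -/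
def precomp (m : MarkedGraph n) (φ : MulAut (FreeGroup (Fin n))) : MarkedGraph n where
  graph := m.graph
  reduced := m.reduced
  marking := m.marking.comp φ.toMonoidHom
  marking_injective := m.marking_injective.comp φ.injective
  marking_range := by
    rw [MonoidHom.range_comp, MonoidHom.range_eq_top.2 (MulEquiv.surjective φ),
      ← MonoidHom.range_eq_map, m.marking_range]

end MarkedGraph

/-- The vertices of the spine of Auter space: marked graphs up to equivalence. -/
def AuterVertex (n : ℕ) : Type 1 := Quotient (MarkedGraph.setoid n)

def AuterVertex.CollapsesTo {n : ℕ} (v w : AuterVertex n) : Prop :=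
  ∃ m m' : MarkedGraph n, Quotient.mk _ m = v ∧ Quotient.mk _ m' = w ∧ m.CollapsesTo m'

/-- The spine `K_n` of Auter space: simplices are the finite chains of forest collapses. -/
def auterSpine (n : ℕ) : AbstractSimplicialComplex (AuterVertex n) where
  faces := {s | s.Nonempty ∧ IsChain AuterVertex.CollapsesTo (s : Set (AuterVertex n))}
  isRelLowerSet_faces := fun _ hs =>
    ⟨hs.1, fun _ hts ht => ⟨ht, hs.2.mono (Finset.coe_subset.2 hts)⟩⟩
  singleton_mem := fun v => ⟨Finset.singleton_nonempty v, by simp⟩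

/-- The vertex is represented by a cactus graph of coweight at most `c` with a symmetric marking. -/
def AuterVertex.IsCactusVertex {n : ℕ} (c : ℕ) (v : AuterVertex n) : Prop :=
  ∃ m : MarkedGraph n, Quotient.mk _ m = v ∧ m.graph.IsCactus ∧ m.IsSymmetric ∧ m.coweight ≤ c

/-- The complex `ΣK_{n,c}`: the full subcomplex of `K_n` that is spanned by the marked cactus
graphs of coweight at most `c`. -/
def cactusComplex (n c : ℕ) : PreAbstractSimplicialComplex (AuterVertex n) where
  faces := {s | s ∈ (auterSpine n).faces ∧ ∀ v ∈ s, v.IsCactusVertex c}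
  isRelLowerSet_faces := fun _ hs =>
    ⟨hs.1.1, fun _ hts ht => ⟨((auterSpine n).isRelLowerSet_faces hs.1).2 hts ht,
      fun v hv => hs.2 v (hts hv)⟩⟩

/-! ### Geometric realization of simplicial complexes -/

/-- The points of the geometric realization, in barycentric coordinates. -/
def Realization {P : Type*} (K : PreAbstractSimplicialComplex P) : Type _ :=
  {x : P →₀ ℝ // (∀ v, 0 ≤ x v) ∧ (x.sum fun _ t => t) = 1 ∧ x.support ∈ K.faces}

namespace Realization

/-- The weak topology: a set is closed if and only if it meets each closed simplex in a closed set,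
where a closed simplex has the Euclidean topology (that of the barycentric coordinates). -/
instance {P : Type*} (K : PreAbstractSimplicialComplex P) : TopologicalSpace (Realization K) :=
  ⨆ s ∈ K.faces, TopologicalSpace.coinduced
    (Subtype.val : {x : Realization K // x.1.support ⊆ s} → Realization K)
    (TopologicalSpace.induced
      (fun (x : {x : Realization K // x.1.support ⊆ s}) (v : P) => x.1.1 v) inferInstance)

open Classical in
/-- The map of realizations that is affine on simplices and extends a simplicial map. -/
def map {P Q : Type*} {K : PreAbstractSimplicialComplex P} {L : PreAbstractSimplicialComplex Q}
    (f : P → Q) (hf : ∀ s ∈ K.faces, s.image f ∈ L.faces) (x : Realization K) : Realization L :=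
  ⟨Finsupp.mapDomain f x.1, by
    obtain ⟨x, h0, h1, hs⟩ := x
    refine ⟨fun w => ?_, ?_, ?_⟩
    · simp only [Finsupp.mapDomain, Finsupp.sum, Finsupp.finsetSum_apply]
      refine Finset.sum_nonneg fun v _ => ?_
      rw [Finsupp.single_apply]
      split_ifs
      · exact h0 v
      · exact le_rfl
    · rw [Finsupp.sum_mapDomain_index (fun _ => rfl) (fun _ _ _ => rfl)]
      exact h1
    · refine (L.isRelLowerSet_faces (hf _ hs)).2 Finsupp.mapDomain_support ?_
      rw [Finset.nonempty_iff_ne_empty, Ne, Finsupp.support_eq_empty]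
      intro h
      have h2 : ((Finsupp.mapDomain f x).sum fun _ t => t) = 1 := by
        rw [Finsupp.sum_mapDomain_index (fun _ => rfl) (fun _ _ _ => rfl)]
        exact h1
      rw [h, Finsupp.sum_zero_index] at h2
      exact zero_ne_one h2⟩

end Realization

/-! ### Symmetric automorphisms and the orbit spaces -/

/-- The endomorphism maps each generator to a conjugate of a generator or of the inverse of a
generator. -/
def IsSymmetricHom {n : ℕ} (φ : FreeGroup (Fin n) →* FreeGroup (Fin n)) : Prop :=
  ∀ i, ∃ j, IsConj (φ (FreeGroup.of i)) (FreeGroup.of j) ∨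
    IsConj (φ (FreeGroup.of i)) (FreeGroup.of j)⁻¹

theorem isConj_inv {G : Type*} [Group G] {a b : G} (h : IsConj a b) : IsConj a⁻¹ b⁻¹ := by
  obtain ⟨c, hc⟩ := isConj_iff.1 h
  exact isConj_iff.2 ⟨c, by rw [← hc]; group⟩

theorem isConj_inv_left {G : Type*} [Group G] {a b : G} (h : IsConj a b⁻¹) : IsConj a⁻¹ b := by
  rw [← inv_inv b]
  exact isConj_inv h

theorem eq_of_isConj_of {n : ℕ} {i j : Fin n}
    (h : IsConj (FreeGroup.of i) (FreeGroup.of j) ∨ IsConj (FreeGroup.of i) (FreeGroup.of j)⁻¹) :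
    i = j := by
  classical
  by_contra hij
  let f : FreeGroup (Fin n) →* Multiplicative ℤ :=
    FreeGroup.lift fun k => if k = i then Multiplicative.ofAdd 1 else 1
  have hi : f (FreeGroup.of i) = Multiplicative.ofAdd 1 := by simp [f]
  have hj : f (FreeGroup.of j) = 1 := by
    simp only [f, FreeGroup.lift_apply_of]
    exact if_neg (fun h => hij h.symm)
  have hne : (Multiplicative.ofAdd (1 : ℤ)) ≠ 1 := by decide
  rcases h with h | h
  · have := isConj_iff_eq.1 (f.map_isConj h)
    rw [hi, hj] at this
    exact hne this
  · have := isConj_iff_eq.1 (f.map_isConj h)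
    rw [hi, map_inv, hj, inv_one] at this
    exact hne this

theorem IsSymmetricHom.map_gen {n : ℕ} {φ : FreeGroup (Fin n) →* FreeGroup (Fin n)}
    (hφ : IsSymmetricHom φ) {g : FreeGroup (Fin n)} {i : Fin n}
    (hg : IsConj g (FreeGroup.of i) ∨ IsConj g (FreeGroup.of i)⁻¹) :
    ∃ j, IsConj (φ g) (FreeGroup.of j) ∨ IsConj (φ g) (FreeGroup.of j)⁻¹ := by
  obtain ⟨j, hj⟩ := hφ i
  refine ⟨j, ?_⟩
  rcases hg with hg | hg <;> have h1 := φ.map_isConj hg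
  · exact hj.imp h1.trans h1.trans
  · rw [map_inv] at h1
    rcases hj with hj | hj
    · exact Or.inr (h1.trans (isConj_inv hj))
    · exact Or.inl (h1.trans (isConj_inv_left hj))

theorem IsSymmetricHom.inv {n : ℕ} {φ : MulAut (FreeGroup (Fin n))}
    (hφ : IsSymmetricHom φ.toMonoidHom) : IsSymmetricHom (φ⁻¹).toMonoidHom := by
  choose σ hσ using hφ
  have hinj : Function.Injective σ := by
    intro i k hik
    have key : IsConj (φ (FreeGroup.of i)) (φ (FreeGroup.of k)) ∨
        IsConj (φ (FreeGroup.of i)) (φ (FreeGroup.of k))⁻¹ := by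
      have h1 := hσ i
      have h2 := hσ k
      rw [← hik] at h2
      rcases h1 with h1 | h1 <;> rcases h2 with h2 | h2
      · exact Or.inl (h1.trans h2.symm)
      · exact Or.inr (h1.trans (by simpa using (isConj_inv h2).symm))
      · exact Or.inr (h1.trans (isConj_inv h2).symm)
      · exact Or.inl (h1.trans h2.symm)
    apply eq_of_isConj_of
    rcases key with key | key
    · left
      simpa using φ.symm.toMonoidHom.map_isConj key
    · right
      simpa using φ.symm.toMonoidHom.map_isConj key
  intro j
  obtain ⟨i, rfl⟩ := Finite.surjective_of_injective hinj j
  refine ⟨i, ?_⟩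
  rcases hσ i with h | h
  · left
    have := φ.symm.toMonoidHom.map_isConj h.symm
    simpa using this
  · right
    have := isConj_inv (φ.symm.toMonoidHom.map_isConj h.symm)
    simpa using this

/-- The group `ΣAut(F_n)` of symmetric automorphisms of the free group of rank `n`. -/
def SAut (n : ℕ) : Subgroup (MulAut (FreeGroup (Fin n))) where
  carrier := {φ | IsSymmetricHom φ.toMonoidHom}
  one_mem' := fun i => ⟨i, Or.inl (IsConj.refl _)⟩
  mul_mem' := fun {φ ψ} hφ hψ i => by
    obtain ⟨j, hj⟩ := hψ i
    exact hφ.map_gen hj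
  inv_mem' := fun h => h.inv

/-- The automorphism `φ` of `F_n` acts (on the right) by precomposition on markings. -/
def AuterVertex.act {n : ℕ} (φ : MulAut (FreeGroup (Fin n))) : AuterVertex n → AuterVertex n :=
  Quotient.map (fun m => m.precomp φ) (by
    rintro m m' ⟨α, h⟩
    refine ⟨α, ?_⟩
    change α.hom.comp (m.marking.comp φ.toMonoidHom) = m'.marking.comp φ.toMonoidHom
    rw [← h, MonoidHom.comp_assoc])

theorem AuterVertex.act_collapsesTo {n : ℕ} (φ : MulAut (FreeGroup (Fin n))) {v w : AuterVertex n}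
    (h : v.CollapsesTo w) : (v.act φ).CollapsesTo (w.act φ) := by
  obtain ⟨m, m', rfl, rfl, F, hF, α, hα⟩ := h
  refine ⟨m.precomp φ, m'.precomp φ, rfl, rfl, F, hF, α, ?_⟩
  change α.hom.comp ((collapseHom F).comp (m.marking.comp φ.toMonoidHom)) =
    m'.marking.comp φ.toMonoidHom
  rw [← hα]
  rfl

theorem AuterVertex.act_isCactusVertex {n c : ℕ} {φ : MulAut (FreeGroup (Fin n))} (hφ : φ ∈ SAut n)
    {v : AuterVertex n} (h : v.IsCactusVertex c) : (v.act φ).IsCactusVertex c := by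
  obtain ⟨m, rfl, hcac, hsym, hc⟩ := h
  refine ⟨m.precomp φ, rfl, hcac, ?_, hc⟩
  intro T hT i
  obtain ⟨j, hj⟩ := hφ i
  obtain ⟨e, he⟩ := hsym T hT j
  refine ⟨e, ?_⟩
  change IsConj (((collapseHom T).comp m.marking) (φ (FreeGroup.of i))) _ ∨
    IsConj (((collapseHom T).comp m.marking) (φ (FreeGroup.of i))) _
  rcases hj with hj | hj <;> have h1 := ((collapseHom T).comp m.marking).map_isConj hj
  · exact he.imp h1.trans h1.trans
  · rw [map_inv] at h1
    rcases he with he | he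
    · exact Or.inr (h1.trans (isConj_inv he))
    · exact Or.inl (h1.trans (isConj_inv_left he))

open Classical in
theorem image_mem_cactusComplex {n n' c c' : ℕ} {f : AuterVertex n → AuterVertex n'}
    (hf : ∀ v w, v.CollapsesTo w → (f v).CollapsesTo (f w))
    (hf' : ∀ v, v.IsCactusVertex c → (f v).IsCactusVertex c') :
    ∀ s ∈ (cactusComplex n c).faces, s.image f ∈ (cactusComplex n' c').faces := by
  rintro s ⟨⟨hne, hch⟩, hs⟩
  refine ⟨⟨hne.image f, ?_⟩, ?_⟩
  · rw [Finset.coe_image]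
    rintro _ ⟨v, hv, rfl⟩ _ ⟨w, hw, rfl⟩ hvw
    exact (hch hv hw fun h => hvw (by rw [h])).imp (hf _ _) (hf _ _)
  · intro w hw
    obtain ⟨v, hv, rfl⟩ := Finset.mem_image.1 hw
    exact hf' v (hs v hv)

/-- The space `ΣK_{n,c}`. -/
abbrev SigmaK (n c : ℕ) : Type 1 := Realization (cactusComplex n c)

/-- The right action of `ΣAut(F_n)` on `ΣK_{n,c}`, as an action of the opposite group. -/
instance (n c : ℕ) : MulAction (SAut n)ᵐᵒᵖ (SigmaK n c) where
  smul φ := Realization.map (AuterVertex.act φ.unop.1)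
    (image_mem_cactusComplex (fun _ _ => AuterVertex.act_collapsesTo _)
      (fun _ => AuterVertex.act_isCactusVertex φ.unop.2))
  one_smul x := by
    refine Subtype.ext ?_
    have : AuterVertex.act (1 : MulAut (FreeGroup (Fin n))) = id := by
      funext v
      obtain ⟨m, rfl⟩ := Quotient.exists_rep v
      rfl
    change Finsupp.mapDomain (AuterVertex.act (1 : MulAut (FreeGroup (Fin n)))) x.1 = x.1
    rw [this, Finsupp.mapDomain_id]
  mul_smul φ ψ x := by
    refine Subtype.ext ?_
    have : AuterVertex.act (ψ.unop.1 * φ.unop.1) =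
        AuterVertex.act φ.unop.1 ∘ AuterVertex.act ψ.unop.1 := by
      funext v
      obtain ⟨m, rfl⟩ := Quotient.exists_rep v
      rfl
    change Finsupp.mapDomain (AuterVertex.act (ψ.unop.1 * φ.unop.1)) x.1 =
      Finsupp.mapDomain (AuterVertex.act φ.unop.1)
        (Finsupp.mapDomain (AuterVertex.act ψ.unop.1) x.1)
    rw [this, Finsupp.mapDomain_comp]

/-- The orbit space `ΣQ_{n,c} = ΣK_{n,c} / ΣAut(F_n)`, with the quotient topology. -/
abbrev SigmaQ (n c : ℕ) : Type 1 := Quotient (MulAction.orbitRel (SAut n)ᵐᵒᵖ (SigmaK n c))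

/-! ### The stabilization map -/

/-- A marking extended by sending the new generator to the new loop. -/
def extendMarking {n : ℕ} {E : Type} (ρ : FreeGroup (Fin n) →* FreeGroup E) :
    FreeGroup (Fin (n + 1)) →* FreeGroup (Option E) :=
  FreeGroup.lift (Fin.lastCases (FreeGroup.of none) fun i =>
    FreeGroup.map some (ρ (FreeGroup.of i)))

theorem extendMarking_last {n : ℕ} {E : Type} (ρ : FreeGroup (Fin n) →* FreeGroup E) :
    extendMarking ρ (FreeGroup.of (Fin.last n)) = FreeGroup.of none := by
  simp [extendMarking]

theorem extendMarking_map {n : ℕ} {E : Type} (ρ : FreeGroup (Fin n) →* FreeGroup E)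
    (g : FreeGroup (Fin n)) :
    extendMarking ρ (FreeGroup.map Fin.castSucc g) = FreeGroup.map some (ρ g) := by
  have : (extendMarking ρ).comp (FreeGroup.map Fin.castSucc) = (FreeGroup.map some).comp ρ := by
    ext i
    simp [extendMarking]
  exact DFunLike.congr_fun this g

theorem hom_ext_succ {n : ℕ} {G : Type*} [Group G] {f g : FreeGroup (Fin (n + 1)) →* G}
    (h : f.comp (FreeGroup.map Fin.castSucc) = g.comp (FreeGroup.map Fin.castSucc))
    (hl : f (FreeGroup.of (Fin.last n)) = g (FreeGroup.of (Fin.last n))) : f = g := by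
  ext i
  refine Fin.lastCases hl (fun i => ?_) i
  simpa using DFunLike.congr_fun h (FreeGroup.of i)

theorem exists_pathClass {Γ : PointedGraph} {v w : Γ.V} (h : Γ.Conn Set.univ v w) :
    ∃ g, Γ.PathClass v w g := by
  unfold PointedGraph.Conn at h
  induction h with
  | rel x y h =>
    obtain ⟨e, _, rfl, rfl⟩ := h
    exact ⟨_, .fwd e 1 .refl⟩
  | refl x => exact ⟨1, .refl⟩
  | symm x y _ ih => exact ⟨_, ih.choose_spec.symm⟩
  | trans x y z _ _ ih1 ih2 => exact ⟨_, ih1.choose_spec.trans ih2.choose_spec⟩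

/-- A marking is split injective. -/
theorem MarkedGraph.exists_retraction {n : ℕ} (m : MarkedGraph n) :
    ∃ r : FreeGroup m.graph.E →* FreeGroup (Fin n), r.comp m.marking = MonoidHom.id _ := by
  classical
  have hex : ∀ v, ∃ g, m.graph.PathClass m.graph.base v g ∧ (v = m.graph.base → g = 1) := by
    intro v
    by_cases hv : v = m.graph.base
    · subst hv
      exact ⟨1, .refl, fun _ => rfl⟩
    · obtain ⟨g, hg⟩ := exists_pathClass (m.reduced.connected m.graph.base v)
      exact ⟨g, hg, fun h => absurd h hv⟩
  choose t ht ht' using hex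
  have hinv : ∀ g, m.graph.PathClass m.graph.base m.graph.base g → ∃ x, m.marking x = g := by
    intro g hg
    have : g ∈ m.graph.pi1 := hg
    rw [← m.marking_range] at this
    exact this
  have hclosed : ∀ e, m.graph.PathClass m.graph.base m.graph.base
      (t (m.graph.src e) * FreeGroup.of e * (t (m.graph.tgt e))⁻¹) := fun e =>
    (PathClass.fwd e _ (ht _)).trans (ht _).symm
  choose l hl using fun e => hinv _ (hclosed e)
  let r : FreeGroup m.graph.E →* FreeGroup (Fin n) := FreeGroup.lift l
  have hr : ∀ w g, m.graph.PathClass m.graph.base w g → m.marking (r g) = g * (t w)⁻¹ := by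
    intro w g hg
    induction hg with
    | refl => rw [ht' _ rfl]; simp
    | fwd e k _ ih =>
      rw [map_mul, map_mul, ih, show r (FreeGroup.of e) = l e from FreeGroup.lift_apply_of, hl]
      group
    | bwd e k _ ih =>
      rw [map_mul, map_mul, ih, map_inv, map_inv,
        show r (FreeGroup.of e) = l e from FreeGroup.lift_apply_of, hl]
      group
  refine ⟨r, ?_⟩
  ext i
  apply m.marking_injective
  have hmem : m.marking (FreeGroup.of i) ∈ m.graph.pi1 := by
    rw [← m.marking_range]
    exact ⟨_, rfl⟩
  have := hr _ _ hmem
  rw [ht' _ rfl, inv_one, mul_one] at this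
  exact this

/-- The marked graph with a loop wedged on at the basepoint; the marking sends the new generator to
the new loop. -/
def MarkedGraph.stab {n : ℕ} (m : MarkedGraph n) : MarkedGraph (n + 1) where
  graph := m.graph.wedgeLoop
  reduced := m.reduced.wedge
  marking := extendMarking m.marking
  marking_injective := by
    obtain ⟨r, hr⟩ := m.exists_retraction
    let r' : FreeGroup (Option m.graph.E) →* FreeGroup (Fin (n + 1)) :=
      FreeGroup.lift fun e => e.elim (FreeGroup.of (Fin.last n))
        fun a => FreeGroup.map Fin.castSucc (r (FreeGroup.of a))
    have hr' : ∀ g, r' (FreeGroup.map some g) = FreeGroup.map Fin.castSucc (r g) := by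
      intro g
      have : r'.comp (FreeGroup.map some) = (FreeGroup.map Fin.castSucc).comp r := by
        ext e
        simp [r']
      exact DFunLike.congr_fun this g
    have hcomp : r'.comp (extendMarking m.marking) = MonoidHom.id _ := by
      apply hom_ext_succ
      · ext i
        have h1 : r (m.marking (FreeGroup.of i)) = FreeGroup.of i :=
          DFunLike.congr_fun hr (FreeGroup.of i)
        rw [MonoidHom.comp_apply, MonoidHom.comp_apply, extendMarking_map, hr', h1]
        rfl
      · rw [MonoidHom.comp_apply, extendMarking_last]
        simp [r']
    exact Function.LeftInverse.injective (g := r') fun x => DFunLike.congr_fun hcomp x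
  marking_range := by
    have hmap : ∀ v w g, m.graph.PathClass v w g →
        m.graph.wedgeLoop.PathClass v w (FreeGroup.map some g) := by
      intro v w g hg
      induction hg with
      | refl => rw [map_one]; exact .refl
      | fwd e k _ ih =>
        rw [map_mul, FreeGroup.map.of]
        exact PathClass.fwd (Γ := m.graph.wedgeLoop) (some e) _ ih
      | bwd e k _ ih =>
        rw [map_mul, map_inv, FreeGroup.map.of]
        exact PathClass.bwd (Γ := m.graph.wedgeLoop) (some e) _ ih
    apply le_antisymm
    · rintro _ ⟨x, rfl⟩
      induction x using FreeGroup.induction_on with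
      | C1 => rw [map_one]; exact one_mem _
      | of i =>
        refine Fin.lastCases ?_ (fun i => ?_) i
        · rw [extendMarking_last]
          have := PathClass.fwd (Γ := m.graph.wedgeLoop) none 1
            (PathClass.refl (Γ := m.graph.wedgeLoop) (v := m.graph.base))
          rw [one_mul] at this
          exact this
        · have h1 := extendMarking_map m.marking (FreeGroup.of i)
          rw [FreeGroup.map.of] at h1
          rw [h1]
          have hmem : m.marking (FreeGroup.of i) ∈ m.graph.pi1 := by
            rw [← m.marking_range]
            exact ⟨_, rfl⟩
          exact hmap _ _ _ hmem
      | inv_of i ih => rw [map_inv]; exact inv_mem ih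
      | mul x y hx hy => rw [map_mul]; exact mul_mem hx hy
    · have key : ∀ w g, m.graph.wedgeLoop.PathClass m.graph.base w g →
          ∃ x h, m.graph.PathClass m.graph.base w h ∧
            g = extendMarking m.marking x * FreeGroup.map some h := by
        have hcl : ∀ h, m.graph.PathClass m.graph.base m.graph.base h →
            ∃ y, FreeGroup.map some h = extendMarking m.marking y := by
          intro h hh
          have : h ∈ m.graph.pi1 := hh
          rw [← m.marking_range] at this
          obtain ⟨y, rfl⟩ := this
          exact ⟨_, (extendMarking_map _ y).symm⟩
        intro w g hg
        induction hg with
        | refl => exact ⟨1, 1, .refl, by simp⟩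
        | fwd e k _ ih =>
          obtain ⟨x, h, hh, rfl⟩ := ih
          cases e with
          | none =>
            obtain ⟨y, hy⟩ := hcl h hh
            refine ⟨x * y * FreeGroup.of (Fin.last n), 1, .refl, ?_⟩
            rw [hy, map_mul, map_mul, extendMarking_last, map_one, mul_one]
          | some e =>
            refine ⟨x, _, .fwd e h hh, ?_⟩
            rw [map_mul, FreeGroup.map.of, mul_assoc]
        | bwd e k _ ih =>
          obtain ⟨x, h, hh, rfl⟩ := ih
          cases e with
          | none =>
            obtain ⟨y, hy⟩ := hcl h hh
            refine ⟨x * y * (FreeGroup.of (Fin.last n))⁻¹, 1, .refl, ?_⟩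
            rw [hy, map_mul, map_mul, map_inv, extendMarking_last, map_one, mul_one]
          | some e =>
            refine ⟨x, _, .bwd e h hh, ?_⟩
            rw [map_mul, map_inv, FreeGroup.map.of, mul_assoc]
      intro g hg
      obtain ⟨x, h, hh, rfl⟩ := key _ g hg
      have : h ∈ m.graph.pi1 := hh
      rw [← m.marking_range] at this
      obtain ⟨y, rfl⟩ := this
      exact ⟨x * FreeGroup.map Fin.castSucc y, by rw [map_mul, extendMarking_map]⟩

/-- The map on vertices that wedges a loop on at the basepoint. -/
def AuterVertex.stab {n : ℕ} : AuterVertex n → AuterVertex (n + 1) :=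
  Quotient.map MarkedGraph.stab (by
    rintro m m' ⟨α, h⟩
    refine ⟨α.wedge, ?_⟩
    apply hom_ext_succ
    · ext i
      change α.wedge.hom (extendMarking m.marking (FreeGroup.map Fin.castSucc (FreeGroup.of i))) =
        extendMarking m'.marking (FreeGroup.map Fin.castSucc (FreeGroup.of i))
      rw [extendMarking_map, extendMarking_map, α.wedge_hom_map, ← h]
      rfl
    · change α.wedge.hom (extendMarking m.marking (FreeGroup.of (Fin.last n))) =
        extendMarking m'.marking (FreeGroup.of (Fin.last n))
      rw [extendMarking_last, extendMarking_last, α.wedge_hom_none])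

theorem AuterVertex.stab_collapsesTo {n : ℕ} {v w : AuterVertex n} (h : v.CollapsesTo w) :
    v.stab.CollapsesTo w.stab := by
  obtain ⟨m, m', rfl, rfl, F, hF, α, hα⟩ := h
  refine ⟨m.stab, m'.stab, rfl, rfl, (some '' F : Set (Option m.graph.E)), isForest_some hF,
    (m.graph.collapseWedge F).trans α.wedge, ?_⟩
  erw [Iso.trans_hom]
  apply hom_ext_succ
  · ext i
    change α.wedge.hom ((m.graph.collapseWedge F).hom (collapseHom (Γ := m.graph.wedgeLoop)
      (some '' F : Set (Option m.graph.E))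
      (extendMarking m.marking (FreeGroup.map Fin.castSucc (FreeGroup.of i))))) =
        extendMarking m'.marking (FreeGroup.map Fin.castSucc (FreeGroup.of i))
    rw [extendMarking_map, extendMarking_map, collapseWedge_hom_map, ← hα]
    exact α.wedge_hom_map _
  · change α.wedge.hom ((m.graph.collapseWedge F).hom (collapseHom (Γ := m.graph.wedgeLoop)
      (some '' F : Set (Option m.graph.E))
      (extendMarking m.marking (FreeGroup.of (Fin.last n))))) =
        extendMarking m'.marking (FreeGroup.of (Fin.last n))
    rw [extendMarking_last, extendMarking_last, collapseWedge_hom_none]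
    exact α.wedge_hom_none

theorem AuterVertex.stab_isCactusVertex {n c : ℕ} {v : AuterVertex n} (h : v.IsCactusVertex c) :
    v.stab.IsCactusVertex c := by
  obtain ⟨m, rfl, hcac, hsym, hc⟩ := h
  refine ⟨m.stab, rfl, hcac.wedge, ?_, ?_⟩
  · intro T hT i
    have hT' := isMaximalTree_of_wedge hT
    have hnone : (none : Option m.graph.E) ∉ T := fun hn =>
      hT.1 ({none} : Set (Option m.graph.E)) (Set.singleton_subset_iff.2 hn) isReducedCycle_loop
    let θ : FreeGroup {e : m.graph.E // e ∉ {e | some e ∈ T}} →*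
        FreeGroup {e : Option m.graph.E // e ∉ T} := FreeGroup.map fun e => ⟨some e.1, e.2⟩
    have hθ : ∀ g, collapseHom (Γ := m.graph.wedgeLoop) T (FreeGroup.map some g) =
        θ (collapseHom {e | some e ∈ T} g) := by
      intro g
      have : (collapseHom (Γ := m.graph.wedgeLoop) T).comp
          (FreeGroup.map (some : m.graph.E → Option m.graph.E)) =
          θ.comp (collapseHom {e | some e ∈ T}) := by
        ext e
        by_cases he : (some e : Option m.graph.E) ∈ T
        · simp only [MonoidHom.comp_apply, collapseHom, FreeGroup.map.of]
          erw [FreeGroup.lift_apply_of, FreeGroup.lift_apply_of, dif_pos he, dif_pos he, map_one]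
        · simp only [MonoidHom.comp_apply, collapseHom, FreeGroup.map.of]
          erw [FreeGroup.lift_apply_of, FreeGroup.lift_apply_of, dif_neg he, dif_neg he,
            FreeGroup.map.of]
      exact DFunLike.congr_fun this g
    refine Fin.lastCases ?_ (fun i => ?_) i
    · refine ⟨⟨(none : Option m.graph.E), hnone⟩, Or.inl ?_⟩
      change IsConj (collapseHom (Γ := m.graph.wedgeLoop) T
        (extendMarking m.marking (FreeGroup.of (Fin.last n)))) _
      rw [extendMarking_last]
      unfold collapseHom
      erw [FreeGroup.lift_apply_of, dif_neg hnone]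
      exact IsConj.refl _
    · obtain ⟨e, he⟩ := hsym _ hT' i
      refine ⟨⟨some e.1, e.2⟩, ?_⟩
      have h1 : collapseHom (Γ := m.graph.wedgeLoop) T
          (extendMarking m.marking (FreeGroup.of i.castSucc)) =
          θ (collapseHom {e | some e ∈ T} (m.marking (FreeGroup.of i))) := by
        rw [← hθ, ← extendMarking_map, FreeGroup.map.of]
      change IsConj (collapseHom (Γ := m.graph.wedgeLoop) T
          (extendMarking m.marking (FreeGroup.of i.castSucc))) _ ∨
        IsConj (collapseHom (Γ := m.graph.wedgeLoop) T
          (extendMarking m.marking (FreeGroup.of i.castSucc))) _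
      rw [h1]
      rcases he with he | he
      · exact Or.inl (θ.map_isConj he)
      · have h2 := θ.map_isConj he
        rw [map_inv] at h2
        exact Or.inr h2
  · have hw := m.graph.weight_wedge
    unfold MarkedGraph.coweight at hc ⊢
    change ((n + 1 : ℕ) : ℤ) - (m.graph.wedgeLoop.weight : ℤ) ≤ c
    push_cast
    omega

/-- The embedding of `ΣK_{n,c}` into `ΣK_{n+1,c}`. -/
def stabK (n c : ℕ) : SigmaK n c → SigmaK (n + 1) c :=
  Realization.map AuterVertex.stab
    (image_mem_cactusComplex (fun _ _ => AuterVertex.stab_collapsesTo)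
      (fun _ => AuterVertex.stab_isCactusVertex))

/-- An endomorphism of `F_n`, extended to `F_{n+1}` by fixing the new generator. -/
def extendHom {n : ℕ} (f : FreeGroup (Fin n) →* FreeGroup (Fin n)) :
    FreeGroup (Fin (n + 1)) →* FreeGroup (Fin (n + 1)) :=
  FreeGroup.lift (Fin.lastCases (FreeGroup.of (Fin.last n)) fun i =>
    FreeGroup.map Fin.castSucc (f (FreeGroup.of i)))

theorem extendHom_last {n : ℕ} (f : FreeGroup (Fin n) →* FreeGroup (Fin n)) :
    extendHom f (FreeGroup.of (Fin.last n)) = FreeGroup.of (Fin.last n) := by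
  simp [extendHom]

theorem extendHom_map {n : ℕ} (f : FreeGroup (Fin n) →* FreeGroup (Fin n))
    (g : FreeGroup (Fin n)) :
    extendHom f (FreeGroup.map Fin.castSucc g) = FreeGroup.map Fin.castSucc (f g) := by
  have : (extendHom f).comp (FreeGroup.map Fin.castSucc) =
      (FreeGroup.map Fin.castSucc).comp f := by
    ext i
    simp [extendHom]
  exact DFunLike.congr_fun this g

theorem extendHom_comp {n : ℕ} {f g : FreeGroup (Fin n) →* FreeGroup (Fin n)}
    (h : f.comp g = MonoidHom.id _) : (extendHom f).comp (extendHom g) = MonoidHom.id _ := by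
  apply hom_ext_succ
  · ext i
    rw [MonoidHom.comp_apply, MonoidHom.comp_apply, extendHom_map, extendHom_map,
      show f (g (FreeGroup.of i)) = FreeGroup.of i from DFunLike.congr_fun h _]
    rfl
  · rw [MonoidHom.comp_apply, extendHom_last, extendHom_last]
    rfl

/-- The inclusion of `Aut(F_n)` into `Aut(F_{n+1})`. -/
def extendAut {n : ℕ} (φ : MulAut (FreeGroup (Fin n))) : MulAut (FreeGroup (Fin (n + 1))) :=
  MonoidHom.toMulEquiv (extendHom φ.toMonoidHom) (extendHom φ.symm.toMonoidHom)
    (extendHom_comp (by ext i; simp)) (extendHom_comp (by ext i; simp))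

theorem extendAut_mem {n : ℕ} {φ : MulAut (FreeGroup (Fin n))} (hφ : φ ∈ SAut n) :
    extendAut φ ∈ SAut (n + 1) := by
  intro i
  refine Fin.lastCases ?_ (fun i => ?_) i
  · refine ⟨Fin.last n, Or.inl ?_⟩
    change IsConj (extendHom φ.toMonoidHom (FreeGroup.of (Fin.last n))) _
    rw [extendHom_last]
  · obtain ⟨j, hj⟩ := hφ i
    refine ⟨j.castSucc, ?_⟩
    have h1 := extendHom_map φ.toMonoidHom (FreeGroup.of i)
    rw [FreeGroup.map.of] at h1
    change IsConj (extendHom φ.toMonoidHom (FreeGroup.of i.castSucc)) _ ∨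
      IsConj (extendHom φ.toMonoidHom (FreeGroup.of i.castSucc)) _
    rw [h1]
    rcases hj with hj | hj
    · left
      simpa using (FreeGroup.map (Fin.castSucc : Fin n → Fin (n + 1))).map_isConj hj
    · right
      simpa using (FreeGroup.map (Fin.castSucc : Fin n → Fin (n + 1))).map_isConj hj

theorem AuterVertex.stab_act {n : ℕ} (φ : MulAut (FreeGroup (Fin n))) (v : AuterVertex n) :
    (v.act φ).stab = v.stab.act (extendAut φ) := by
  obtain ⟨m, rfl⟩ := Quotient.exists_rep v
  refine Quotient.sound ⟨Iso.refl _, ?_⟩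
  erw [Iso.refl_hom, MonoidHom.id_comp]
  apply hom_ext_succ
  · ext i
    change extendMarking (m.marking.comp φ.toMonoidHom)
        (FreeGroup.map Fin.castSucc (FreeGroup.of i)) =
      extendMarking m.marking
        (extendHom φ.toMonoidHom (FreeGroup.map Fin.castSucc (FreeGroup.of i)))
    rw [extendMarking_map, extendHom_map, extendMarking_map]
    rfl
  · change extendMarking (m.marking.comp φ.toMonoidHom) (FreeGroup.of (Fin.last n)) =
      extendMarking m.marking (extendHom φ.toMonoidHom (FreeGroup.of (Fin.last n)))
    rw [extendMarking_last, extendHom_last, extendMarking_last]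

/-- The map `ι : ΣQ_{n,c} → ΣQ_{n+1,c}` of orbit spaces that is induced by wedging a loop on at the
basepoint. -/
def iota (n c : ℕ) : SigmaQ n c → SigmaQ (n + 1) c :=
  Quotient.map (stabK n c) (by
    rintro x y ⟨φ, rfl⟩
    refine ⟨MulOpposite.op ⟨extendAut φ.unop.1, extendAut_mem φ.unop.2⟩, ?_⟩
    refine Subtype.ext ?_
    change Finsupp.mapDomain (AuterVertex.act (extendAut φ.unop.1))
        (Finsupp.mapDomain AuterVertex.stab y.1) =
      Finsupp.mapDomain AuterVertex.stab (Finsupp.mapDomain (AuterVertex.act φ.unop.1) y.1)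
    rw [← Finsupp.mapDomain_comp, ← Finsupp.mapDomain_comp]
    congr 1
    funext v
    exact (AuterVertex.stab_act φ.unop.1 v).symm)

end CactusSpace

end

/-! The orbit space is described by unmarked metric graphs. A point of the realization is a chain of
forests in one marked graph with barycentric weights. Giving each edge the total weight of the
forests that miss it as its length yields a length function with values in [0,1] for which every
reduced cycle has an edge of length 1. Conversely, the sublevel sets {l < s} for 0 < s ≤ 1 form a
chain of forests, weighted by the Lebesgue measure of their levels (`bary_of_chain`,
`bary_sum_notMem`). A cactus graph has a symmetric marking, and any two differ by a symmetric
automorphism (`IsCac.exists_marking`, `exists_act_eq`), so passing to orbits forgets the marking.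
Hence ΣQ is a quotient of the disjoint union of the spaces `Met Γ` (`isQuotientMap_tauMap`). Edges
of length zero may be collapsed (`tau_restrict`), and graphs with positive lengths give the same
point only if they are isometric (`exists_iso_of_tau_eq`). The last fact rests on `cls_injOn`: a
forest is determined by the marked graph that its collapse produces.

In this model ι wedges on a loop of length 1 (`iota_tau`). The loop can be cancelled from an
isometry, so ι is injective. A graph with positive lengths is in the image if and only if it has a
loop at the basepoint. Since each graph has only finitely many such loops and finitely many
collapses, ι is a closed map.

Put N = n + 1. A cactus graph of rank N has N reduced cycles, w through the basepoint and f ≤ c away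
from it. If every cycle through the basepoint has j further vertices, each of these lies on a second
cycle, and the jw second cycles are distinct and miss the basepoint, so jw ≤ c (`mul_weight_le`).
Without loops at the basepoint, j = 1 gives N ≤ 2c; if there are no two-edge cycles at the basepoint
either, j = 2 gives 2N ≤ 3c. So 2c < N forces a loop and ι is onto.

If 3c < 2N, a graph without a loop at the basepoint has a pair of parallel edges there. One of the
two has length 1 and an automorphism interchanges them, so up to symmetry only the shorter length
varies, and the face where it equals 1 is free. Flowing away from a point beyond this face shortens
edges until one has length zero, which pushes the cell onto graphs with fewer vertices. Filtering by
the number of vertices, each stage deformation retracts to the previous one, and finitely many steps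
lead down to the image of ι. -/

noncomputable section

namespace CactusSpace

namespace PointedGraph

/-! ### Connectedness, simple paths and reduced cycles -/

section Basics

variable {Γ : PointedGraph}

theorem Conn.refl {S : Set Γ.E} (v : Γ.V) : Γ.Conn S v v := Relation.EqvGen.refl _

theorem Conn.symm {S : Set Γ.E} {v w : Γ.V} (h : Γ.Conn S v w) : Γ.Conn S w v :=
  Relation.EqvGen.symm _ _ h

theorem Conn.trans {S : Set Γ.E} {u v w : Γ.V} (h : Γ.Conn S u v) (h' : Γ.Conn S v w) :
    Γ.Conn S u w := Relation.EqvGen.trans _ _ _ h h'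

theorem Conn.edge {S : Set Γ.E} {e : Γ.E} (he : e ∈ S) : Γ.Conn S (Γ.src e) (Γ.tgt e) :=
  Relation.EqvGen.rel _ _ ⟨e, he, rfl, rfl⟩

/-- The relation `Conn S` is the smallest equivalence relation that relates the ends of the edges
in `S`. -/
theorem Conn.lift {S : Set Γ.E} {r : Γ.V → Γ.V → Prop} (hr : Equivalence r)
    (h : ∀ e ∈ S, r (Γ.src e) (Γ.tgt e)) {v w : Γ.V} (hc : Γ.Conn S v w) : r v w := by
  unfold Conn at hc
  induction hc with
  | rel x y h' =>
    obtain ⟨e, he, rfl, rfl⟩ := h'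
    exact h e he
  | refl x => exact hr.refl _
  | symm x y _ ih => exact hr.symm ih
  | trans x y z _ _ ih1 ih2 => exact hr.trans ih1 ih2

theorem Conn.bind {S S' : Set Γ.E} (h : ∀ e ∈ S, Γ.Conn S' (Γ.src e) (Γ.tgt e)) {v w : Γ.V}
    (hc : Γ.Conn S v w) : Γ.Conn S' v w :=
  hc.lift ⟨Conn.refl, Conn.symm, Conn.trans⟩ h

theorem Conn.mono {S S' : Set Γ.E} (h : S ⊆ S') {v w : Γ.V}
    (hc : Γ.Conn S v w) : Γ.Conn S' v w :=
  hc.bind fun _ he => .edge (h he)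

theorem Conn.map_eq {α : Type*} {S : Set Γ.E} (f : Γ.V → α)
    (h : ∀ e ∈ S, f (Γ.src e) = f (Γ.tgt e)) {v w : Γ.V} (hc : Γ.Conn S v w) : f v = f w :=
  hc.lift (r := fun v w => f v = f w) ⟨fun _ => rfl, Eq.symm, Eq.trans⟩ h

theorem Conn.mem_iff {S : Set Γ.E} {W : Set Γ.V}
    (h : ∀ e ∈ S, Γ.src e ∈ W ↔ Γ.tgt e ∈ W) {v w : Γ.V} (hc : Γ.Conn S v w) :
    v ∈ W ↔ w ∈ W :=
  hc.lift (r := fun v w => v ∈ W ↔ w ∈ W) ⟨fun _ => Iff.rfl, Iff.symm, Iff.trans⟩ h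

/-- Removing an edge cuts a path at one of the ends of the edge. -/
theorem Conn.remove_edge {S : Set Γ.E} {v w : Γ.V} (hc : Γ.Conn S v w) (e : Γ.E) :
    Γ.Conn (S \ {e}) v w ∨ Γ.Conn (S \ {e}) v (Γ.src e) ∨ Γ.Conn (S \ {e}) v (Γ.tgt e) := by
  by_contra! h
  have := hc.mem_iff (W := {x | Γ.Conn (S \ {e}) v x}) (fun f hf => ?_)
  · exact h.1 (this.1 (.refl _))
  · by_cases hfe : f = e
    · subst hfe
      simp [h.2.1, h.2.2]
    · have hf' : Γ.Conn (S \ {e}) (Γ.src f) (Γ.tgt f) := .edge ⟨hf, hfe⟩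
      exact ⟨fun h => h.trans hf', fun h => h.trans hf'.symm⟩

theorem valence_insert {S : Set Γ.E} {e : Γ.E} (he : e ∉ S) (v : Γ.V) [Decidable (Γ.src e = v)]
    [Decidable (Γ.tgt e = v)] :
    Γ.valence (insert e S) v =
      Γ.valence S v + ((if Γ.src e = v then 1 else 0) + (if Γ.tgt e = v then 1 else 0)) := by
  have key : ∀ (f : Γ.E → Γ.V) [Decidable (f e = v)], {a | a ∈ insert e S ∧ f a = v}.ncard =
      {a | a ∈ S ∧ f a = v}.ncard + (if f e = v then 1 else 0) := by
    intro f _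
    split_ifs with h
    · rw [show {a | a ∈ insert e S ∧ f a = v} = insert e {a | a ∈ S ∧ f a = v} by
        ext a; simp only [Set.mem_insert_iff, Set.mem_ofPred_eq]; grind]
      exact Set.ncard_insert_of_notMem (fun h => he h.1) (Set.toFinite _)
    · rw [show {a | a ∈ insert e S ∧ f a = v} = {a | a ∈ S ∧ f a = v} by
        ext a; simp only [Set.mem_insert_iff, Set.mem_ofPred_eq]; grind]
      rfl
  unfold valence
  rw [key Γ.src, key Γ.tgt]
  omega

theorem valence_empty (v : Γ.V) : Γ.valence ∅ v = 0 := by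
  simp [valence]

theorem valence_disjoint_union {S S' : Set Γ.E} (h : Disjoint S S') (v : Γ.V) :
    Γ.valence (S ∪ S') v = Γ.valence S v + Γ.valence S' v := by
  have key : ∀ (f : Γ.E → Γ.V), {a | a ∈ S ∪ S' ∧ f a = v}.ncard =
      {a | a ∈ S ∧ f a = v}.ncard + {a | a ∈ S' ∧ f a = v}.ncard := by
    intro f
    rw [← Set.ncard_union_eq (Set.disjoint_left.2 fun a ha ha' =>
      Set.disjoint_left.1 h ha.1 ha'.1) (Set.toFinite _) (Set.toFinite _)]
    congr 1
    ext a
    simp only [Set.mem_union, Set.mem_ofPred_eq]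
    tauto
  unfold valence
  rw [key Γ.src, key Γ.tgt]
  omega

theorem valence_pos_iff {S : Set Γ.E} {v : Γ.V} :
    0 < Γ.valence S v ↔ ∃ e ∈ S, Γ.src e = v ∨ Γ.tgt e = v := by
  unfold valence
  rw [Nat.add_pos_iff_pos_or_pos, Set.ncard_pos (Set.toFinite _), Set.ncard_pos (Set.toFinite _)]
  constructor
  · rintro (⟨e, he, h⟩ | ⟨e, he, h⟩)
    · exact ⟨e, he, Or.inl h⟩
    · exact ⟨e, he, Or.inr h⟩
  · rintro ⟨e, he, h | h⟩
    · exact Or.inl ⟨e, he, h⟩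
    · exact Or.inr ⟨e, he, h⟩

/-- If a set of edges is contained in another one and has the same valence at `v`, then the two
sets have the same edges at `v`. -/
theorem mem_of_valence_le {S S' : Set Γ.E} (h : S ⊆ S') {v : Γ.V}
    (hv : Γ.valence S' v ≤ Γ.valence S v) {e : Γ.E} (he : e ∈ S')
    (hev : Γ.src e = v ∨ Γ.tgt e = v) : e ∈ S := by
  classical
  by_contra hn
  have h1 := valence_insert hn v
  have h2 := valence_mono (Γ := Γ) (Set.insert_subset he h) v
  rcases hev with hev | hev <;> rw [if_pos hev] at h1 <;> omega

open Classical in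
/-- The handshake lemma for a set of vertices that is a union of components. -/
theorem even_sum_valence (S : Set Γ.E) (W : Finset Γ.V)
    (hW : ∀ e ∈ S, Γ.src e ∈ W ↔ Γ.tgt e ∈ W) : Even (∑ v ∈ W, Γ.valence S v) := by
  induction S, Set.toFinite S using Set.Finite.induction_on with
  | empty => simp [valence_empty]
  | @insert e S he _ ih =>
    have h1 := ih fun a ha => hW a (Set.mem_insert_of_mem _ ha)
    simp only [valence_insert he, Finset.sum_add_distrib, Finset.sum_ite_eq]
    refine h1.add ?_
    have h2 := hW e (Set.mem_insert _ _)
    by_cases h : Γ.src e ∈ W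
    · rw [if_pos h, if_pos (h2.1 h)]; decide
    · rw [if_neg h, if_neg (fun h' => h (h2.2 h'))]; decide

variable (Γ) in
/-- `PathIn S v w g`: the element `g` is spelled by an edge path from `v` to `w` with edges in
`S`. -/
inductive PathIn (S : Set Γ.E) (v : Γ.V) : Γ.V → FreeGroup Γ.E → Prop
  | refl : PathIn S v v 1
  | fwd (e : Γ.E) (g : FreeGroup Γ.E) (he : e ∈ S) :
      PathIn S v (Γ.src e) g → PathIn S v (Γ.tgt e) (g * FreeGroup.of e)
  | bwd (e : Γ.E) (g : FreeGroup Γ.E) (he : e ∈ S) :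
      PathIn S v (Γ.tgt e) g → PathIn S v (Γ.src e) (g * (FreeGroup.of e)⁻¹)

namespace PathIn

variable {S S' : Set Γ.E} {u v w : Γ.V} {g h : FreeGroup Γ.E}

theorem trans (hg : Γ.PathIn S u v g) (hh : Γ.PathIn S v w h) : Γ.PathIn S u w (g * h) := by
  induction hh with
  | refl => simpa using hg
  | fwd e k he _ ih => rw [← mul_assoc]; exact .fwd e _ he ih
  | bwd e k he _ ih => rw [← mul_assoc]; exact .bwd e _ he ih

theorem of_mem {e : Γ.E} (he : e ∈ S) : Γ.PathIn S (Γ.src e) (Γ.tgt e) (FreeGroup.of e) := by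
  simpa using fwd e 1 he refl

theorem inv_of_mem {e : Γ.E} (he : e ∈ S) :
    Γ.PathIn S (Γ.tgt e) (Γ.src e) (FreeGroup.of e)⁻¹ := by
  simpa using bwd e 1 he refl

theorem symm (hg : Γ.PathIn S v w g) : Γ.PathIn S w v g⁻¹ := by
  induction hg with
  | refl => rw [inv_one]; exact .refl
  | fwd e k he _ ih =>
    rw [mul_inv_rev]
    exact (inv_of_mem he).trans ih
  | bwd e k he _ ih =>
    rw [mul_inv_rev, inv_inv]
    exact (of_mem he).trans ih

theorem mono (hS : S ⊆ S') (hg : Γ.PathIn S v w g) : Γ.PathIn S' v w g := by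
  induction hg with
  | refl => exact .refl
  | fwd e k he _ ih => exact .fwd e k (hS he) ih
  | bwd e k he _ ih => exact .bwd e k (hS he) ih

theorem pathClass (hg : Γ.PathIn S v w g) : Γ.PathClass v w g := by
  induction hg with
  | refl => exact .refl
  | fwd e k he _ ih => exact .fwd e k ih
  | bwd e k he _ ih => exact .bwd e k ih

theorem of_pathClass (hg : Γ.PathClass v w g) : Γ.PathIn Set.univ v w g := by
  induction hg with
  | refl => exact .refl
  | fwd e k _ ih => exact .fwd e k trivial ih
  | bwd e k _ ih => exact .bwd e k trivial ih

/-- A homomorphism that is a difference of vertex labels on the edges of a path is one on the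
path. -/
theorem hom_eq {G : Type*} [Group G] {φ : FreeGroup Γ.E →* G} {t : Γ.V → G}
    (ht : ∀ e ∈ S, φ (FreeGroup.of e) = (t (Γ.src e))⁻¹ * t (Γ.tgt e)) (hg : Γ.PathIn S v w g) :
    φ g = (t v)⁻¹ * t w := by
  induction hg with
  | refl => simp
  | fwd e k he _ ih => rw [map_mul, ih, ht e he]; group
  | bwd e k he _ ih => rw [map_mul, map_inv, ih, ht e he]; group

/-- The trivial subgroup shows that a path of killed edges is killed. A point stabilizer in a
permutation group serves to show that a word cannot be spelled without a certain edge. -/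
theorem hom_mem {G : Type*} [Group G] {φ : FreeGroup Γ.E →* G} {H : Subgroup G}
    (hH : ∀ e ∈ S, φ (FreeGroup.of e) ∈ H) (hg : Γ.PathIn S v w g) : φ g ∈ H := by
  induction hg with
  | refl => rw [map_one]; exact one_mem _
  | fwd e k he _ ih => rw [map_mul]; exact mul_mem ih (hH e he)
  | bwd e k he _ ih => rw [map_mul, map_inv]; exact mul_mem ih (inv_mem (hH e he))

end PathIn

theorem Conn.exists_pathIn {S : Set Γ.E} {v w : Γ.V} (h : Γ.Conn S v w) : ∃ g, Γ.PathIn S v w g :=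
  h.lift (r := fun v w => ∃ g, Γ.PathIn S v w g)
    ⟨fun _ => ⟨1, .refl⟩, fun ⟨_, h⟩ => ⟨_, h.symm⟩, fun ⟨_, h⟩ ⟨_, h'⟩ => ⟨_, h.trans h'⟩⟩
    fun _ he => ⟨_, .of_mem he⟩

variable (Γ) in
/-- `SimplePath a b P W`: the edge set `P` and the vertex set `W` form an embedded path from `a` to
`b`. -/
inductive SimplePath : Γ.V → Γ.V → Set Γ.E → Set Γ.V → Prop
  | nil (a : Γ.V) : SimplePath a a ∅ {a}
  | cons {e : Γ.E} {a a' b : Γ.V} {P : Set Γ.E} {W : Set Γ.V}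
      (he : (Γ.src e = a ∧ Γ.tgt e = a') ∨ (Γ.src e = a' ∧ Γ.tgt e = a))
      (hp : SimplePath a' b P W) (ha : a ∉ W) : SimplePath a b (insert e P) (insert a W)

namespace SimplePath

variable {a b : Γ.V} {P : Set Γ.E} {W : Set Γ.V}

theorem left_mem (h : Γ.SimplePath a b P W) : a ∈ W := by
  cases h with
  | nil => rfl
  | cons => exact Set.mem_insert _ _

theorem ends_mem (h : Γ.SimplePath a b P W) {e : Γ.E} (he : e ∈ P) : Γ.src e ∈ W ∧ Γ.tgt e ∈ W := by
  induction h with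
  | nil => exact he.elim
  | @cons e' a a' b P W he' hp ha ih =>
    rcases he with rfl | he
    · rcases he' with ⟨rfl, rfl⟩ | ⟨rfl, rfl⟩
      · exact ⟨Set.mem_insert _ _, Set.mem_insert_of_mem _ hp.left_mem⟩
      · exact ⟨Set.mem_insert_of_mem _ hp.left_mem, Set.mem_insert _ _⟩
    · exact ⟨Set.mem_insert_of_mem _ (ih he).1, Set.mem_insert_of_mem _ (ih he).2⟩

theorem edge_notMem {e : Γ.E} {a a' : Γ.V} (hp : Γ.SimplePath a' b P W) (ha : a ∉ W)
    (he : (Γ.src e = a ∧ Γ.tgt e = a') ∨ (Γ.src e = a' ∧ Γ.tgt e = a)) : e ∉ P := by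
  intro h
  rcases he with he | he
  · exact ha (he.1 ▸ (hp.ends_mem h).1)
  · exact ha (he.2 ▸ (hp.ends_mem h).2)

theorem conn (h : Γ.SimplePath a b P W) {v : Γ.V} (hv : v ∈ W) : Γ.Conn P a v := by
  induction h with
  | nil => rw [show v = _ from hv]; exact .refl _
  | @cons e a a' b P W he' hp ha ih =>
    rcases hv with rfl | hv
    · exact .refl _
    · refine Conn.trans ?_ ((ih hv).mono (Set.subset_insert _ _))
      have := Conn.edge (Set.mem_insert e P)
      rcases he' with ⟨rfl, rfl⟩ | ⟨rfl, rfl⟩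
      · exact this
      · exact this.symm

theorem right_mem (h : Γ.SimplePath a b P W) : b ∈ W := by
  induction h with
  | nil => rfl
  | cons _ _ _ ih => exact Set.mem_insert_of_mem _ ih

-- The end terms make up for the missing half-edges, as if the path were closed up by an extra edge
-- from `b` to `a`. In this form the formula also covers the trivial path.
open Classical in
theorem valence (h : Γ.SimplePath a b P W) (v : Γ.V) :
    Γ.valence P v + ((if a = v then 1 else 0) + (if b = v then 1 else 0)) =
      if v ∈ W then 2 else 0 := by
  induction h with
  | nil a =>
    rw [valence_empty]
    by_cases h : a = v
    · subst h; simp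
    · have : v ∉ ({a} : Set Γ.V) := fun h' => h h'.symm
      simp [h, this]
  | @cons e a a' b P W he' hp ha ih =>
    rw [valence_insert (hp.edge_notMem ha he')]
    have hsum : (if Γ.src e = v then 1 else 0) + (if Γ.tgt e = v then 1 else 0) =
        (if a = v then 1 else 0) + (if a' = v then 1 else 0) := by
      rcases he' with ⟨rfl, rfl⟩ | ⟨rfl, rfl⟩
      · rfl
      · exact Nat.add_comm _ _
    rw [hsum]
    by_cases hav : a = v
    · subst hav
      rw [if_neg ha] at ih
      rw [if_pos (Set.mem_insert _ _)]
      simp only [if_true]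
      omega
    · have : v ∈ insert a W ↔ v ∈ W := by
        simp [Set.mem_insert_iff, Ne.symm hav]
      simp only [this]
      rw [if_neg hav]
      omega

/-- An embedded path from a vertex on an embedded path to the end. -/
theorem suffix (h : Γ.SimplePath a b P W) {v : Γ.V} (hv : v ∈ W) :
    ∃ P' W', P' ⊆ P ∧ Γ.SimplePath v b P' W' := by
  induction h with
  | nil a =>
    rw [show v = a from hv]
    exact ⟨_, _, subset_rfl, .nil a⟩
  | @cons e a a' b P W he' hp ha ih =>
    rcases hv with rfl | hv
    · exact ⟨_, _, subset_rfl, .cons he' hp ha⟩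
    · obtain ⟨P', W', h1, h2⟩ := ih hv
      exact ⟨P', W', h1.trans (Set.subset_insert _ _), h2⟩

/-- The word spelled by an embedded path: every edge of the path occurs exactly once. -/
theorem exists_word (h : Γ.SimplePath a b P W) :
    ∃ g, Γ.PathIn P a b g ∧ (∀ (G : Type) [Group G] (φ : FreeGroup Γ.E →* G),
      (∀ f ∈ P, φ (FreeGroup.of f) = 1) → φ g = 1) ∧
      ∀ e ∈ P, ∀ (G : Type) [Group G] (φ : FreeGroup Γ.E →* G),
        (∀ f ∈ P, f ≠ e → φ (FreeGroup.of f) = 1) →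
          φ g = φ (FreeGroup.of e) ∨ φ g = (φ (FreeGroup.of e))⁻¹ := by
  induction h with
  | nil a => exact ⟨1, .refl, fun _ _ _ _ => map_one _, fun _ h => h.elim⟩
  | @cons e a a' b P W he' hp ha ih =>
    obtain ⟨g, hg, h1, h2⟩ := ih
    have hstep : ∃ k, Γ.PathIn (insert e P) a a' k ∧ (k = FreeGroup.of e ∨ k = (FreeGroup.of e)⁻¹) := by
      rcases he' with ⟨rfl, rfl⟩ | ⟨rfl, rfl⟩
      · exact ⟨_, .of_mem (Set.mem_insert _ _), Or.inl rfl⟩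
      · exact ⟨_, .inv_of_mem (Set.mem_insert _ _), Or.inr rfl⟩
    obtain ⟨k, hk, hk'⟩ := hstep
    refine ⟨k * g, hk.trans (hg.mono (Set.subset_insert _ _)), fun G _ φ hφ => ?_, fun f hf G _ φ hφ => ?_⟩
    · rw [map_mul, h1 G φ fun f hf => hφ f (Set.mem_insert_of_mem _ hf)]
      have := hφ e (Set.mem_insert _ _)
      rcases hk' with rfl | rfl <;> simp [this]
    · have hne := hp.edge_notMem ha he'
      rcases hf with rfl | hf
      · rw [map_mul, h1 G φ fun f' hf' => hφ f' (Set.mem_insert_of_mem _ hf')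
          (fun h => hne (h ▸ hf'))]
        rcases hk' with rfl | rfl <;> simp
      · rw [map_mul]
        have := hφ e (Set.mem_insert _ _) (fun h => hne (h ▸ hf))
        have hk1 : φ k = 1 := by rcases hk' with rfl | rfl <;> simp [this]
        rw [hk1, one_mul]
        exact h2 f hf G φ fun f' hf' hne' => hφ f' (Set.mem_insert_of_mem _ hf') hne'

end SimplePath

/-- The set of starting points of embedded paths to `b` is closed under adjacency: an edge either
extends the path or leads to a vertex already on it, and then a suffix will do. -/
theorem Conn.exists_simplePath {S : Set Γ.E} {a b : Γ.V} (h : Γ.Conn S a b) :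
    ∃ P W, P ⊆ S ∧ Γ.SimplePath a b P W := by
  have key : ∀ e ∈ S, (∃ P W, P ⊆ S ∧ Γ.SimplePath (Γ.src e) b P W) ↔
      ∃ P W, P ⊆ S ∧ Γ.SimplePath (Γ.tgt e) b P W := by
    intro e he
    constructor
    · rintro ⟨P, W, hP, hp⟩
      by_cases ht : Γ.tgt e ∈ W
      · obtain ⟨P', W', h1, h2⟩ := hp.suffix ht
        exact ⟨P', W', h1.trans hP, h2⟩
      · exact ⟨_, _, Set.insert_subset he hP, .cons (Or.inr ⟨rfl, rfl⟩) hp ht⟩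
    · rintro ⟨P, W, hP, hp⟩
      by_cases ht : Γ.src e ∈ W
      · obtain ⟨P', W', h1, h2⟩ := hp.suffix ht
        exact ⟨P', W', h1.trans hP, h2⟩
      · exact ⟨_, _, Set.insert_subset he hP, .cons (Or.inl ⟨rfl, rfl⟩) hp ht⟩
  exact (h.mem_iff (W := {x | ∃ P W, P ⊆ S ∧ Γ.SimplePath x b P W}) key).2
    ⟨∅, _, Set.empty_subset _, .nil b⟩

theorem SimplePath.isReducedCycle {e : Γ.E} {P : Set Γ.E} {W : Set Γ.V}
    (h : Γ.SimplePath (Γ.src e) (Γ.tgt e) P W) (he : e ∉ P) : Γ.IsReducedCycle (insert e P) := by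
  classical
  have hval : ∀ v ∈ W, Γ.valence (insert e P) v = 2 := by
    intro v hv
    rw [valence_insert he, h.valence v, if_pos hv]
  have hends : ∀ f ∈ insert e P, Γ.src f ∈ W ∧ Γ.tgt f ∈ W := by
    rintro f (rfl | hf)
    · exact ⟨h.left_mem, h.right_mem⟩
    · exact h.ends_mem hf
  exact ⟨⟨e, Set.mem_insert _ _⟩,
    fun f hf f' hf' => ((h.conn (hends f hf).1).symm.trans (h.conn (hends f' hf').1)).mono
      (Set.subset_insert _ _),
    fun f hf => hval _ (hends f hf).1, fun f hf => hval _ (hends f hf).2⟩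

/-- An edge whose ends are joined by a path that avoids the edge lies on a reduced cycle. -/
theorem exists_isReducedCycle {S : Set Γ.E} {e : Γ.E} (he : e ∉ S)
    (h : Γ.Conn S (Γ.src e) (Γ.tgt e)) :
    ∃ C, Γ.IsReducedCycle C ∧ e ∈ C ∧ C ⊆ insert e S := by
  obtain ⟨P, W, hP, hp⟩ := h.exists_simplePath
  exact ⟨_, hp.isReducedCycle fun h => he (hP h), Set.mem_insert _ _, Set.insert_subset_insert hP⟩

namespace IsReducedCycle

variable {C D : Set Γ.E}

theorem valence_eq (hC : Γ.IsReducedCycle C) {e : Γ.E} (he : e ∈ C) {v : Γ.V}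
    (hv : Γ.src e = v ∨ Γ.tgt e = v) : Γ.valence C v = 2 := by
  rcases hv with rfl | rfl
  · exact hC.valence_src e he
  · exact hC.valence_tgt e he

theorem conn_of_mem (hC : Γ.IsReducedCycle C) {e f : Γ.E} (he : e ∈ C) (hf : f ∈ C) {v w : Γ.V}
    (hv : Γ.src e = v ∨ Γ.tgt e = v) (hw : Γ.src f = w ∨ Γ.tgt f = w) : Γ.Conn C v w := by
  have h := hC.conn e he f hf
  rcases hv with rfl | rfl <;> rcases hw with rfl | rfl
  · exact h
  · exact h.trans (.edge hf)
  · exact (Conn.edge he).symm.trans h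
  · exact (Conn.edge he).symm.trans (h.trans (.edge hf))

/-- Removing an edge does not disconnect a reduced cycle. -/
theorem conn_diff (hC : Γ.IsReducedCycle C) {e : Γ.E} (he : e ∈ C) :
    Γ.Conn (C \ {e}) (Γ.src e) (Γ.tgt e) := by
  classical
  by_contra hn
  have := Fintype.ofFinite Γ.V
  let W : Finset Γ.V := Finset.univ.filter fun v => Γ.Conn (C \ {e}) (Γ.src e) v
  have hmem : ∀ v, v ∈ W ↔ Γ.Conn (C \ {e}) (Γ.src e) v := by simp [W]
  -- Parity argument: if the component `W` of one end of `e` misses the other end, its valences in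
  -- `C \ {e}` are all 2 except for a single 1, so that their sum is odd.
  have heven := even_sum_valence (C \ {e}) W (fun f hf => by
    rw [hmem, hmem]
    exact ⟨fun h => h.trans (.edge hf), fun h => h.trans (Conn.edge hf).symm⟩)
  have hne : Γ.src e ≠ Γ.tgt e := fun h => hn (h ▸ .refl _)
  have hval : ∀ v ∈ W, Γ.valence (C \ {e}) v + (if Γ.src e = v then 1 else 0) = 2 := by
    intro v hv
    have h1 := valence_insert (Γ := Γ) (S := C \ {e}) (e := e) (fun h => h.2 rfl) v
    rw [Set.insert_sdiff_singleton, Set.insert_eq_of_mem he,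
      if_neg (fun h : Γ.tgt e = v => hn (h ▸ (hmem v).1 hv)), add_zero] at h1
    rw [← h1]
    by_cases hv' : Γ.src e = v
    · exact hC.valence_eq he (Or.inl hv')
    · have hpos : 0 < Γ.valence (C \ {e}) v := by
        rw [valence_pos_iff]
        by_contra! hno
        have := ((hmem v).1 hv).mem_iff (W := {x | x ≠ v})
          (fun f hf => by
            have h := hno f hf
            simp [h.1, h.2])
        exact this.1 hv' rfl
      obtain ⟨f, hf, hfv⟩ := valence_pos_iff.1 hpos
      exact hC.valence_eq hf.1 hfv
  have hsum : ∑ v ∈ W, Γ.valence (C \ {e}) v + 1 = 2 * W.card := by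
    have h1 : ∑ v ∈ W, (Γ.valence (C \ {e}) v + (if Γ.src e = v then 1 else 0)) = ∑ v ∈ W, 2 :=
      Finset.sum_congr rfl hval
    rw [Finset.sum_add_distrib, Finset.sum_ite_eq, if_pos ((hmem _).2 (.refl _)),
      Finset.sum_const, smul_eq_mul] at h1
    omega
  obtain ⟨k, hk⟩ := heven
  omega

/-- At a vertex of `C` both cycles have valence 2, so `D` has no further edges there. Connectedness
of `D` spreads this to all of `D`. -/
theorem eq_of_subset (hC : Γ.IsReducedCycle C) (hD : Γ.IsReducedCycle D) (h : C ⊆ D) : C = D := by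
  refine h.antisymm fun e he => ?_
  obtain ⟨f, hf⟩ := hC.nonempty
  let W : Set Γ.V := {v | ∃ g ∈ C, Γ.src g = v ∨ Γ.tgt g = v}
  have hW : ∀ g ∈ D, (Γ.src g ∈ W ∨ Γ.tgt g ∈ W) → g ∈ C := by
    rintro g hg (⟨k, hk, hkv⟩ | ⟨k, hk, hkv⟩)
    · exact mem_of_valence_le h (by rw [hD.valence_src g hg, hC.valence_eq hk hkv]) hg (Or.inl rfl)
    · exact mem_of_valence_le h (by rw [hD.valence_tgt g hg, hC.valence_eq hk hkv]) hg (Or.inr rfl)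
  have := (hD.conn f (h hf) e he).mem_iff (W := W) fun g hg =>
    ⟨fun h' => ⟨g, hW g hg (Or.inl h'), Or.inr rfl⟩, fun h' => ⟨g, hW g hg (Or.inr h'), Or.inl rfl⟩⟩
  exact hW e he (Or.inl (this.1 ⟨f, hf, Or.inl rfl⟩))

/-- An embedded path in `C \ {e}` between the ends of `e` closes up to a reduced cycle inside `C`,
which is all of `C`. -/
theorem simplePath (hC : Γ.IsReducedCycle C) {e : Γ.E} (he : e ∈ C) :
    ∃ W, Γ.SimplePath (Γ.src e) (Γ.tgt e) (C \ {e}) W := by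
  obtain ⟨P, W, hP, hp⟩ := (hC.conn_diff he).exists_simplePath
  have heP : e ∉ P := fun h => (hP h).2 rfl
  have h1 := (hp.isReducedCycle heP).eq_of_subset hC
    (Set.insert_subset he (hP.trans Set.sdiff_subset))
  have : C \ {e} = P := by
    rw [← h1]
    ext f
    simp only [Set.mem_sdiff, Set.mem_insert_iff, Set.mem_singleton_iff]
    grind
  exact ⟨W, this ▸ hp⟩

/-- A reduced cycle that contains a loop consists of the loop. -/
theorem eq_singleton_of_loop (hC : Γ.IsReducedCycle C) {e : Γ.E} (he : e ∈ C)
    (hl : Γ.src e = Γ.tgt e) : C = {e} := by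
  obtain ⟨D, hD, -, hDe⟩ := exists_isReducedCycle (Γ := Γ) (S := ∅) (e := e) (by simp)
    (hl ▸ .refl _)
  have h1 : D = {e} := by
    obtain ⟨f, hf⟩ := hD.nonempty
    rw [insert_empty_eq] at hDe
    refine hDe.antisymm ?_
    rw [Set.singleton_subset_iff]
    have : f = e := hDe hf
    exact this ▸ hf
  rw [← h1]
  exact (hD.eq_of_subset hC (by rw [h1]; exact Set.singleton_subset_iff.2 he)).symm

end IsReducedCycle

theorem isReducedCycle_singleton {e : Γ.E} (h : Γ.src e = Γ.tgt e) : Γ.IsReducedCycle {e} := by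
  obtain ⟨D, hD, heD, hDe⟩ := exists_isReducedCycle (Γ := Γ) (S := ∅) (e := e) (by simp)
    (h ▸ .refl _)
  rwa [hD.eq_singleton_of_loop heD h] at hD

theorem IsForest.mono {F F' : Set Γ.E} (h : Γ.IsForest F') (hF : F ⊆ F') : Γ.IsForest F :=
  fun C hC => h C (hC.trans hF)

theorem isForest_empty : Γ.IsForest ∅ := fun _ hC h => by
  obtain ⟨e, he⟩ := h.nonempty
  exact hC he

theorem IsForest.src_ne_tgt {F : Set Γ.E} (h : Γ.IsForest F) {e : Γ.E} (he : e ∈ F) :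
    Γ.src e ≠ Γ.tgt e := fun hl =>
  h {e} (Set.singleton_subset_iff.2 he) (isReducedCycle_singleton hl)

end Basics

/-! ### Cactus graphs -/

section Cactus

variable {Γ : PointedGraph}

variable (Γ) in
/-- The reduced cycles of a graph. -/
def cycles : Set (Set Γ.E) := {C | Γ.IsReducedCycle C}

/-- The vertex `v` lies on the subgraph with edge set `S`. -/
def On (Γ : PointedGraph) (S : Set Γ.E) (v : Γ.V) : Prop := ∃ e ∈ S, Γ.src e = v ∨ Γ.tgt e = v

variable (Γ) in
/-- The reduced cycles that do not pass through the basepoint. -/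
def farCycles : Set (Set Γ.E) := {C | Γ.IsReducedCycle C ∧ ¬ Γ.On C Γ.base}

/-- As the rank of a cactus graph is its number of cycles, this turns the coweight into the number
of cycles that miss the basepoint. -/
theorem weight_add_ncard_farCycles (Γ : PointedGraph) :
    Γ.weight + Γ.farCycles.ncard = Γ.cycles.ncard := by
  unfold weight
  rw [← Set.ncard_union_eq]
  · congr 1
    ext C
    simp only [farCycles, cycles, On, Set.mem_union, Set.mem_ofPred_eq]
    exact ⟨fun h => h.elim And.left And.left,
      fun h => (em _).elim (fun h' => Or.inl ⟨h, h'⟩) fun h' => Or.inr ⟨h, h'⟩⟩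
  · rw [Set.disjoint_left]
    intro C h h'
    exact h'.2 h.2

theorem IsReducedCycle.valence_on {C : Set Γ.E} (hC : Γ.IsReducedCycle C) {v : Γ.V}
    (hv : Γ.On C v) : Γ.valence C v = 2 := by
  obtain ⟨e, he, hv⟩ := hv
  exact hC.valence_eq he hv

theorem IsReducedCycle.conn_on {C : Set Γ.E} (hC : Γ.IsReducedCycle C) {v w : Γ.V}
    (hv : Γ.On C v) (hw : Γ.On C w) : Γ.Conn C v w := by
  obtain ⟨e, he, hv⟩ := hv
  obtain ⟨f, hf, hw⟩ := hw
  exact hC.conn_of_mem he hf hv hw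

theorem IsReducedCycle.conn_diff_on {C : Set Γ.E} (hC : Γ.IsReducedCycle C) {v w : Γ.V}
    (hv : Γ.On C v) (hw : Γ.On C w) {e : Γ.E} (he : e ∈ C) : Γ.Conn (C \ {e}) v w := by
  refine (hC.conn_on hv hw).bind fun f hf => ?_
  by_cases h : f = e
  · rw [h]; exact hC.conn_diff he
  · exact .edge ⟨hf, h⟩

namespace IsCactus

theorem exists_cycle (h : Γ.IsCactus) (e : Γ.E) : ∃ C, Γ.IsReducedCycle C ∧ e ∈ C :=
  (h e).exists

theorem eq_of_mem (h : Γ.IsCactus) {C D : Set Γ.E} (hC : Γ.IsReducedCycle C)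
    (hD : Γ.IsReducedCycle D) {e : Γ.E} (he : e ∈ C) (he' : e ∈ D) : C = D :=
  (h e).unique ⟨hC, he⟩ ⟨hD, he'⟩

theorem disjoint (h : Γ.IsCactus) {C D : Set Γ.E} (hC : Γ.IsReducedCycle C)
    (hD : Γ.IsReducedCycle D) (hne : C ≠ D) : Disjoint C D :=
  Set.disjoint_left.2 fun _ he he' => hne (h.eq_of_mem hC hD he he')

/-- If the ends of an edge of a reduced cycle `C` are joined by a path that avoids the edge, then
the path passes through all the other edges of `C`. -/
theorem subset_of_conn (h : Γ.IsCactus) {C S : Set Γ.E} (hC : Γ.IsReducedCycle C) {e : Γ.E}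
    (he : e ∈ C) (heS : e ∉ S) (hS : Γ.Conn S (Γ.src e) (Γ.tgt e)) : C ⊆ insert e S := by
  obtain ⟨D, hD, heD, hDS⟩ := exists_isReducedCycle heS hS
  rw [h.eq_of_mem hC hD he heD]
  exact hDS

/-- Two vertices on a reduced cycle of a cactus graph are not joined by a path outside the
cycle. -/
theorem eq_of_conn_compl (h : Γ.IsCactus) {C : Set Γ.E} (hC : Γ.IsReducedCycle C) {v w : Γ.V}
    (hv : Γ.On C v) (hw : Γ.On C w) (hc : Γ.Conn Cᶜ v w) : v = w := by
  by_contra hne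
  -- Take a minimal connecting set `A` inside `C` and an edge `e` of it. The rest of `A` and the
  -- path outside `C` join the ends of `e`, so uniqueness of the cycle forces `A` to contain all of
  -- `C`. But `C` stays connected without `e`, against minimality.
  obtain ⟨A, hA⟩ := (Set.toFinite {A : Set Γ.E | A ⊆ C ∧ Γ.Conn A v w}).exists_minimal
    ⟨C, subset_rfl, hC.conn_on hv hw⟩
  obtain ⟨hAC, hAvw⟩ := hA.prop
  have hmin : ∀ e ∈ A, ¬ Γ.Conn (A \ {e}) v w := fun e he h' => by
    have hP : A \ {e} ∈ {A : Set Γ.E | A ⊆ C ∧ Γ.Conn A v w} := ⟨Set.sdiff_subset.trans hAC, h'⟩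
    exact (hA.le_of_le hP Set.sdiff_subset he).2 rfl
  obtain ⟨e, he⟩ : A.Nonempty := by
    rw [Set.nonempty_iff_ne_empty]
    rintro rfl
    exact hne (hAvw.map_eq id fun _ h => h.elim)
  have hcon : Γ.Conn (A \ {e} ∪ Cᶜ) (Γ.src e) (Γ.tgt e) := by
    have h1 : ∀ {x y}, Γ.Conn (A \ {e}) x y → Γ.Conn (A \ {e} ∪ Cᶜ) x y :=
      fun h => h.mono Set.subset_union_left
    have h2 : Γ.Conn (A \ {e} ∪ Cᶜ) v w := hc.mono Set.subset_union_right
    have hn := hmin e he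
    rcases hAvw.remove_edge e with h3 | h3 | h3
    · exact absurd h3 hn
    · rcases hAvw.symm.remove_edge e with h4 | h4 | h4
      · exact absurd h4.symm hn
      · exact absurd (h3.trans h4.symm) hn
      · exact (h1 h3).symm.trans (h2.trans (h1 h4))
    · rcases hAvw.symm.remove_edge e with h4 | h4 | h4
      · exact absurd h4.symm hn
      · exact (h1 h4).symm.trans (h2.symm.trans (h1 h3))
      · exact absurd (h3.trans h4.symm) hn
  have hsub := h.subset_of_conn hC (hAC he)
    (fun h' => h'.elim (fun h' => h'.2 rfl) fun h' => h' (hAC he)) hcon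
  refine hmin e he ((hC.conn_diff_on hv hw (hAC he)).mono fun f hf => ?_)
  refine ⟨?_, hf.2⟩
  rcases hsub hf.1 with h' | h' | h'
  · exact absurd h' hf.2
  · exact h'.1
  · exact absurd hf.1 h'

/-- Different cycles have no common edge, so `D` provides a path outside `C`. -/
theorem eq_of_on_of_on (h : Γ.IsCactus) {C D : Set Γ.E} (hC : Γ.IsReducedCycle C)
    (hD : Γ.IsReducedCycle D) (hne : C ≠ D) {v w : Γ.V} (hv : Γ.On C v) (hw : Γ.On C w)
    (hv' : Γ.On D v) (hw' : Γ.On D w) : v = w :=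
  h.eq_of_conn_compl hC hv hw ((hD.conn_on hv' hw').mono fun _ he he' =>
    Set.disjoint_left.1 (h.disjoint hC hD hne) he' he)

/-- The forest `T` misses some edge of `C`. The tree path between its ends closes up to the only
cycle through it, namely `C`, so all other edges of `C` are in `T`. -/
theorem diff_maximalTree (h : Γ.IsCactus) {T C : Set Γ.E} (hT : Γ.IsMaximalTree T)
    (hC : Γ.IsReducedCycle C) : ∃ e ∈ C, e ∉ T ∧ C \ T = {e} := by
  obtain ⟨e, he, heT⟩ := Set.not_subset.1 fun hCT => hT.1 C hCT hC
  refine ⟨e, he, heT, Set.eq_singleton_iff_unique_mem.2 ⟨⟨he, heT⟩, fun f hf => ?_⟩⟩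
  rcases h.subset_of_conn hC he heT (hT.2 _ _) hf.1 with h' | h'
  · exact h'
  · exact absurd h' hf.2

theorem isMaximalTree_of_diff (h : Γ.IsCactus) (hc : ∀ v w, Γ.Conn Set.univ v w) {T : Set Γ.E}
    (hT : ∀ C, Γ.IsReducedCycle C → ∃ e, C \ T = {e}) : Γ.IsMaximalTree T := by
  constructor
  · intro C hCT hC
    obtain ⟨e, he⟩ := hT C hC
    have : e ∈ C \ T := he ▸ rfl
    exact this.2 (hCT this.1)
  · intro v w
    refine (hc v w).bind fun e _ => ?_
    by_cases heT : e ∈ T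
    · exact .edge heT
    · obtain ⟨C, hC, heC⟩ := h.exists_cycle e
      obtain ⟨f, hf⟩ := hT C hC
      have hef : e = f := by
        have : e ∈ C \ T := ⟨heC, heT⟩
        rwa [hf] at this
      subst hef
      refine (hC.conn_diff heC).mono fun g hg => ?_
      by_contra hgT
      have : g ∈ C \ T := ⟨hg.1, hgT⟩
      rw [hf] at this
      exact hg.2 this

/-- Removing one edge from every reduced cycle yields a maximal tree. -/
theorem exists_maximalTree (h : Γ.IsCactus) (hc : ∀ v w, Γ.Conn Set.univ v w)
    (s : Set Γ.E → Γ.E) (hs : ∀ C, Γ.IsReducedCycle C → s C ∈ C) :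
    ∃ T, Γ.IsMaximalTree T ∧ ∀ C, Γ.IsReducedCycle C → C \ T = {s C} := by
  have key : ∀ C, Γ.IsReducedCycle C → C \ {e | ∀ D, Γ.IsReducedCycle D → s D ≠ e} = {s C} := by
    intro C hC
    refine Set.eq_singleton_iff_unique_mem.2 ⟨⟨hs C hC, fun h' => h' C hC rfl⟩, ?_⟩
    rintro e ⟨he, he'⟩
    simp only [Set.mem_ofPred_eq, not_forall, not_not] at he'
    obtain ⟨D, hD, rfl⟩ := he'
    rw [h.eq_of_mem hC hD he (hs D hD)]
  exact ⟨_, h.isMaximalTree_of_diff hc fun C hC => ⟨_, key C hC⟩, key⟩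

/-- Every cycle has an edge outside `F`; removing one such edge from each cycle leaves a maximal
tree. -/
theorem exists_maximalTree_of_isForest (h : Γ.IsCactus) (hc : ∀ v w, Γ.Conn Set.univ v w)
    {F : Set Γ.E} (hF : Γ.IsForest F) : ∃ T, F ⊆ T ∧ Γ.IsMaximalTree T := by
  rcases isEmpty_or_nonempty Γ.E with hE | hE
  · exact ⟨F, subset_rfl, hF, fun v w => (hc v w).mono fun e => hE.elim e⟩
  have hs : ∀ C, ∃ e, Γ.IsReducedCycle C → e ∈ C ∧ e ∉ F := fun C => by
    by_cases hC : Γ.IsReducedCycle C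
    · obtain ⟨e, he⟩ := Set.not_subset.1 fun hCF => hF C hCF hC
      exact ⟨e, fun _ => he⟩
    · exact ⟨hE.some, fun h => absurd h hC⟩
  choose s hs using hs
  obtain ⟨T, hT, hT'⟩ := h.exists_maximalTree hc s fun C hC => (hs C hC).1
  refine ⟨T, fun e he => ?_, hT⟩
  by_contra heT
  obtain ⟨C, hC, heC⟩ := h.exists_cycle e
  have : e ∈ C \ T := ⟨heC, heT⟩
  rw [hT' C hC] at this
  rw [show e = s C from this] at he
  exact (hs C hC).2 he

/-- The edges outside a maximal tree correspond to the reduced cycles. -/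
theorem card_compl_maximalTree (h : Γ.IsCactus) {T : Set Γ.E} (hT : Γ.IsMaximalTree T) :
    Nat.card {e // e ∉ T} = Γ.cycles.ncard := by
  choose C hC heC using h.exists_cycle
  rw [← Nat.card_coe_set_eq]
  refine Nat.card_congr (Equiv.ofBijective (fun e => ⟨C e.1, hC e.1⟩) ⟨?_, ?_⟩)
  · intro e e' hee
    have hee' : C e.1 = C e'.1 := congrArg Subtype.val hee
    obtain ⟨f, -, -, hf⟩ := h.diff_maximalTree hT (hC e.1)
    have h1 : e.1 ∈ C e.1 \ T := ⟨heC _, e.2⟩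
    have h2 : e'.1 ∈ C e.1 \ T := ⟨hee' ▸ heC _, e'.2⟩
    rw [hf] at h1 h2
    exact Subtype.ext (h1.trans h2.symm)
  · rintro ⟨D, hD⟩
    obtain ⟨f, hf, hfT, -⟩ := h.diff_maximalTree hT hD
    exact ⟨⟨f, hfT⟩, Subtype.ext (h.eq_of_mem (hC f) hD (heC f) hf)⟩

/-- A vertex that lies on two reduced cycles is at least `4`-valent. -/
theorem four_le_valence (h : Γ.IsCactus) {C D : Set Γ.E} (hC : Γ.IsReducedCycle C)
    (hD : Γ.IsReducedCycle D) (hne : C ≠ D) {v : Γ.V} (hv : Γ.On C v) (hv' : Γ.On D v) :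
    4 ≤ Γ.valence Set.univ v := by
  have h1 := valence_disjoint_union (h.disjoint hC hD hne) v
  rw [hC.valence_on hv, hD.valence_on hv'] at h1
  have := valence_mono (Set.subset_univ (C ∪ D)) v
  omega

/-- A vertex that is at least `3`-valent lies on a second reduced cycle. -/
theorem exists_ne_cycle (h : Γ.IsCactus) {C : Set Γ.E} (hC : Γ.IsReducedCycle C) {v : Γ.V}
    (hv : Γ.On C v) (h3 : 3 ≤ Γ.valence Set.univ v) :
    ∃ D, Γ.IsReducedCycle D ∧ D ≠ C ∧ Γ.On D v := by
  by_contra! hn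
  have : Γ.valence Set.univ v ≤ Γ.valence C v := by
    refine Nat.add_le_add (Set.ncard_le_ncard ?_) (Set.ncard_le_ncard ?_)
    · rintro e ⟨-, he⟩
      obtain ⟨D, hD, heD⟩ := h.exists_cycle e
      by_cases hDC : D = C
      · exact ⟨hDC ▸ heD, he⟩
      · exact absurd ⟨e, heD, Or.inl he⟩ (hn D hD hDC)
    · rintro e ⟨-, he⟩
      obtain ⟨D, hD, heD⟩ := h.exists_cycle e
      by_cases hDC : D = C
      · exact ⟨hDC ▸ heD, he⟩
      · exact absurd ⟨e, heD, Or.inr he⟩ (hn D hD hDC)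
  rw [hC.valence_on hv] at this
  omega

end IsCactus

theorem IsReduced.two_le_valence (h : Γ.IsReduced) (v : Γ.V) : 2 ≤ Γ.valence Set.univ v := by
  by_cases hv : v = Γ.base
  · exact hv ▸ h.base_valence
  · exact (Nat.le_succ 2).trans (h.other_valence v hv)

theorem IsReduced.exists_cycle_on (h : Γ.IsReduced) (hc : Γ.IsCactus) (v : Γ.V) :
    ∃ C, Γ.IsReducedCycle C ∧ Γ.On C v := by
  obtain ⟨e, -, he⟩ := valence_pos_iff.1 (lt_of_lt_of_le two_pos (h.two_le_valence v))
  obtain ⟨C, hC, heC⟩ := hc.exists_cycle e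
  exact ⟨C, hC, e, heC, he⟩

end Cactus

end PointedGraph

end CactusSpace

namespace CactusSpace

namespace PointedGraph

/-! ### Collapse maps -/

/-- A map of graphs that collapses the components of the subgraph with edge set `F` to points and
is injective otherwise; `inv e` is the edge that is mapped to `e`, with its orientation reversed if
`flip e` holds. -/
structure CMap (Γ Δ : PointedGraph) (F : Set Γ.E) where
  vert : Γ.V → Δ.V
  inv : Δ.E → Γ.E
  flip : Δ.E → Bool
  surj : Function.Surjective vert
  base : vert Γ.base = Δ.base
  vert_eq_iff : ∀ v w, vert v = vert w ↔ Γ.Conn F v w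
  inj : Function.Injective inv
  range : Set.range inv = Fᶜ
  src : ∀ e, vert (Γ.src (inv e)) = if flip e then Δ.tgt e else Δ.src e
  tgt : ∀ e, vert (Γ.tgt (inv e)) = if flip e then Δ.src e else Δ.tgt e

namespace CMap

variable {Γ Δ Δ' Θ : PointedGraph} {F : Set Γ.E} {G : Set Δ.E}

theorem inv_notMem (κ : CMap Γ Δ F) (e : Δ.E) : κ.inv e ∉ F := by
  have : κ.inv e ∈ Set.range κ.inv := ⟨e, rfl⟩
  rwa [κ.range] at this

theorem exists_inv (κ : CMap Γ Δ F) {e : Γ.E} (he : e ∉ F) : ∃ a, κ.inv a = e := by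
  have : e ∈ Set.range κ.inv := by rwa [κ.range]
  exact this

theorem vert_src_eq (κ : CMap Γ Δ F) {e : Γ.E} (he : e ∈ F) :
    κ.vert (Γ.src e) = κ.vert (Γ.tgt e) := (κ.vert_eq_iff _ _).2 (.edge he)

open Classical in
/-- The effect of a collapse map on homotopy classes of edge paths. -/
def hom (κ : CMap Γ Δ F) : FreeGroup Γ.E →* FreeGroup Δ.E :=
  FreeGroup.lift fun e => if h : ∃ a, κ.inv a = e then
    (if κ.flip h.choose then (FreeGroup.of h.choose)⁻¹ else FreeGroup.of h.choose) else 1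

theorem hom_inv (κ : CMap Γ Δ F) (a : Δ.E) : κ.hom (FreeGroup.of (κ.inv a)) =
    if κ.flip a then (FreeGroup.of a)⁻¹ else FreeGroup.of a := by
  have h : ∃ b, κ.inv b = κ.inv a := ⟨a, rfl⟩
  have h1 : h.choose = a := κ.inj h.choose_spec
  rw [hom, FreeGroup.lift_apply_of, dif_pos h, h1]

theorem hom_of_mem (κ : CMap Γ Δ F) {e : Γ.E} (he : e ∈ F) : κ.hom (FreeGroup.of e) = 1 := by
  rw [hom, FreeGroup.lift_apply_of, dif_neg]
  rintro ⟨a, rfl⟩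
  exact κ.inv_notMem a he

theorem hom_ext (κ : CMap Γ Δ F) {H : Type*} [Group H] {φ ψ : FreeGroup Γ.E →* H}
    (h1 : ∀ e ∈ F, φ (FreeGroup.of e) = ψ (FreeGroup.of e))
    (h2 : ∀ a, φ (FreeGroup.of (κ.inv a)) = ψ (FreeGroup.of (κ.inv a))) : φ = ψ := by
  ext e
  by_cases he : e ∈ F
  · exact h1 e he
  · obtain ⟨a, rfl⟩ := κ.exists_inv he
    exact h2 a

/-- The collapse of a set of edges. -/
def ofCollapse (Γ : PointedGraph) (F : Set Γ.E) : CMap Γ (Γ.collapse F) F where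
  vert := Quotient.mk _
  inv := Subtype.val
  flip := fun _ => false
  surj := Quotient.exists_rep
  base := rfl
  vert_eq_iff := fun _ _ => Quotient.eq
  inj := Subtype.val_injective
  range := Subtype.range_val
  src := fun _ => rfl
  tgt := fun _ => rfl

theorem ofCollapse_hom (Γ : PointedGraph) (F : Set Γ.E) : (ofCollapse Γ F).hom = collapseHom F := by
  apply (ofCollapse Γ F).hom_ext
  · intro e he
    rw [hom_of_mem _ he, collapseHom, FreeGroup.lift_apply_of, dif_pos he]
  · intro a
    rw [hom_inv, collapseHom, FreeGroup.lift_apply_of]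
    rw [dif_neg (show (ofCollapse Γ F).inv a ∉ F from a.2)]
    rfl

/-- An isomorphism, as a collapse map. -/
def ofIso (α : Iso Γ Δ) : CMap Γ Δ ∅ where
  vert := α.vert
  inv := α.edge.symm
  flip := fun e => α.flip (α.edge.symm e)
  surj := α.vert.surjective
  base := α.map_base
  vert_eq_iff := fun v w => by
    rw [α.vert.injective.eq_iff]
    exact ⟨fun h => h ▸ .refl _, fun h => h.map_eq id fun _ h => h.elim⟩
  inj := α.edge.symm.injective
  range := by rw [α.edge.symm.surjective.range_eq, Set.compl_empty]
  src := fun e => by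
    have h1 := α.src_edge (α.edge.symm e)
    have h2 := α.tgt_edge (α.edge.symm e)
    rw [Equiv.apply_symm_apply] at h1 h2
    split_ifs with h <;> simp_all
  tgt := fun e => by
    have h1 := α.src_edge (α.edge.symm e)
    have h2 := α.tgt_edge (α.edge.symm e)
    rw [Equiv.apply_symm_apply] at h1 h2
    split_ifs with h <;> simp_all

theorem ofIso_hom (α : Iso Γ Δ) : (ofIso α).hom = α.hom := by
  apply (ofIso α).hom_ext
  · intro e he
    exact he.elim
  · intro a
    rw [hom_inv, Iso.hom, FreeGroup.lift_apply_of]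
    simp only [ofIso, Equiv.apply_symm_apply]
    rfl

theorem conn_map (κ : CMap Γ Δ F) {S : Set Γ.E} {v w : Γ.V} (h : Γ.Conn S v w) :
    Δ.Conn (κ.inv ⁻¹' S) (κ.vert v) (κ.vert w) := by
  refine h.lift (r := fun v w => Δ.Conn (κ.inv ⁻¹' S) (κ.vert v) (κ.vert w))
    ⟨fun _ => .refl _, .symm, .trans⟩ fun e he => ?_
  by_cases heF : e ∈ F
  · rw [κ.vert_src_eq heF]
    exact .refl _
  · obtain ⟨a, rfl⟩ := κ.exists_inv heF
    rw [κ.src, κ.tgt]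
    have : Δ.Conn (κ.inv ⁻¹' S) (Δ.src a) (Δ.tgt a) := .edge he
    split_ifs
    · exact this.symm
    · exact this

/-- Paths lift once detours through the collapsed edges are allowed, since a section on vertices is
off only by moves within the components of `F`. -/
theorem conn_iff (κ : CMap Γ Δ F) {S : Set Δ.E} {v w : Γ.V} :
    Δ.Conn S (κ.vert v) (κ.vert w) ↔ Γ.Conn (F ∪ κ.inv '' S) v w := by
  constructor
  · intro h
    let σ := Function.surjInv κ.surj
    have hσ : ∀ v, Γ.Conn (F ∪ κ.inv '' S) (σ (κ.vert v)) v := fun v =>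
      ((κ.vert_eq_iff _ _).1 (Function.surjInv_eq κ.surj (κ.vert v))).mono Set.subset_union_left
    have := h.lift (r := fun x y => Γ.Conn (F ∪ κ.inv '' S) (σ x) (σ y))
      ⟨fun _ => .refl _, .symm, .trans⟩ (fun e he => by
        have h1 := hσ (Γ.src (κ.inv e))
        have h2 := hσ (Γ.tgt (κ.inv e))
        have h3 : Γ.Conn (F ∪ κ.inv '' S) (Γ.src (κ.inv e)) (Γ.tgt (κ.inv e)) :=
          .edge (Or.inr ⟨e, he, rfl⟩)
        have h4 := h1.trans (h3.trans h2.symm)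
        rw [κ.src, κ.tgt] at h4
        split_ifs at h4
        · exact h4.symm
        · exact h4)
    exact (hσ v).symm.trans (this.trans (hσ w))
  · intro h
    refine (κ.conn_map h).mono fun e he => ?_
    rcases he with he | ⟨a, ha, hae⟩
    · exact absurd he (κ.inv_notMem e)
    · exact κ.inj hae ▸ ha

/-- The composition of two collapse maps. -/
def comp (κ : CMap Γ Δ F) (μ : CMap Δ Θ G) : CMap Γ Θ (F ∪ κ.inv '' G) where
  vert := μ.vert ∘ κ.vert
  inv := κ.inv ∘ μ.inv
  flip := fun e => xor (κ.flip (μ.inv e)) (μ.flip e)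
  surj := μ.surj.comp κ.surj
  base := by rw [Function.comp_apply, κ.base, μ.base]
  vert_eq_iff := fun v w => by
    rw [Function.comp_apply, Function.comp_apply, μ.vert_eq_iff, κ.conn_iff]
  inj := κ.inj.comp μ.inj
  range := by
    rw [Set.range_comp, μ.range]
    ext e
    simp only [Set.mem_image, Set.mem_compl_iff, Set.mem_union, not_or, not_exists, not_and]
    constructor
    · rintro ⟨a, ha, rfl⟩
      exact ⟨κ.inv_notMem a, fun b hb hba => ha (κ.inj hba ▸ hb)⟩
    · rintro ⟨h1, h2⟩
      obtain ⟨a, rfl⟩ := κ.exists_inv h1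
      exact ⟨a, fun ha => h2 a ha rfl, rfl⟩
  src := fun e => by
    have h1 := μ.src e
    have h2 := μ.tgt e
    have h3 := κ.src (μ.inv e)
    cases hf : κ.flip (μ.inv e) <;> cases hg : μ.flip e <;> simp_all
  tgt := fun e => by
    have h1 := μ.src e
    have h2 := μ.tgt e
    have h3 := κ.tgt (μ.inv e)
    cases hf : κ.flip (μ.inv e) <;> cases hg : μ.flip e <;> simp_all

theorem comp_hom (κ : CMap Γ Δ F) (μ : CMap Δ Θ G) : (κ.comp μ).hom = μ.hom.comp κ.hom := by
  apply (κ.comp μ).hom_ext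
  · rintro e (he | ⟨a, ha, rfl⟩)
    · rw [hom_of_mem _ (Or.inl he), MonoidHom.comp_apply, κ.hom_of_mem he, map_one]
    · rw [hom_of_mem _ (Or.inr ⟨a, ha, rfl⟩), MonoidHom.comp_apply, κ.hom_inv]
      split_ifs
      · rw [map_inv, μ.hom_of_mem ha, inv_one]
      · rw [μ.hom_of_mem ha]
  · intro a
    rw [hom_inv]
    change _ = μ.hom (κ.hom (FreeGroup.of (κ.inv (μ.inv a))))
    rw [κ.hom_inv]
    have := μ.hom_inv a
    cases hf : κ.flip (μ.inv a) <;> cases hg : μ.flip a <;> simp_all [comp]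

/-- Two collapse maps that collapse the same edges have isomorphic targets. -/
def iso (κ : CMap Γ Δ F) (κ' : CMap Γ Δ' F) : Iso Δ Δ' where
  vert :=
    { toFun := fun v => κ'.vert (Function.surjInv κ.surj v)
      invFun := fun v => κ.vert (Function.surjInv κ'.surj v)
      left_inv := fun v => by
        rw [← Function.surjInv_eq κ.surj v, κ.vert_eq_iff, ← κ'.vert_eq_iff,
          Function.surjInv_eq κ'.surj, Function.surjInv_eq κ.surj]
      right_inv := fun v => by
        rw [← Function.surjInv_eq κ'.surj v, κ'.vert_eq_iff, ← κ.vert_eq_iff,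
          Function.surjInv_eq κ.surj, Function.surjInv_eq κ'.surj] }
  edge :=
    { toFun := fun e => (κ'.exists_inv (κ.inv_notMem e)).choose
      invFun := fun e => (κ.exists_inv (κ'.inv_notMem e)).choose
      left_inv := fun e => κ.inj (by
        rw [(κ.exists_inv (κ'.inv_notMem _)).choose_spec,
          (κ'.exists_inv (κ.inv_notMem e)).choose_spec])
      right_inv := fun e => κ'.inj (by
        rw [(κ'.exists_inv (κ.inv_notMem _)).choose_spec,
          (κ.exists_inv (κ'.inv_notMem e)).choose_spec]) }
  -- Both orientations are compared with that of the common edge of `Γ`, so two reversals cancel.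
  flip := fun e => xor (κ.flip e) (κ'.flip (κ'.exists_inv (κ.inv_notMem e)).choose)
  map_base := by
    change κ'.vert (Function.surjInv κ.surj Δ.base) = _
    rw [← κ'.base, κ'.vert_eq_iff, ← κ.vert_eq_iff, Function.surjInv_eq κ.surj, κ.base]
  src_edge := fun e => by
    have hv : ∀ v, κ'.vert (Function.surjInv κ.surj (κ.vert v)) = κ'.vert v := fun v => by
      rw [κ'.vert_eq_iff, ← κ.vert_eq_iff, Function.surjInv_eq κ.surj]
    have h0 := (κ'.exists_inv (κ.inv_notMem e)).choose_spec
    have h1 := κ.src e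
    have h2 := κ.tgt e
    have h3 := κ'.src (κ'.exists_inv (κ.inv_notMem e)).choose
    have h4 := κ'.tgt (κ'.exists_inv (κ.inv_notMem e)).choose
    have h5 := hv (Γ.src (κ.inv e))
    have h6 := hv (Γ.tgt (κ.inv e))
    cases hf : κ.flip e <;> cases hg : κ'.flip (κ'.exists_inv (κ.inv_notMem e)).choose <;>
      simp_all
  tgt_edge := fun e => by
    have hv : ∀ v, κ'.vert (Function.surjInv κ.surj (κ.vert v)) = κ'.vert v := fun v => by
      rw [κ'.vert_eq_iff, ← κ.vert_eq_iff, Function.surjInv_eq κ.surj]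
    have h0 := (κ'.exists_inv (κ.inv_notMem e)).choose_spec
    have h1 := κ.src e
    have h2 := κ.tgt e
    have h3 := κ'.src (κ'.exists_inv (κ.inv_notMem e)).choose
    have h4 := κ'.tgt (κ'.exists_inv (κ.inv_notMem e)).choose
    have h5 := hv (Γ.src (κ.inv e))
    have h6 := hv (Γ.tgt (κ.inv e))
    cases hf : κ.flip e <;> cases hg : κ'.flip (κ'.exists_inv (κ.inv_notMem e)).choose <;>
      simp_all

theorem inv_iso_edge (κ : CMap Γ Δ F) (κ' : CMap Γ Δ' F) (e : Δ.E) :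
    κ'.inv ((κ.iso κ').edge e) = κ.inv e := (κ'.exists_inv (κ.inv_notMem e)).choose_spec

theorem iso_hom_comp (κ : CMap Γ Δ F) (κ' : CMap Γ Δ' F) :
    (κ.iso κ').hom.comp κ.hom = κ'.hom := by
  apply κ.hom_ext
  · intro e he
    rw [MonoidHom.comp_apply, κ.hom_of_mem he, κ'.hom_of_mem he, map_one]
  · intro a
    rw [MonoidHom.comp_apply, κ.hom_inv, ← inv_iso_edge κ κ', κ'.hom_inv]
    have h : (κ.iso κ').hom (FreeGroup.of a) = if xor (κ.flip a) (κ'.flip ((κ.iso κ').edge a)) then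
        (FreeGroup.of ((κ.iso κ').edge a))⁻¹ else FreeGroup.of ((κ.iso κ').edge a) := by
      rw [Iso.hom, FreeGroup.lift_apply_of]
      rfl
    cases hf : κ.flip a <;> cases hg : κ'.flip ((κ.iso κ').edge a) <;> simp_all

/-! ### Collapse maps of cactus graphs -/

theorem preimage_nonempty (κ : CMap Γ Δ F) (hF : Γ.IsForest F) {C : Set Γ.E} (hC : Γ.IsReducedCycle C) :
    (κ.inv ⁻¹' C).Nonempty := by
  obtain ⟨e, he, heF⟩ := Set.not_subset.1 fun hCF => hF C hCF hC
  obtain ⟨a, rfl⟩ := κ.exists_inv heF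
  exact ⟨a, he⟩

/-- The path `D \ {a}` lifts to a path through `F` and the lifts of its edges that joins the ends of
`κ.inv a`. In a cactus graph it must run through the rest of `C`. -/
theorem preimage_subset (κ : CMap Γ Δ F) (hc : Γ.IsCactus) {C : Set Γ.E} (hC : Γ.IsReducedCycle C)
    {D : Set Δ.E} (hD : Δ.IsReducedCycle D) {a : Δ.E} (ha : a ∈ D) (haC : κ.inv a ∈ C) :
    κ.inv ⁻¹' C ⊆ D := by
  have h1 : Γ.Conn (F ∪ κ.inv '' (D \ {a})) (Γ.src (κ.inv a)) (Γ.tgt (κ.inv a)) := by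
    rw [← κ.conn_iff, κ.src, κ.tgt]
    split_ifs
    · exact (hD.conn_diff ha).symm
    · exact hD.conn_diff ha
  have h2 := hc.subset_of_conn hC haC (fun h => by
    rcases h with h | ⟨b, hb, hba⟩
    · exact κ.inv_notMem a h
    · exact hb.2 (κ.inj hba)) h1
  intro b hb
  rcases h2 hb with h | h | ⟨b', hb', hbb'⟩
  · rw [κ.inj h]; exact ha
  · exact absurd h (κ.inv_notMem b)
  · rw [← κ.inj hbb']; exact hb'.1

/-- The rest of `C` still joins the ends of `a` after the collapse, so the image of `C` contains a
cycle through `a`; `preimage_subset` shows that this cycle is the whole image. -/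
theorem isReducedCycle_preimage (κ : CMap Γ Δ F) (hc : Γ.IsCactus) (hF : Γ.IsForest F)
    {C : Set Γ.E} (hC : Γ.IsReducedCycle C) : Δ.IsReducedCycle (κ.inv ⁻¹' C) := by
  obtain ⟨a, ha⟩ := κ.preimage_nonempty hF hC
  have h1 := κ.conn_map (hC.conn_diff ha)
  have h2 : κ.inv ⁻¹' (C \ {κ.inv a}) = κ.inv ⁻¹' C \ {a} := by
    ext b
    simp [κ.inj.eq_iff]
  rw [h2] at h1
  have h3 : Δ.Conn (κ.inv ⁻¹' C \ {a}) (Δ.src a) (Δ.tgt a) := by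
    rw [κ.src, κ.tgt] at h1
    split_ifs at h1
    · exact h1.symm
    · exact h1
  obtain ⟨D, hD, haD, hDC⟩ := exists_isReducedCycle (fun h => h.2 rfl) h3
  rw [Set.insert_sdiff_singleton, Set.insert_eq_of_mem ha] at hDC
  rwa [(κ.preimage_subset hc hC hD haD ha).antisymm hDC]

theorem preimage_eq (κ : CMap Γ Δ F) (hc : Γ.IsCactus) (hF : Γ.IsForest F) {C : Set Γ.E}
    (hC : Γ.IsReducedCycle C) {D : Set Δ.E} (hD : Δ.IsReducedCycle D) {a : Δ.E} (ha : a ∈ D)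
    (haC : κ.inv a ∈ C) : κ.inv ⁻¹' C = D :=
  (κ.isReducedCycle_preimage hc hF hC).eq_of_subset hD (κ.preimage_subset hc hC hD ha haC)

theorem exists_preimage_eq (κ : CMap Γ Δ F) (hc : Γ.IsCactus) (hF : Γ.IsForest F)
    {D : Set Δ.E} (hD : Δ.IsReducedCycle D) : ∃ C, Γ.IsReducedCycle C ∧ κ.inv ⁻¹' C = D := by
  obtain ⟨a, ha⟩ := hD.nonempty
  obtain ⟨C, hC, haC⟩ := hc.exists_cycle (κ.inv a)
  exact ⟨C, hC, κ.preimage_eq hc hF hC hD ha haC⟩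

theorem preimage_injOn (κ : CMap Γ Δ F) (hc : Γ.IsCactus) (hF : Γ.IsForest F) :
    Set.InjOn (fun C => κ.inv ⁻¹' C) Γ.cycles := by
  intro C hC D hD h
  obtain ⟨a, ha⟩ := κ.preimage_nonempty hF hC
  have ha' : a ∈ κ.inv ⁻¹' D := (show κ.inv ⁻¹' C = κ.inv ⁻¹' D from h) ▸ ha
  exact hc.eq_of_mem hC hD ha ha'

theorem image_cycles (κ : CMap Γ Δ F) (hc : Γ.IsCactus) (hF : Γ.IsForest F) :
    (fun C => κ.inv ⁻¹' C) '' Γ.cycles = Δ.cycles := by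
  ext D
  constructor
  · rintro ⟨C, hC, rfl⟩
    exact κ.isReducedCycle_preimage hc hF hC
  · intro hD
    exact κ.exists_preimage_eq hc hF hD

theorem ncard_cycles (κ : CMap Γ Δ F) (hc : Γ.IsCactus) (hF : Γ.IsForest F) :
    Δ.cycles.ncard = Γ.cycles.ncard := by
  rw [← κ.image_cycles hc hF, (κ.preimage_injOn hc hF).ncard_image]

theorem isCactus (κ : CMap Γ Δ F) (hc : Γ.IsCactus) (hF : Γ.IsForest F) : Δ.IsCactus := by
  intro a
  obtain ⟨C, hC, haC⟩ := hc.exists_cycle (κ.inv a)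
  exact ⟨_, ⟨κ.isReducedCycle_preimage hc hF hC, haC⟩,
    fun D hD => (κ.preimage_eq hc hF hC hD.1 hD.2 haC).symm⟩

theorem isForest_union (κ : CMap Γ Δ F) (hc : Γ.IsCactus) (hF : Γ.IsForest F) (hG : Δ.IsForest G) :
    Γ.IsForest (F ∪ κ.inv '' G) := by
  intro C hCFG hC
  refine hG _ (fun a ha => ?_) (κ.isReducedCycle_preimage hc hF hC)
  rcases hCFG ha with h | ⟨b, hb, hba⟩
  · exact absurd h (κ.inv_notMem a)
  · rw [← κ.inj hba]; exact hb

theorem isMaximalTree_union (κ : CMap Γ Δ F) (hc : Γ.IsCactus) (hF : Γ.IsForest F)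
    (hG : Δ.IsMaximalTree G) : Γ.IsMaximalTree (F ∪ κ.inv '' G) :=
  ⟨κ.isForest_union hc hF hG.1, fun _ _ => κ.conn_iff.1 (hG.2 _ _)⟩

/-- Otherwise no edge of `C` would leave the fibre over the image of `v`: collapsed edges stay in
fibres and the others would not touch it. But `C` is connected and has an edge that survives. -/
theorem on_preimage (κ : CMap Γ Δ F) (hF : Γ.IsForest F) {C : Set Γ.E} (hC : Γ.IsReducedCycle C)
    {v : Γ.V} (hv : Γ.On C v) : Δ.On (κ.inv ⁻¹' C) (κ.vert v) := by
  obtain ⟨a, ha⟩ := κ.preimage_nonempty hF hC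
  by_contra hn
  have key : ∀ b, κ.inv b ∈ C → κ.vert (Γ.src (κ.inv b)) ≠ κ.vert v ∧
      κ.vert (Γ.tgt (κ.inv b)) ≠ κ.vert v := by
    intro b hb
    rw [κ.src, κ.tgt]
    constructor
    · intro h
      refine hn ⟨b, hb, ?_⟩
      split_ifs at h
      · exact Or.inr h
      · exact Or.inl h
    · intro h
      refine hn ⟨b, hb, ?_⟩
      split_ifs at h
      · exact Or.inl h
      · exact Or.inr h
  have := (hC.conn_on hv ⟨_, ha, Or.inl rfl⟩).mem_iff (W := {u | κ.vert u = κ.vert v})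
    (fun f hf => by
      by_cases hfF : f ∈ F
      · simp [κ.vert_src_eq hfF]
      · obtain ⟨b, rfl⟩ := κ.exists_inv hfF
        simp [key b hf])
  exact (key a ha).1 (this.1 rfl)

/-- The valences are bounded below through cycles: one cycle through the basepoint and two different
ones through any other vertex survive the collapse. -/
theorem isReduced (κ : CMap Γ Δ F) (hr : Γ.IsReduced) (hc : Γ.IsCactus) (hF : Γ.IsForest F) :
    Δ.IsReduced := by
  refine ⟨fun x y => ?_, ?_, fun x hx => ?_, fun a x y => ?_⟩
  · obtain ⟨v, rfl⟩ := κ.surj x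
    obtain ⟨w, rfl⟩ := κ.surj y
    exact κ.conn_map (hr.connected v w)
  · obtain ⟨C, hC, hCv⟩ := hr.exists_cycle_on hc Γ.base
    have h1 := κ.on_preimage hF hC hCv
    rw [κ.base] at h1
    rw [← (κ.isReducedCycle_preimage hc hF hC).valence_on h1]
    exact valence_mono (Set.subset_univ _) _
  · obtain ⟨v, rfl⟩ := κ.surj x
    have hv : v ≠ Γ.base := fun h => hx (by rw [h, κ.base])
    obtain ⟨C, hC, hCv⟩ := hr.exists_cycle_on hc v
    obtain ⟨D, hD, hDC, hDv⟩ := hc.exists_ne_cycle hC hCv (hr.other_valence v hv)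
    exact (Nat.le_succ 3).trans ((κ.isCactus hc hF).four_le_valence
      (κ.isReducedCycle_preimage hc hF hC) (κ.isReducedCycle_preimage hc hF hD)
      (fun h => hDC (κ.preimage_injOn hc hF hC hD h).symm) (κ.on_preimage hF hC hCv)
      (κ.on_preimage hF hD hDv))
  · obtain ⟨v, rfl⟩ := κ.surj x
    obtain ⟨w, rfl⟩ := κ.surj y
    refine (κ.conn_map (hr.no_separating (κ.inv a) v w)).mono ?_
    rintro b hb rfl
    exact hb rfl

/-- A cycle through the basepoint keeps passing through it, so collapses do not raise the coweight.
-/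
theorem ncard_farCycles_le (κ : CMap Γ Δ F) (hc : Γ.IsCactus) (hF : Γ.IsForest F) :
    Δ.farCycles.ncard ≤ Γ.farCycles.ncard := by
  refine le_trans (Set.ncard_le_ncard (t := (fun C => κ.inv ⁻¹' C) '' Γ.farCycles) ?_
    (Set.toFinite _)) (Set.ncard_image_le (Set.toFinite _))
  rintro D ⟨hD, hDb⟩
  obtain ⟨C, hC, rfl⟩ := κ.exists_preimage_eq hc hF hD
  refine ⟨C, ⟨hC, fun h => hDb ?_⟩, rfl⟩
  rw [← κ.base]
  exact κ.on_preimage hF hC h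

/-- An edge of a forest is not a loop, so its collapse identifies two vertices. The number of
vertices orders the collapses and later filters the orbit space. -/
theorem card_lt (κ : CMap Γ Δ F) (hF : Γ.IsForest F) (hne : F.Nonempty) :
    Nat.card Δ.V < Nat.card Γ.V := by
  refine lt_of_le_of_ne (Nat.card_le_card_of_surjective _ κ.surj) fun h => ?_
  obtain ⟨e, he⟩ := hne
  have hinj : Function.Injective κ.vert := by
    have h1 := Function.Injective.bijective_of_nat_card_le
      (Function.injective_surjInv κ.surj) h.ge
    intro v w hvw
    obtain ⟨x, rfl⟩ := h1.2 v
    obtain ⟨y, rfl⟩ := h1.2 w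
    rw [Function.surjInv_eq κ.surj, Function.surjInv_eq κ.surj] at hvw
    rw [hvw]
  exact hF.src_ne_tgt he (hinj (κ.vert_src_eq he))

end CMap

/-- A reduced cactus graph with `N` reduced cycles, at most `c` of which do not pass through the
basepoint. -/
structure IsCac (Γ : PointedGraph) (N c : ℕ) : Prop where
  red : Γ.IsReduced
  cac : Γ.IsCactus
  card : Γ.cycles.ncard = N
  far : Γ.farCycles.ncard ≤ c

theorem IsCac.map {Γ Δ : PointedGraph} {N c : ℕ} (h : Γ.IsCac N c) {F : Set Γ.E} (κ : CMap Γ Δ F)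
    (hF : Γ.IsForest F) : Δ.IsCac N c :=
  ⟨κ.isReduced h.red h.cac hF, κ.isCactus h.cac hF, (κ.ncard_cycles h.cac hF).trans h.card,
    (κ.ncard_farCycles_le h.cac hF).trans h.far⟩

end PointedGraph

end CactusSpace

namespace CactusSpace

open PointedGraph

namespace PointedGraph

/-! ### Fundamental groups and collapse maps -/

section Potential

variable {Γ Δ : PointedGraph} {F : Set Γ.E}

/-- A forest carries a potential: a labelling of the vertices by words of paths in the forest. -/
theorem IsForest.exists_potential (hF : Γ.IsForest F) : ∃ t : Γ.V → FreeGroup Γ.E,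
    ∀ f ∈ F, FreeGroup.of f = (t (Γ.src f))⁻¹ * t (Γ.tgt f) := by
  classical
  induction F, Set.toFinite F using Set.Finite.induction_on with
  | empty => exact ⟨fun _ => 1, fun f hf => hf.elim⟩
  | @insert f F hf _ ih =>
    obtain ⟨t, ht⟩ := ih (hF.mono (Set.subset_insert _ _))
    have hn : ¬ Γ.Conn F (Γ.src f) (Γ.tgt f) := fun h => by
      obtain ⟨C, hC, -, hCF⟩ := exists_isReducedCycle hf h
      exact hF C hCF hC
    -- The new edge `f` joins two components of `F`. Translating the potential on one of them on the
    -- left makes it fit along `f` and changes no differences inside the component.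
    refine ⟨fun v => if Γ.Conn F (Γ.tgt f) v then
      t (Γ.src f) * FreeGroup.of f * (t (Γ.tgt f))⁻¹ * t v else t v, ?_⟩
    beta_reduce
    rintro e (rfl | he)
    · rw [if_pos (Conn.refl _), if_neg fun h => hn h.symm]
      group
    · have h1 : Γ.Conn F (Γ.src e) (Γ.tgt e) := .edge he
      by_cases h : Γ.Conn F (Γ.tgt f) (Γ.src e)
      · rw [if_pos h, if_pos (h.trans h1), ht e he]
        group
      · rw [if_neg h, if_neg fun h' => h (h'.trans h1.symm), ht e he]

/-- The words of the paths from the basepoint in a maximal tree. -/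
theorem IsMaximalTree.exists_potential {T : Set Γ.E} (hT : Γ.IsMaximalTree T) :
    ∃ t : Γ.V → FreeGroup Γ.E, (∀ f ∈ T, FreeGroup.of f = (t (Γ.src f))⁻¹ * t (Γ.tgt f)) ∧
      t Γ.base = 1 ∧ ∀ v, Γ.PathIn T Γ.base v (t v) := by
  obtain ⟨t, ht⟩ := hT.1.exists_potential
  refine ⟨fun v => (t Γ.base)⁻¹ * t v, fun f hf => ?_, by simp, fun v => ?_⟩
  · rw [ht f hf]
    group
  · obtain ⟨g, hg⟩ := (hT.2 Γ.base v).exists_pathIn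
    have := hg.hom_eq (φ := MonoidHom.id _) ht
    beta_reduce
    rw [← this]
    exact hg

namespace CMap

theorem pathIn_map (κ : CMap Γ Δ F) {S : Set Γ.E} {v w : Γ.V} {g : FreeGroup Γ.E}
    (hg : Γ.PathIn S v w g) : Δ.PathIn (κ.inv ⁻¹' S) (κ.vert v) (κ.vert w) (κ.hom g) := by
  have key : ∀ e ∈ S, Δ.PathIn (κ.inv ⁻¹' S) (κ.vert (Γ.src e)) (κ.vert (Γ.tgt e))
      (κ.hom (FreeGroup.of e)) := by
    intro e he
    by_cases heF : e ∈ F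
    · rw [κ.hom_of_mem heF, κ.vert_src_eq heF]
      exact .refl
    · obtain ⟨a, rfl⟩ := κ.exists_inv heF
      rw [κ.hom_inv, κ.src, κ.tgt]
      split_ifs
      · exact .inv_of_mem he
      · exact .of_mem he
  induction hg with
  | refl => rw [map_one]; exact .refl
  | fwd e k he _ ih => rw [map_mul]; exact ih.trans (key e he)
  | bwd e k he _ ih => rw [map_mul, map_inv]; exact ih.trans (key e he).symm

theorem exists_pathIn_of_conn (κ : CMap Γ Δ F) {v w : Γ.V} (h : Γ.Conn F v w) :
    ∃ g, Γ.PathIn F v w g ∧ κ.hom g = 1 := by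
  obtain ⟨g, hg⟩ := h.exists_pathIn
  exact ⟨g, hg, Subgroup.mem_bot.1 (hg.hom_mem fun e he =>
    Subgroup.mem_bot.2 (κ.hom_of_mem he))⟩

theorem exists_pathIn (κ : CMap Γ Δ F) {S : Set Δ.E} {x y : Δ.V} {h : FreeGroup Δ.E}
    (hh : Δ.PathIn S x y h) {v w : Γ.V} (hv : κ.vert v = x) (hw : κ.vert w = y) :
    ∃ g, Γ.PathIn (F ∪ κ.inv '' S) v w g ∧ κ.hom g = h := by
  have hconn : ∀ {u u'}, κ.vert u = κ.vert u' →
      ∃ g, Γ.PathIn (F ∪ κ.inv '' S) u u' g ∧ κ.hom g = 1 := fun h => by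
    obtain ⟨g, hg, hg'⟩ := κ.exists_pathIn_of_conn ((κ.vert_eq_iff _ _).1 h)
    exact ⟨g, hg.mono Set.subset_union_left, hg'⟩
  have key : ∀ a ∈ S, ∃ u u' g, κ.vert u = Δ.src a ∧ κ.vert u' = Δ.tgt a ∧
      Γ.PathIn (F ∪ κ.inv '' S) u u' g ∧ κ.hom g = FreeGroup.of a := by
    intro a ha
    have h1 := κ.src a
    have h2 := κ.tgt a
    have h3 := κ.hom_inv a
    have h4 : κ.inv a ∈ F ∪ κ.inv '' S := Or.inr ⟨a, ha, rfl⟩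
    split_ifs at h1 h2 h3 with hf
    · exact ⟨_, _, _, h2, h1, .inv_of_mem h4, by rw [map_inv, h3, inv_inv]⟩
    · exact ⟨_, _, _, h1, h2, .of_mem h4, h3⟩
  induction hh generalizing w with
  | refl =>
    exact hconn (hv.trans hw.symm)
  | fwd a k ha _ ih =>
    obtain ⟨u, u', g, hu, hu', hg, hg'⟩ := key a ha
    obtain ⟨g1, h1, h1'⟩ := ih hu
    obtain ⟨g2, h2, h2'⟩ := hconn (hu'.trans hw.symm)
    exact ⟨g1 * g * g2, (h1.trans hg).trans h2, by rw [map_mul, map_mul, h1', hg', h2', mul_one]⟩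
  | bwd a k ha _ ih =>
    obtain ⟨u, u', g, hu, hu', hg, hg'⟩ := key a ha
    obtain ⟨g1, h1, h1'⟩ := ih hu'
    obtain ⟨g2, h2, h2'⟩ := hconn (hu.trans hw.symm)
    exact ⟨g1 * g⁻¹ * g2, (h1.trans hg.symm).trans h2,
      by rw [map_mul, map_mul, map_inv, h1', hg', h2', mul_one]⟩

/-- Collapsing a forest is injective on homotopy classes of paths. -/
theorem hom_injOn (κ : CMap Γ Δ F) (hF : Γ.IsForest F) {v w : Γ.V} {g g' : FreeGroup Γ.E}
    (hg : Γ.PathClass v w g) (hg' : Γ.PathClass v w g') (h : κ.hom g = κ.hom g') : g = g' := by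
  obtain ⟨t, ht⟩ := hF.exists_potential
  -- The map `σ` undoes the collapse up to the potential: it sends the image of an edge `e` to `t
  -- (src e) * e * (t (tgt e))⁻¹`, which is 1 on the collapsed edges. Along a path the inner factors
  -- cancel, so the word is recovered from its image and its ends.
  let σ : FreeGroup Δ.E →* FreeGroup Γ.E := FreeGroup.lift fun a =>
    if κ.flip a then t (Γ.tgt (κ.inv a)) * (FreeGroup.of (κ.inv a))⁻¹ * (t (Γ.src (κ.inv a)))⁻¹
    else t (Γ.src (κ.inv a)) * FreeGroup.of (κ.inv a) * (t (Γ.tgt (κ.inv a)))⁻¹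
  have key : ∀ e, σ (κ.hom (FreeGroup.of e)) =
      t (Γ.src e) * FreeGroup.of e * (t (Γ.tgt e))⁻¹ := by
    intro e
    by_cases he : e ∈ F
    · rw [κ.hom_of_mem he, map_one, ht e he]
      group
    · obtain ⟨a, rfl⟩ := κ.exists_inv he
      rw [κ.hom_inv]
      cases hf : κ.flip a
      · simp [σ, hf]
      · simp [σ, hf, mul_assoc]
  have hpath : ∀ {w g}, Γ.PathClass v w g → σ (κ.hom g) = t v * g * (t w)⁻¹ := by
    intro w g hg
    induction hg with
    | refl => simp
    | fwd e k _ ih => rw [map_mul, map_mul, ih, key]; group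
    | bwd e k _ ih => rw [map_mul, map_mul, map_inv, map_inv, ih, key]; group
  have h1 := hpath hg
  rw [h, hpath hg'] at h1
  exact (mul_left_cancel (mul_right_cancel h1)).symm

theorem map_pi1 (κ : CMap Γ Δ F) : Γ.pi1.map κ.hom = Δ.pi1 := by
  ext h
  constructor
  · rintro ⟨g, hg, rfl⟩
    have := (κ.pathIn_map (PathIn.of_pathClass hg)).pathClass
    rw [κ.base] at this
    exact this
  · intro hh
    obtain ⟨g, hg, hg'⟩ := κ.exists_pathIn (PathIn.of_pathClass hh) κ.base κ.base
    exact ⟨g, hg.pathClass, hg'⟩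

end CMap

end Potential

end PointedGraph

/-! ### Pushing markings forward -/

namespace MarkedGraph

variable {n : ℕ}

theorem marking_mem (m : MarkedGraph n) (x : FreeGroup (Fin n)) :
    m.graph.PathClass m.graph.base m.graph.base (m.marking x) := by
  have : m.marking x ∈ m.graph.pi1 := by
    rw [← m.marking_range]
    exact ⟨x, rfl⟩
  exact this

theorem exists_marking (m : MarkedGraph n) {g : FreeGroup m.graph.E}
    (hg : m.graph.PathClass m.graph.base m.graph.base g) : ∃ x, m.marking x = g := by
  have : g ∈ m.graph.pi1 := hg
  rwa [← m.marking_range] at this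

/-- The marked graph obtained by a forest collapse. -/
abbrev push (m : MarkedGraph n) (hc : m.graph.IsCactus) {Δ : PointedGraph} {F : Set m.graph.E}
    (κ : CMap m.graph Δ F) (hF : m.graph.IsForest F) : MarkedGraph n where
  graph := Δ
  reduced := κ.isReduced m.reduced hc hF
  marking := κ.hom.comp m.marking
  marking_injective := fun x y h =>
    m.marking_injective (κ.hom_injOn hF (m.marking_mem x) (m.marking_mem y) h)
  marking_range := by
    rw [MonoidHom.range_comp, m.marking_range, κ.map_pi1]

/-- The vertex of the spine that is represented by a marked graph. -/
def vtx (m : MarkedGraph n) : AuterVertex n := Quotient.mk _ m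

variable {m m' : MarkedGraph n}

theorem vtx_eq_of_iso (α : Iso m.graph m'.graph) (h : α.hom.comp m.marking = m'.marking) :
    m.vtx = m'.vtx := Quotient.sound ⟨α, h⟩

theorem exists_iso_of_vtx_eq (h : m.vtx = m'.vtx) :
    ∃ α : Iso m.graph m'.graph, α.hom.comp m.marking = m'.marking := Quotient.exact h

theorem vtx_push_eq (hc : m.graph.IsCactus) {Δ Δ' : PointedGraph} {F : Set m.graph.E}
    (κ : CMap m.graph Δ F) (κ' : CMap m.graph Δ' F) (hF : m.graph.IsForest F) :
    (m.push hc κ hF).vtx = (m.push hc κ' hF).vtx :=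
  vtx_eq_of_iso (κ.iso κ') (by
    change (κ.iso κ').hom.comp (κ.hom.comp m.marking) = κ'.hom.comp m.marking
    rw [← MonoidHom.comp_assoc, CMap.iso_hom_comp])

open Classical in
/-- The vertex of the spine that is obtained by collapsing the forest `F`. -/
def cls (m : MarkedGraph n) (F : Set m.graph.E) : AuterVertex n :=
  -- The value in the other case plays no role; totality allows this function to be used with
  -- `Finsupp.mapDomain`.
  if h : m.graph.IsCactus ∧ m.graph.IsForest F then
    (m.push h.1 (CMap.ofCollapse m.graph F) h.2).vtx else m.vtx

theorem cls_eq_vtx_push (hc : m.graph.IsCactus) {Δ : PointedGraph} {F : Set m.graph.E}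
    (κ : CMap m.graph Δ F) (hF : m.graph.IsForest F) :
    m.cls F = (m.push hc κ hF).vtx := by
  rw [cls, dif_pos ⟨hc, hF⟩]
  exact vtx_push_eq hc _ _ hF

theorem cls_eq_vtx {m' : MarkedGraph n} (hc : m.graph.IsCactus) {F : Set m.graph.E}
    (κ : CMap m.graph m'.graph F) (hF : m.graph.IsForest F)
    (h : κ.hom.comp m.marking = m'.marking) : m.cls F = m'.vtx := by
  rw [cls_eq_vtx_push hc κ hF]
  refine vtx_eq_of_iso (Iso.refl _) ?_
  erw [Iso.refl_hom, ← h]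
  rfl

theorem cls_empty (hc : m.graph.IsCactus) : m.cls ∅ = m.vtx :=
  cls_eq_vtx hc (CMap.ofIso (Iso.refl _)) isForest_empty (by
    rw [CMap.ofIso_hom, Iso.refl_hom, MonoidHom.id_comp])

theorem cls_of_cmap (hc : m.graph.IsCactus) {F : Set m.graph.E}
    (κ : CMap m.graph m'.graph F) (hF : m.graph.IsForest F)
    (h : κ.hom.comp m.marking = m'.marking) {G : Set m'.graph.E} (hG : m'.graph.IsForest G) :
    m'.cls G = m.cls (F ∪ κ.inv '' G) := by
  rw [cls_eq_vtx_push (κ.isCactus hc hF) (CMap.ofCollapse m'.graph G) hG]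
  refine (cls_eq_vtx hc (κ.comp (CMap.ofCollapse m'.graph G)) (κ.isForest_union hc hF hG) ?_).symm
  rw [CMap.comp_hom, MonoidHom.comp_assoc, h]

/-- Collapse maps with arbitrary targets compose more easily than a quotient graph followed by an
isomorphism. -/
theorem collapsesTo_iff : m.CollapsesTo m' ↔ ∃ F, m.graph.IsForest F ∧
    ∃ κ : CMap m.graph m'.graph F, κ.hom.comp m.marking = m'.marking := by
  constructor
  · rintro ⟨F, hF, α, hα⟩
    have h0 : F ∪ (CMap.ofCollapse m.graph F).inv '' ∅ = F := by simp
    let κ := (CMap.ofCollapse m.graph F).comp (CMap.ofIso α)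
    have hκ : κ.hom.comp m.marking = m'.marking := by
      rw [CMap.comp_hom, CMap.ofIso_hom, CMap.ofCollapse_hom, MonoidHom.comp_assoc, hα]
    exact ⟨_, h0.symm ▸ hF, κ, hκ⟩
  · rintro ⟨F, hF, κ, hκ⟩
    refine ⟨F, hF, (CMap.ofCollapse m.graph F).iso κ, ?_⟩
    rw [← MonoidHom.comp_assoc, ← CMap.ofCollapse_hom, CMap.iso_hom_comp, hκ]

/-- Collapsing a larger forest is a further collapse. -/
theorem cls_collapsesTo (hc : m.graph.IsCactus) {F F' : Set m.graph.E} (hF : m.graph.IsForest F')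
    (h : F ⊆ F') : (m.cls F).CollapsesTo (m.cls F') := by
  have hF0 := hF.mono h
  let κ := CMap.ofCollapse m.graph F
  let m1 := m.push hc κ hF0
  have hG : F ∪ κ.inv '' (κ.inv ⁻¹' F') = F' := by
    rw [Set.image_preimage_eq_inter_range, κ.range]
    ext e
    simp only [Set.mem_union, Set.mem_inter_iff, Set.mem_compl_iff]
    have := @h e
    tauto
  have hGf : m1.graph.IsForest (κ.inv ⁻¹' F') := by
    intro C hC hC'
    obtain ⟨D, hD, hDC⟩ := κ.exists_preimage_eq hc hF0 hC'
    refine hF D (fun e he => ?_) hD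
    by_cases heF : e ∈ F
    · exact h heF
    · obtain ⟨a, rfl⟩ := κ.exists_inv heF
      have : a ∈ C := hDC ▸ he
      exact hC this
  have hc1 : m1.graph.IsCactus := κ.isCactus hc hF0
  refine ⟨m1, m1.push hc1 (CMap.ofCollapse _ _) hGf, (cls_eq_vtx_push hc κ hF0).symm, ?_,
    collapsesTo_iff.2 ⟨_, hGf, CMap.ofCollapse _ _, rfl⟩⟩
  exact (cls_eq_vtx_push hc1 _ hGf).symm.trans
    ((cls_of_cmap (m' := m1) hc κ hF0 rfl hGf).trans (congrArg m.cls hG))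

/-! ### The rank, and symmetric markings -/

/-- The fundamental group of a graph with one vertex is the free group on the edges. -/
theorem pi1_eq_top {Γ : PointedGraph} (h : ∀ v w : Γ.V, v = w) : Γ.pi1 = ⊤ := by
  rw [eq_top_iff]
  rintro g -
  induction g using FreeGroup.induction_on with
  | C1 => exact one_mem _
  | of e =>
    change Γ.PathClass _ _ _
    have := (PathIn.of_mem (Set.mem_univ e)).pathClass
    rwa [h (Γ.src e) Γ.base, h (Γ.tgt e) Γ.base] at this
  | inv_of e ih => exact inv_mem ih
  | mul x y hx hy => exact mul_mem hx hy

/-- The isomorphism of free groups that is obtained from a marking by collapsing a maximal tree. -/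
def roseEquiv (m : MarkedGraph n) {T : Set m.graph.E} (hT : m.graph.IsMaximalTree T) :
    FreeGroup (Fin n) ≃* FreeGroup {e // e ∉ T} :=
  MulEquiv.ofBijective ((collapseHom T).comp m.marking) (by
    rw [← CMap.ofCollapse_hom]
    constructor
    · exact fun x y h => m.marking_injective
        ((CMap.ofCollapse m.graph T).hom_injOn hT.1 (m.marking_mem x) (m.marking_mem y) h)
    · rw [← MonoidHom.range_eq_top, MonoidHom.range_comp, m.marking_range, CMap.map_pi1]
      apply pi1_eq_top
      intro v w
      obtain ⟨v, rfl⟩ := (CMap.ofCollapse m.graph T).surj v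
      obtain ⟨w, rfl⟩ := (CMap.ofCollapse m.graph T).surj w
      exact ((CMap.ofCollapse m.graph T).vert_eq_iff _ _).2 (hT.2 v w))

/-- Collapsing a maximal tree makes the edges outside it a basis of a free group of rank `n`, and
there is one such edge on each cycle. -/
theorem ncard_cycles (m : MarkedGraph n) (hc : m.graph.IsCactus) : m.graph.cycles.ncard = n := by
  obtain ⟨T, -, hT⟩ := hc.exists_maximalTree_of_isForest m.reduced.connected isForest_empty
  rw [← hc.card_compl_maximalTree hT, ← Nat.card_congr (Equiv.ofFreeGroupEquiv (m.roseEquiv hT)),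
    Nat.card_fin]

theorem coweight_le_iff (m : MarkedGraph n) (hc : m.graph.IsCactus) (c : ℕ) :
    m.coweight ≤ c ↔ m.graph.farCycles.ncard ≤ c := by
  have h1 := m.graph.weight_add_ncard_farCycles
  rw [m.ncard_cycles hc] at h1
  unfold coweight
  omega

/-- An element that is conjugate to a basis element or to the inverse of one. -/
def _root_.FreeGroup.IsConjGen {X : Type*} (g : FreeGroup X) : Prop :=
  ∃ x, IsConj g (FreeGroup.of x) ∨ IsConj g (FreeGroup.of x)⁻¹

theorem _root_.FreeGroup.IsConjGen.map {X Y : Type*} {φ : FreeGroup X →* FreeGroup Y}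
    (hφ : ∀ x, (φ (FreeGroup.of x)).IsConjGen) {g : FreeGroup X} (hg : g.IsConjGen) :
    (φ g).IsConjGen := by
  obtain ⟨x, hx⟩ := hg
  obtain ⟨y, hy⟩ := hφ x
  refine ⟨y, ?_⟩
  rcases hx with hx | hx <;> have h1 := φ.map_isConj hx
  · exact hy.imp h1.trans h1.trans
  · rw [map_inv] at h1
    rcases hy with hy | hy
    · exact Or.inr (h1.trans (isConj_inv hy))
    · exact Or.inl (h1.trans (isConj_inv_left hy))

/-- Two generators with the same target would be conjugate up to inversion, which is impossible for
different basis elements. So `A` permutes the classes of generators bijectively, the ranks being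
equal, and this can be inverted. -/
theorem isConjGen_symm {X : Type} (A : FreeGroup (Fin n) ≃* FreeGroup X)
    (hA : ∀ i, (A (FreeGroup.of i)).IsConjGen) (x : X) : (A.symm (FreeGroup.of x)).IsConjGen := by
  have hX : Finite X := Finite.of_equiv _ (Equiv.ofFreeGroupEquiv A)
  have hsymm : ∀ {g y}, IsConj (A g) y → IsConj g (A.symm y) := fun {g y} h => by
    simpa using A.symm.toMonoidHom.map_isConj h
  choose σ hσ using hA
  have hinj : Function.Injective σ := by
    intro i k hik
    have key : IsConj (A (FreeGroup.of i)) (A (FreeGroup.of k)) ∨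
        IsConj (A (FreeGroup.of i)) (A (FreeGroup.of k))⁻¹ := by
      have h1 := hσ i
      have h2 := hσ k
      rw [← hik] at h2
      rcases h1 with h1 | h1 <;> rcases h2 with h2 | h2
      · exact Or.inl (h1.trans h2.symm)
      · exact Or.inr (h1.trans (by simpa using (isConj_inv h2).symm))
      · exact Or.inr (h1.trans (isConj_inv h2).symm)
      · exact Or.inl (h1.trans h2.symm)
    apply eq_of_isConj_of
    rcases key with key | key
    · exact Or.inl (by simpa using hsymm key)
    · exact Or.inr (by simpa using hsymm key)
  have hbij : Function.Bijective σ :=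
    hinj.bijective_of_nat_card_le (Nat.card_congr (Equiv.ofFreeGroupEquiv A)).ge
  obtain ⟨i, rfl⟩ := hbij.2 x
  refine ⟨i, ?_⟩
  rcases hσ i with h | h
  · exact Or.inl (hsymm h).symm
  · refine Or.inr ?_
    have := isConj_inv (hsymm h).symm
    simpa using this

theorem isSymmetric_iff : m.IsSymmetric ↔ ∀ T : Set m.graph.E, m.graph.IsMaximalTree T →
    ∀ i, (collapseHom T (m.marking (FreeGroup.of i))).IsConjGen := Iff.rfl

/-- A maximal tree of `Δ` together with `F` is a maximal tree upstairs, and the two resulting roses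
differ only by the names and orientations of the petals. -/
theorem push_isSymmetric (hc : m.graph.IsCactus) {Δ : PointedGraph} {F : Set m.graph.E}
    (κ : CMap m.graph Δ F) (hF : m.graph.IsForest F) (hs : m.IsSymmetric) :
    (m.push hc κ hF).IsSymmetric := by
  rw [isSymmetric_iff] at hs ⊢
  intro T hT i
  change Set Δ.E at T
  have h1 := hs _ (κ.isMaximalTree_union hc hF hT) i
  have h2 := CMap.iso_hom_comp (CMap.ofCollapse m.graph (F ∪ κ.inv '' T))
    (κ.comp (CMap.ofCollapse Δ T))
  rw [CMap.ofCollapse_hom, CMap.comp_hom, CMap.ofCollapse_hom] at h2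
  have h3 := DFunLike.congr_fun h2 (m.marking (FreeGroup.of i))
  change (collapseHom T (κ.hom (m.marking (FreeGroup.of i)))).IsConjGen
  rw [MonoidHom.comp_apply, MonoidHom.comp_apply] at h3
  rw [← h3]
  refine h1.map fun e => ?_
  rw [Iso.hom, FreeGroup.lift_apply_of]
  split_ifs
  · exact ⟨_, Or.inr (IsConj.refl _)⟩
  · exact ⟨_, Or.inl (IsConj.refl _)⟩

/-- Any two symmetric markings of a cactus graph differ by a symmetric automorphism. -/
theorem exists_act_eq (hc : m.graph.IsCactus) (hs : m.IsSymmetric) (hs' : m'.IsSymmetric)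
    (α : Iso m.graph m'.graph) :
    ∃ φ ∈ SAut n, m'.vtx = AuterVertex.act φ m.vtx ∧
      α.hom.comp (m.marking.comp φ.toMonoidHom) = m'.marking := by
  let m1 := m.push hc (CMap.ofIso α) isForest_empty
  have hs1 : m1.IsSymmetric := push_isSymmetric hc _ _ hs
  have hc1 : m'.graph.IsCactus := (CMap.ofIso α).isCactus hc isForest_empty
  obtain ⟨T, -, hT⟩ := hc1.exists_maximalTree_of_isForest m'.reduced.connected isForest_empty
  let A := m1.roseEquiv hT
  let A' := m'.roseEquiv hT
  -- Both markings are compared in the rose obtained from one maximal tree; as the collapse is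
  -- injective on loops, agreement in the rose lifts to the graph.
  let φ : MulAut (FreeGroup (Fin n)) := A'.trans A.symm
  have hφ : φ ∈ SAut n := by
    intro i
    have h1 : (A' (FreeGroup.of i)).IsConjGen := hs' T hT i
    exact FreeGroup.IsConjGen.map (φ := A.symm.toMonoidHom) (isConjGen_symm A (hs1 T hT)) h1
  have hm : α.hom.comp (m.marking.comp φ.toMonoidHom) = m'.marking := by
    have hm1 : ∀ x, m1.marking (φ x) = m'.marking x := by
      intro x
      apply (CMap.ofCollapse m'.graph T).hom_injOn hT.1 (m1.marking_mem _) (m'.marking_mem _)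
      rw [CMap.ofCollapse_hom]
      change A (A.symm (A' x)) = A' x
      exact A.apply_symm_apply _
    ext i
    rw [← hm1]
    change _ = (CMap.ofIso α).hom _
    rw [CMap.ofIso_hom]
    rfl
  exact ⟨φ, hφ, (vtx_eq_of_iso (m := m.precomp φ) α hm).symm, hm⟩

end MarkedGraph

/-- Every cactus graph has a symmetric marking. -/
theorem PointedGraph.IsCac.exists_marking {Γ : PointedGraph} {n c : ℕ} (h : Γ.IsCac n c) :
    ∃ ρ : FreeGroup (Fin n) →* FreeGroup Γ.E, Function.Injective ρ ∧ ρ.range = Γ.pi1 ∧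
      ∀ T : Set Γ.E, Γ.IsMaximalTree T → ∀ i,
        (collapseHom T (ρ (FreeGroup.of i))).IsConjGen := by
  obtain ⟨T, -, hT⟩ := h.cac.exists_maximalTree_of_isForest h.red.connected isForest_empty
  obtain ⟨t, ht, htb, htp⟩ := hT.exists_potential
  have hcard : Nat.card {e // e ∉ T} = n := (h.cac.card_compl_maximalTree hT).trans h.card
  let ε : Fin n ≃ {e // e ∉ T} := (Finite.equivFinOfCardEq hcard).symm
  -- The loop that runs in the tree to `e`, crosses `e`, and returns in the tree.
  let r : {e // e ∉ T} → FreeGroup Γ.E :=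
    fun e => t (Γ.src e.1) * FreeGroup.of e.1 * (t (Γ.tgt e.1))⁻¹
  let ρ : FreeGroup (Fin n) →* FreeGroup Γ.E := FreeGroup.lift fun i => r (ε i)
  have hct : ∀ v, collapseHom T (t v) = 1 := fun v => Subgroup.mem_bot.1
    ((htp v).hom_mem fun e he => Subgroup.mem_bot.2 (by
      rw [← CMap.ofCollapse_hom, CMap.hom_of_mem _ he]))
  have hcr : (collapseHom T).comp ρ = (FreeGroup.freeGroupCongr ε).toMonoidHom := by
    ext i
    simp only [ρ, r, MonoidHom.comp_apply, FreeGroup.lift_apply_of, map_mul, map_inv, hct]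
    simp [collapseHom, (ε i).2]
  have hbij : Function.Bijective ((collapseHom T).comp ρ) := by
    rw [hcr]
    exact (FreeGroup.freeGroupCongr ε).bijective
  have hle : ρ.range ≤ Γ.pi1 := by
    rintro _ ⟨x, rfl⟩
    induction x using FreeGroup.induction_on with
    | C1 => rw [map_one]; exact one_mem _
    | of i =>
      simp only [ρ, FreeGroup.lift_apply_of]
      have h1 : Γ.PathIn Set.univ _ _ (r (ε i)) := (((htp _).mono (Set.subset_univ _)).trans
        (PathIn.of_mem (Set.mem_univ (ε i).1))).trans ((htp _).symm.mono (Set.subset_univ _))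
      exact h1.pathClass
    | inv_of i ih => rw [map_inv]; exact inv_mem ih
    | mul x y hx hy => rw [map_mul]; exact mul_mem hx hy
  refine ⟨ρ, Function.Injective.of_comp hbij.1, hle.antisymm fun g hg => ?_, fun T' hT' i => ?_⟩
  · obtain ⟨x, hx⟩ := hbij.2 (collapseHom T g)
    refine ⟨x, (CMap.ofCollapse Γ T).hom_injOn hT.1 (hle ⟨x, rfl⟩) hg ?_⟩
    rw [CMap.ofCollapse_hom]
    exact hx
  · obtain ⟨C, hC, heC⟩ := h.cac.exists_cycle (ε i).1
    have hCT : C \ {(ε i).1} ⊆ T := by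
      obtain ⟨f, hf, hfT, hCf⟩ := h.cac.diff_maximalTree hT hC
      have : (ε i).1 ∈ C \ T := ⟨heC, (ε i).2⟩
      rw [hCf] at this
      rw [show (ε i).1 = f from this]
      intro g hg
      by_contra hgT
      have : g ∈ C \ T := ⟨hg.1, hgT⟩
      rw [hCf] at this
      exact hg.2 this
    obtain ⟨W, hW⟩ := hC.simplePath heC
    obtain ⟨q, hq, hq1, hq2⟩ := hW.exists_word
    have hqt := (hq.mono hCT).hom_eq (φ := MonoidHom.id _) ht
    rw [MonoidHom.id_apply] at hqt
    -- The rest of the cycle `C` lies in `T`, so the generator is conjugate to the word that runs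
    -- once around `C`. Any other maximal tree omits exactly one edge `f` of `C`, and only the
    -- letter of `f` survives its collapse.
    have hρ : ρ (FreeGroup.of i) = t (Γ.src (ε i).1) *
        (FreeGroup.of (ε i).1 * q⁻¹) * (t (Γ.src (ε i).1))⁻¹ := by
      rw [hqt]
      simp only [ρ, r, FreeGroup.lift_apply_of]
      group
    obtain ⟨f, hf, hfT, hCf⟩ := h.cac.diff_maximalTree hT' hC
    have hkill : ∀ g ∈ C, g ≠ f → collapseHom T' (FreeGroup.of g) = 1 := by
      intro g hg hgf
      have hgT : g ∈ T' := by
        by_contra hgT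
        have : g ∈ C \ T' := ⟨hg, hgT⟩
        rw [hCf] at this
        exact hgf this
      rw [← CMap.ofCollapse_hom, CMap.hom_of_mem _ hgT]
    have hf1 : collapseHom T' (FreeGroup.of f) = FreeGroup.of ⟨f, hfT⟩ := by
      simp [collapseHom, hfT]
    have hconj : IsConj (collapseHom T' (ρ (FreeGroup.of i)))
        (collapseHom T' (FreeGroup.of (ε i).1 * q⁻¹)) := by
      rw [hρ, map_mul, map_mul, map_inv]
      exact (isConj_iff.2 ⟨_, rfl⟩ : IsConj (collapseHom T' (FreeGroup.of (ε i).1 * q⁻¹)) _).symm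
    refine ⟨⟨f, hfT⟩, ?_⟩
    by_cases hef : (ε i).1 = f
    · left
      have := hq1 _ (collapseHom T') fun g hg => hkill g hg.1 (hef ▸ hg.2)
      rwa [map_mul, map_inv, this, inv_one, mul_one, hef, hf1] at hconj
    · have := hq2 f ⟨hf, fun h => hef h.symm⟩ _ (collapseHom T') fun g hg hgf => hkill g hg.1 hgf
      rw [map_mul, map_inv, hkill _ heC hef, one_mul] at hconj
      rcases this with h | h
      · right
        rwa [h, hf1] at hconj
      · left
        rwa [h, hf1, inv_inv] at hconj

end CactusSpace

namespace CactusSpace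

open PointedGraph

namespace PointedGraph

/-! ### A collapse is determined by its effect on the marking -/

section Rigid

variable {Γ Δ : PointedGraph}

/-- A loop avoiding `κ.inv a` maps to a loop avoiding `a`. Its lift through `κ'` avoids `κ'.inv a`
and spells the same word by injectivity. Thus the effect on loops remembers which edge lies over
`a`. -/
theorem CMap.pathIn_of_hom_eq {F F' : Set Γ.E} (κ : CMap Γ Δ F) (κ' : CMap Γ Δ F')
    (hF' : Γ.IsForest F') (h : ∀ g, Γ.PathClass Γ.base Γ.base g → κ.hom g = κ'.hom g) (a : Δ.E)
    {g : FreeGroup Γ.E} (hg : Γ.PathIn {κ.inv a}ᶜ Γ.base Γ.base g) :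
    Γ.PathIn {κ'.inv a}ᶜ Γ.base Γ.base g := by
  have h1 := κ.pathIn_map hg
  rw [h g hg.pathClass, κ.base] at h1
  obtain ⟨g', hg', h2⟩ := κ'.exists_pathIn h1 κ'.base κ'.base
  rw [← κ'.hom_injOn hF' hg'.pathClass hg.pathClass h2]
  refine hg'.mono ?_
  rintro e (he | ⟨b, hb, rfl⟩) hea
  · rw [show e = κ'.inv a from hea] at he
    exact κ'.inv_notMem a he
  · rw [κ'.inj hea] at hb
    exact hb rfl

/-- A loop that represents the edge `d` outside a maximal tree. -/
theorem pathIn_compl_of_potential {T : Set Γ.E} {t : Γ.V → FreeGroup Γ.E}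
    (htp : ∀ v, Γ.PathIn T Γ.base v (t v)) {d e : Γ.E} (hde : d ≠ e) (he : e ∉ T) :
    Γ.PathIn {e}ᶜ Γ.base Γ.base (t (Γ.src d) * FreeGroup.of d * (t (Γ.tgt d))⁻¹) := by
  have h1 : T ⊆ {e}ᶜ := fun f hf hfe => he (hfe ▸ hf)
  exact (((htp _).mono h1).trans (.of_mem hde)).trans ((htp _).mono h1).symm

/-- Choose a maximal tree that omits both edges. The loop through the tree around `e'` avoids `e`,
but its exponent sum in `e'` is 1. -/
theorem exists_pathIn_compl_of_ne_cycle (hr : Γ.IsReduced) (hc : Γ.IsCactus) {C D : Set Γ.E}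
    (hC : Γ.IsReducedCycle C) (hD : Γ.IsReducedCycle D) (hCD : C ≠ D) {e e' : Γ.E} (he : e ∈ C)
    (he' : e' ∈ D) : ∃ g, Γ.PathIn {e}ᶜ Γ.base Γ.base g ∧ ¬ Γ.PathIn {e'}ᶜ Γ.base Γ.base g := by
  classical
  have hs : ∀ B : Set Γ.E, ∃ f, Γ.IsReducedCycle B → f ∈ B ∧ (B = C → f = e) ∧ (B = D → f = e') := by
    intro B
    by_cases h1 : B = C
    · exact ⟨e, fun _ => ⟨h1 ▸ he, fun _ => rfl, fun h => absurd (h1.symm.trans h) hCD⟩⟩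
    by_cases h2 : B = D
    · exact ⟨e', fun _ => ⟨h2 ▸ he', fun h => absurd h h1, fun _ => rfl⟩⟩
    by_cases h3 : B.Nonempty
    · exact ⟨h3.some, fun _ => ⟨h3.some_mem, fun h => absurd h h1, fun h => absurd h h2⟩⟩
    · exact ⟨e, fun h => absurd h.nonempty h3⟩
  choose s hs using hs
  obtain ⟨T, hT, hT'⟩ := hc.exists_maximalTree hr.connected s fun B hB => (hs B hB).1
  obtain ⟨t, ht, -, htp⟩ := hT.exists_potential
  have heT : e ∉ T := by
    have : e ∈ C \ T := by rw [hT' C hC, (hs C hC).2.1 rfl]; rfl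
    exact this.2
  have heT' : e' ∉ T := by
    have : e' ∈ D \ T := by rw [hT' D hD, (hs D hD).2.2 rfl]; rfl
    exact this.2
  have hne : e' ≠ e := fun h => hCD (hc.eq_of_mem hC hD he (h ▸ he'))
  refine ⟨_, pathIn_compl_of_potential htp hne heT, fun hg => ?_⟩
  let φ : FreeGroup Γ.E →* Multiplicative ℤ :=
    FreeGroup.lift fun f => if f = e' then Multiplicative.ofAdd 1 else 1
  have hφ : ∀ f, f ≠ e' → φ (FreeGroup.of f) = 1 := fun f hf => by simp [φ, hf]
  have hφt : ∀ v, φ (t v) = 1 := fun v => Subgroup.mem_bot.1 ((htp v).hom_mem fun f hf =>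
    Subgroup.mem_bot.2 (hφ f fun h => heT' (h ▸ hf)))
  have h1 := Subgroup.mem_bot.1 (hg.hom_mem (φ := φ) (H := ⊥) fun f hf =>
    Subgroup.mem_bot.2 (hφ f hf))
  rw [map_mul, map_mul, map_inv, hφt, hφt, inv_one, mul_one, one_mul,
    show φ (FreeGroup.of e') = Multiplicative.ofAdd 1 by simp [φ]] at h1
  exact absurd h1 (by decide)

/-- With a tree that contains all of `C` but `e`, cross `e'` to its far end `v`, go around a second
cycle through `v`, and return. The second cycle exists because `v` is at least 3-valent. The loop
avoids `e` and crosses `e'` back and forth, so only a nonabelian quotient can detect `e'`. -/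
theorem exists_pathIn_compl_of_mem_cycle (hr : Γ.IsReduced) (hc : Γ.IsCactus) {C : Set Γ.E}
    (hC : Γ.IsReducedCycle C) {e e' : Γ.E} (he : e ∈ C) (he' : e' ∈ C) (hne : e' ≠ e) :
    ∃ g, Γ.PathIn {e}ᶜ Γ.base Γ.base g ∧ ¬ Γ.PathIn {e'}ᶜ Γ.base Γ.base g := by
  classical
  have hs : ∀ B : Set Γ.E, ∃ f, Γ.IsReducedCycle B → f ∈ B ∧ (B = C → f = e) := by
    intro B
    by_cases h1 : B = C
    · exact ⟨e, fun _ => ⟨h1 ▸ he, fun _ => rfl⟩⟩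
    by_cases h3 : B.Nonempty
    · exact ⟨h3.some, fun _ => ⟨h3.some_mem, fun h => absurd h h1⟩⟩
    · exact ⟨e, fun h => absurd h.nonempty h3⟩
  choose s hs using hs
  obtain ⟨T, hT, hT'⟩ := hc.exists_maximalTree hr.connected s fun B hB => (hs B hB).1
  obtain ⟨t, ht, htb, htp⟩ := hT.exists_potential
  have hCT : C \ T = {e} := by rw [hT' C hC, (hs C hC).2 rfl]
  have heT : e ∉ T := by
    have : e ∈ C \ T := by rw [hCT]; rfl
    exact this.2
  have heT' : e' ∈ T := by
    by_contra h
    have : e' ∈ C \ T := ⟨he', h⟩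
    rw [hCT] at this
    exact hne this
  have hcut : ¬ Γ.Conn (T \ {e'}) (Γ.src e') (Γ.tgt e') := fun h => by
    obtain ⟨B, hB, -, hBT⟩ := exists_isReducedCycle (fun h => h.2 rfl) h
    rw [Set.insert_sdiff_singleton, Set.insert_eq_of_mem heT'] at hBT
    exact hT.1 B hBT hB
  -- the end `v` of `e'` that is separated from the basepoint in the tree
  obtain ⟨v, v', hv, hv', hvv'⟩ : ∃ v v', ¬ Γ.Conn (T \ {e'}) Γ.base v ∧
      Γ.Conn (T \ {e'}) Γ.base v' ∧
      ((Γ.src e' = v ∧ Γ.tgt e' = v') ∨ (Γ.src e' = v' ∧ Γ.tgt e' = v)) := by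
    by_cases h : Γ.Conn (T \ {e'}) Γ.base (Γ.src e')
    · exact ⟨_, _, fun h' => hcut (h.symm.trans h'), h, Or.inr ⟨rfl, rfl⟩⟩
    · refine ⟨_, _, h, ?_, Or.inl ⟨rfl, rfl⟩⟩
      rcases (hT.2 Γ.base (Γ.tgt e')).remove_edge e' with h1 | h1 | h1
      · exact h1
      · exact absurd h1 h
      · exact h1
  have hvb : v ≠ Γ.base := fun h => hv (h ▸ .refl _)
  have hvC : Γ.On C v := ⟨e', he', hvv'.imp And.left And.right⟩
  obtain ⟨D, hD, hDC, hvD⟩ := hc.exists_ne_cycle hC hvC (hr.other_valence v hvb)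
  obtain ⟨d, hd, hdT, hDT⟩ := hc.diff_maximalTree hT hD
  have hdis := Set.disjoint_left.1 (hc.disjoint hC hD hDC.symm)
  have hde : d ≠ e := fun h => hdis he (h ▸ hd)
  have hde' : d ≠ e' := fun h => hdT (h ▸ heT')
  have hconn : ∀ {u}, Γ.On D u → Γ.Conn (T \ {e'}) v u := fun hu =>
    (hD.conn_diff_on hvD hu hd).mono fun f hf => by
      refine ⟨?_, fun h => hdis he' (h ▸ hf.1)⟩
      by_contra hfT
      have : f ∈ D \ T := ⟨hf.1, hfT⟩
      rw [hDT] at this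
      exact hf.2 this
  refine ⟨_, pathIn_compl_of_potential htp hde heT, fun hg => ?_⟩
  -- With `e'` sent to a 3-cycle, `d` to the transposition of 0 and 1, and all other edges to 1,
  -- words without `e'` fix 2. The loop is sent to the conjugate of the transposition by the 3-cycle
  -- or its inverse, which moves 2.
  let a : Equiv.Perm (Fin 3) := finRotate 3
  let b : Equiv.Perm (Fin 3) := Equiv.swap 0 1
  let φ : FreeGroup Γ.E →* Equiv.Perm (Fin 3) :=
    FreeGroup.lift fun f => if f = e' then a else if f = d then b else 1
  have hφ : ∀ f, f ≠ e' → f ≠ d → φ (FreeGroup.of f) = 1 := fun f hf hf' => by simp [φ, hf, hf']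
  have hφd : φ (FreeGroup.of d) = b := by simp [φ, hde']
  have hφe : φ (FreeGroup.of e') = a := by simp [φ]
  have hφt : ∀ {u w}, Γ.Conn (T \ {e'}) u w → φ (t u) = φ (t w) := fun h =>
    h.map_eq (fun u => φ (t u)) fun f hf => by
      have h1 := ht f hf.1
      have h2 := hφ f hf.2 fun h => hdT (h ▸ hf.1)
      rw [h1, map_mul, map_inv] at h2
      exact (inv_mul_eq_one.1 h2)
  have hv1 : φ (t v') = 1 := by rw [← hφt hv', htb, map_one]
  have hz : φ (t v) = a ∨ φ (t v) = a⁻¹ := by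
    have h1 := congrArg φ (ht e' heT')
    rw [hφe, map_mul, map_inv] at h1
    rcases hvv' with ⟨h2, h3⟩ | ⟨h2, h3⟩
    · rw [h2, h3, hv1, mul_one] at h1
      exact Or.inr (by rw [h1, inv_inv])
    · rw [h2, h3, hv1, inv_one, one_mul] at h1
      exact Or.inl h1.symm
  have hmem := hg.hom_mem (φ := φ) (H := MulAction.stabilizer (Equiv.Perm (Fin 3)) (2 : Fin 3))
    fun f hf => by
      by_cases hfd : f = d
      · rw [hfd, hφd, MulAction.mem_stabilizer_iff]
        decide
      · rw [hφ f hf hfd]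
        exact one_mem _
  rw [map_mul, map_mul, map_inv, ← hφt (hconn ⟨d, hd, Or.inl rfl⟩),
    ← hφt (hconn ⟨d, hd, Or.inr rfl⟩), hφd, MulAction.mem_stabilizer_iff] at hmem
  rcases hz with hz | hz <;> rw [hz] at hmem <;> exact absurd hmem (by decide)

/-- An edge of a reduced cactus graph is determined by the loops that avoid it. -/
theorem eq_of_forall_pathIn_compl (hr : Γ.IsReduced) (hc : Γ.IsCactus) {e e' : Γ.E}
    (h : ∀ g, Γ.PathIn {e}ᶜ Γ.base Γ.base g → Γ.PathIn {e'}ᶜ Γ.base Γ.base g) : e' = e := by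
  by_contra hne
  obtain ⟨C, hC, he⟩ := hc.exists_cycle e
  obtain ⟨D, hD, he'⟩ := hc.exists_cycle e'
  by_cases hCD : C = D
  · subst hCD
    obtain ⟨g, hg, hg'⟩ := exists_pathIn_compl_of_mem_cycle hr hc hC he he' hne
    exact hg' (h g hg)
  · obtain ⟨g, hg, hg'⟩ := exists_pathIn_compl_of_ne_cycle hr hc hC hD hCD he he'
    exact hg' (h g hg)

end Rigid

end PointedGraph

namespace MarkedGraph

variable {n : ℕ} {m : MarkedGraph n}

/-- Different forests have different collapses. -/
theorem cls_injOn (hc : m.graph.IsCactus) {F F' : Set m.graph.E} (hF : m.graph.IsForest F)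
    (hF' : m.graph.IsForest F') (h : m.cls F = m.cls F') : F = F' := by
  rw [cls_eq_vtx_push hc (CMap.ofCollapse _ F) hF,
    cls_eq_vtx_push hc (CMap.ofCollapse _ F') hF'] at h
  obtain ⟨α, hα⟩ := exists_iso_of_vtx_eq h
  let κ := (CMap.ofCollapse m.graph F).comp (CMap.ofIso α)
  let κ' := CMap.ofCollapse m.graph F'
  have h0 : F ∪ (CMap.ofCollapse m.graph F).inv '' ∅ = F := by simp
  have hhom : ∀ g, m.graph.PathClass m.graph.base m.graph.base g → κ.hom g = κ'.hom g := by
    intro g hg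
    obtain ⟨x, rfl⟩ := m.exists_marking hg
    rw [CMap.comp_hom, CMap.ofIso_hom]
    exact DFunLike.congr_fun hα x
  have hinv : κ.inv = κ'.inv := by
    funext a
    exact (eq_of_forall_pathIn_compl m.reduced hc fun g hg =>
      κ.pathIn_of_hom_eq κ' hF' hhom a hg).symm
  have h1 := κ.range
  rw [hinv, κ'.range, compl_inj_iff, h0] at h1
  exact h1.symm

end MarkedGraph

end CactusSpace

namespace CactusSpace

open PointedGraph MeasureTheory

/-! ### Sublevel sets of length functions -/

section Levels

variable {X : Type} (l : X → ℝ)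

/-- The elements of length less than `s`. -/
def lev (s : ℝ) : Set X := {e | l e < s}

theorem lev_mono {s s' : ℝ} (h : s ≤ s') : lev l s ⊆ lev l s' := fun _ he => lt_of_lt_of_le he h

/-- The length of the set of all `s` for which `F` is the set of elements of length less than
`s`. -/
def levWeight (F : Set X) : ℝ := volume.real {s | s ∈ Set.Ioc (0 : ℝ) 1 ∧ lev l s = F}

theorem levWeight_nonneg (F : Set X) : 0 ≤ levWeight l F := measureReal_nonneg

theorem exists_lev_of_levWeight_ne_zero {F : Set X} (h : levWeight l F ≠ 0) :
    ∃ s ∈ Set.Ioc (0 : ℝ) 1, lev l s = F := by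
  by_contra! hn
  refine h ?_
  rw [levWeight, show {s | s ∈ Set.Ioc (0 : ℝ) 1 ∧ lev l s = F} = ∅ by
    ext s; simpa using hn s, measureReal_empty]

open Classical in
/-- The supremum of `0` and the lengths of the elements of `F`. -/
def levLo [Fintype X] (F : Set X) : ℝ :=
  (Finset.univ : Finset (Option X)).sup' ⟨none, Finset.mem_univ _⟩
    fun o => o.elim 0 fun e => if e ∈ F then l e else 0

open Classical in
/-- The infimum of `1` and the lengths of the elements outside `F`. -/
def levHi [Fintype X] (F : Set X) : ℝ :=
  (Finset.univ : Finset (Option X)).inf' ⟨none, Finset.mem_univ _⟩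
    fun o => o.elim 1 fun e => if e ∈ F then 1 else l e

theorem levLo_lt_iff [Fintype X] (F : Set X) (s : ℝ) :
    levLo l F < s ↔ 0 < s ∧ ∀ e ∈ F, l e < s := by
  classical
  refine (Finset.sup'_lt_iff _).trans ⟨fun h => ⟨h none (Finset.mem_univ _), fun e he => ?_⟩, ?_⟩
  · simpa [he] using h (some e) (Finset.mem_univ _)
  · rintro ⟨h0, h⟩ (- | e) -
    · exact h0
    · change (if e ∈ F then l e else 0) < s
      split_ifs with he
      · exact h e he
      · exact h0

theorem le_levHi_iff [Fintype X] (F : Set X) (s : ℝ) :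
    s ≤ levHi l F ↔ s ≤ 1 ∧ ∀ e ∉ F, s ≤ l e := by
  classical
  refine (Finset.le_inf'_iff _ _).trans ⟨fun h => ⟨h none (Finset.mem_univ _), fun e he => ?_⟩, ?_⟩
  · simpa [he] using h (some e) (Finset.mem_univ _)
  · rintro ⟨h0, h⟩ (- | e) -
    · exact h0
    · change s ≤ if e ∈ F then 1 else l e
      split_ifs with he
      · exact h0
      · exact h e he

/-- The levels that cut out `F` lie above all lengths in `F` and not above any length outside. The
interval may be empty, whence the maximum with 0 in `levWeight_eq`; the explicit ends give
continuity in `l`. -/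
theorem setOf_lev_eq [Fintype X] (F : Set X) :
    {s | s ∈ Set.Ioc (0 : ℝ) 1 ∧ lev l s = F} = Set.Ioc (levLo l F) (levHi l F) := by
  ext s
  rw [Set.mem_Ioc, levLo_lt_iff, le_levHi_iff]
  constructor
  · rintro ⟨⟨h0, h1⟩, rfl⟩
    exact ⟨⟨h0, fun e he => he⟩, h1, fun e he => not_lt.1 he⟩
  · rintro ⟨⟨h0, h0'⟩, h1, h1'⟩
    refine ⟨⟨h0, h1⟩, ?_⟩
    ext e
    by_cases he : e ∈ F
    · exact ⟨fun _ => he, fun _ => h0' e he⟩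
    · exact ⟨fun h => absurd h (not_lt.2 (h1' e he)), fun h => absurd h he⟩

theorem levWeight_eq [Fintype X] (F : Set X) :
    levWeight l F = max (levHi l F - levLo l F) 0 := by
  rw [levWeight, setOf_lev_eq, Real.volume_real_Ioc]

theorem continuous_levWeight [Finite X] (F : Set X) :
    Continuous fun l : X → ℝ => levWeight l F := by
  classical
  have := Fintype.ofFinite X
  simp only [levWeight_eq]
  refine (Continuous.sub ?_ ?_).max continuous_const
  · refine Continuous.finset_inf'_apply _ fun o _ => ?_
    rcases o with - | e
    · exact continuous_const
    · simp only [Option.elim_some]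
      split_ifs
      · exact continuous_const
      · exact continuous_apply e
  · refine Continuous.finset_sup'_apply _ fun o _ => ?_
    rcases o with - | e
    · exact continuous_const
    · simp only [Option.elim_some]
      split_ifs
      · exact continuous_apply e
      · exact continuous_const

/-- The barycentric coordinates of a length function with respect to its sublevel sets. -/
def bary [Finite X] : Set X →₀ ℝ := Finsupp.equivFunOnFinite.symm (levWeight l)

variable [Finite X]

theorem bary_apply (F : Set X) : bary l F = levWeight l F := rfl

/-- The sublevel sets partition (0,1] into finitely many intervals, so sums of barycentric
coordinates are measures of sets of levels. -/
theorem bary_sum_ite (Q : Set X → Prop) [DecidablePred Q] :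
    ((bary l).sum fun F t => if Q F then t else 0) =
      volume.real {s | s ∈ Set.Ioc (0 : ℝ) 1 ∧ Q (lev l s)} := by
  have := Fintype.ofFinite X
  rw [Finsupp.sum_fintype _ _ (fun F => by simp), ← Finset.sum_filter]
  have h1 : {s | s ∈ Set.Ioc (0 : ℝ) 1 ∧ Q (lev l s)} =
      ⋃ F ∈ Finset.univ.filter Q, {s | s ∈ Set.Ioc (0 : ℝ) 1 ∧ lev l s = F} := by
    ext s
    simp only [Set.mem_ofPred_eq, Finset.mem_filter, Finset.mem_univ, true_and, Set.mem_iUnion,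
      exists_prop]
    constructor
    · rintro ⟨hs, hQ⟩
      exact ⟨_, hQ, hs, rfl⟩
    · rintro ⟨F, hQ, hs, rfl⟩
      exact ⟨hs, hQ⟩
  rw [h1, measureReal_biUnion_finset (fun F _ G _ hFG => Set.disjoint_left.2 fun s hs hs' =>
    hFG (hs.2.symm.trans hs'.2)) (fun F _ => by rw [setOf_lev_eq]; exact measurableSet_Ioc)
    (fun F _ => by rw [setOf_lev_eq]; exact measure_Ioc_lt_top.ne)]
  rfl

theorem bary_sum : ((bary l).sum fun _ t => t) = 1 := by
  have := bary_sum_ite l fun _ => True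
  simp only [if_true, and_true] at this
  rw [this, show {s | s ∈ Set.Ioc (0 : ℝ) 1} = Set.Ioc 0 1 from rfl,
    Real.volume_real_Ioc_of_le zero_le_one, sub_zero]

open Classical in
/-- A length function is determined by its barycentric coordinates. -/
theorem bary_sum_notMem {l : X → ℝ} {e : X} (h0 : 0 ≤ l e) (h1 : l e ≤ 1) :
    ((bary l).sum fun F t => if e ∉ F then t else 0) = l e := by
  refine (bary_sum_ite l fun F => e ∉ F).trans ?_
  have : {s | s ∈ Set.Ioc (0 : ℝ) 1 ∧ e ∉ lev l s} = Set.Ioc 0 (l e) := by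
    ext s
    simp only [lev, Set.mem_ofPred_eq, not_lt, Set.mem_Ioc]
    exact ⟨fun h => ⟨h.1.1, h.2⟩, fun h => ⟨⟨h.1, h.2.trans h1⟩, h.2⟩⟩
  rw [this, Real.volume_real_Ioc_of_le h0, sub_zero]

open Classical in
theorem mapDomain_bary_apply {P : Type*} (v : Set X → P) (u : P) :
    Finsupp.mapDomain v (bary l) u =
      volume.real {s | s ∈ Set.Ioc (0 : ℝ) 1 ∧ v (lev l s) = u} := by
  rw [← bary_sum_ite l fun F => v F = u, Finsupp.mapDomain, Finsupp.sum, Finsupp.finsetSum_apply,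
    Finsupp.sum]
  refine Finset.sum_congr rfl fun F _ => ?_
  rw [Finsupp.single_apply]

/-- Points of realizations can thus be compared level by level, without matching up chains and
weights. -/
theorem mapDomain_bary_congr {Y : Type} [Finite Y] {l : X → ℝ} {l' : Y → ℝ} {P : Type*}
    {v : Set X → P} {v' : Set Y → P}
    (h : ∀ s ∈ Set.Ioc (0 : ℝ) 1, v (lev l s) = v' (lev l' s)) :
    Finsupp.mapDomain v (bary l) = Finsupp.mapDomain v' (bary l') := by
  ext u
  rw [mapDomain_bary_apply, mapDomain_bary_apply]
  congr 1
  ext s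
  exact and_congr_right fun hs => by rw [h s hs]

theorem exists_lev_of_mem_support {F : Set X} (h : F ∈ (bary l).support) :
    ∃ s ∈ Set.Ioc (0 : ℝ) 1, lev l s = F :=
  exists_lev_of_levWeight_ne_zero l (Finsupp.mem_support_iff.1 h)

theorem exists_lev_of_mem_support_mapDomain {P : Type*} {v : Set X → P} {u : P}
    (h : u ∈ (Finsupp.mapDomain v (bary l)).support) :
    ∃ s ∈ Set.Ioc (0 : ℝ) 1, v (lev l s) = u := by
  classical
  obtain ⟨F, hF, rfl⟩ := Finset.mem_image.1 (Finsupp.mapDomain_support h)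
  obtain ⟨s, hs, rfl⟩ := exists_lev_of_mem_support l hF
  exact ⟨s, hs, rfl⟩

open Classical in
/-- Every chain of sets with barycentric coordinates comes from a length function. -/
theorem bary_of_chain {ι : Type*} (s : Finset ι) (F : ι → Set X) (t : ι → ℝ)
    (hF : ∀ i ∈ s, ∀ j ∈ s, F i ⊆ F j ∨ F j ⊆ F i) (ht : ∀ i ∈ s, 0 ≤ t i)
    (ht1 : ∑ i ∈ s, t i = 1) :
    bary (fun e => ∑ i ∈ s, if e ∉ F i then t i else 0) =
      ∑ i ∈ s, Finsupp.single (F i) (t i) := by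
  have := Fintype.ofFinite X
  set l : X → ℝ := fun e => ∑ i ∈ s, if e ∉ F i then t i else 0 with hl
  have happ : ∀ G, (∑ i ∈ s, Finsupp.single (F i) (t i)) G =
      ∑ i ∈ s, if F i = G then t i else 0 := by
    intro G
    rw [Finsupp.finsetSum_apply]
    exact Finset.sum_congr rfl fun i _ => Finsupp.single_apply
  -- An inequality in each coordinate is enough because both sides have total 1.
  have hle : ∀ G, (∑ i ∈ s, Finsupp.single (F i) (t i)) G ≤ bary l G := by
    intro G
    rw [happ]
    by_cases hG : ∃ j ∈ s, F j = G
    · obtain ⟨j, hj, rfl⟩ := hG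
      -- The interval from `B` to `A` consists of levels of `F j`: elements of `F j` are missed only
      -- by strictly smaller members of the chain, so their length is at most `B`, and elements
      -- outside are missed by all members contained in `F j`, so their length is at least `A`.
      set A := ∑ i ∈ s, if F i ⊆ F j then t i else 0
      set B := ∑ i ∈ s, if F i ⊂ F j then t i else 0
      have hAB : (∑ i ∈ s, if F i = F j then t i else 0) = A - B := by
        rw [← Finset.sum_sub_distrib]
        refine Finset.sum_congr rfl fun i _ => ?_
        by_cases h1 : F i = F j
        · rw [if_pos h1, h1, if_pos subset_rfl, if_neg (ssubset_irrefl _), sub_zero]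
        · by_cases h2 : F i ⊆ F j
          · rw [if_neg h1, if_pos h2, if_pos (h2.ssubset_of_ne h1), sub_self]
          · rw [if_neg h1, if_neg h2, if_neg fun h => h2 h.subset, sub_self]
      have hB0 : 0 ≤ B := Finset.sum_nonneg fun i hi => by
        split_ifs
        · exact ht i hi
        · exact le_rfl
      have hA1 : A ≤ 1 := by
        rw [← ht1]
        refine Finset.sum_le_sum fun i hi => ?_
        split_ifs
        · exact le_rfl
        · exact ht i hi
      have hA : A ≤ levHi l (F j) := by
        refine (le_levHi_iff l _ _).2 ⟨hA1, fun e he => Finset.sum_le_sum fun i hi => ?_⟩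
        by_cases h1 : F i ⊆ F j
        · rw [if_pos h1, if_pos fun h => he (h1 h)]
        · rw [if_neg h1]
          split_ifs
          exacts [le_rfl, ht i hi]
      have hB : levLo l (F j) ≤ B := by
        refine le_of_forall_gt fun r hr => (levLo_lt_iff l _ _).2 ⟨hB0.trans_lt hr, fun e he => ?_⟩
        refine lt_of_le_of_lt (Finset.sum_le_sum fun i hi => ?_) hr
        by_cases h1 : e ∉ F i
        · have h2 : F i ⊂ F j := by
            rcases hF i hi j hj with h | h
            · exact h.ssubset_of_ne fun h' => h1 (h' ▸ he)
            · exact absurd (h he) h1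
          rw [if_pos h1, if_pos h2]
        · rw [if_neg h1]
          split_ifs
          exacts [ht i hi, le_rfl]
      rw [hAB, bary_apply, levWeight_eq]
      exact (sub_le_sub hA hB).trans (le_max_left _ _)
    · rw [Finset.sum_eq_zero fun i hi => if_neg fun h => hG ⟨i, hi, h⟩]
      exact levWeight_nonneg l G
  have hsum : ∑ G, (∑ i ∈ s, Finsupp.single (F i) (t i)) G = ∑ G, bary l G := by
    have h1 := bary_sum l
    rw [Finsupp.sum_fintype _ _ fun _ => rfl] at h1
    rw [h1, ← ht1]
    simp only [happ]
    rw [Finset.sum_comm]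
    refine Finset.sum_congr rfl fun i _ => ?_
    rw [Finset.sum_ite_eq, if_pos (Finset.mem_univ _)]
  ext G
  exact ((Finset.sum_eq_sum_iff_of_le fun G _ => hle G).1 hsum G (Finset.mem_univ _)).symm

end Levels

end CactusSpace

namespace CactusSpace

open PointedGraph MeasureTheory

/-! ### Metric graphs -/

/-- Length functions on the edges of a graph with values in the unit interval such that the edges
of length less than one form a forest. -/
abbrev Met (Γ : PointedGraph) : Type :=
  {l : Γ.E → ℝ // (∀ e, 0 ≤ l e ∧ l e ≤ 1) ∧ Γ.IsForest {e | l e < 1}}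

theorem Met.isForest_lev {Γ : PointedGraph} (l : Met Γ) {s : ℝ} (hs : s ≤ 1) :
    Γ.IsForest (lev l.1 s) :=
  l.2.2.mono fun _ he => lt_of_lt_of_le he hs

theorem Met.isForest_of_eq_zero {Γ : PointedGraph} (l : Met Γ) {F : Set Γ.E}
    (hF : ∀ e ∈ F, l.1 e = 0) : Γ.IsForest F :=
  l.2.2.mono fun e he => by
    change l.1 e < 1
    rw [hF e he]
    exact zero_lt_one

theorem Met.isForest_of_mem_support {Γ : PointedGraph} (l : Met Γ) {F : Set Γ.E}
    (hF : F ∈ (bary l.1).support) : Γ.IsForest F := by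
  obtain ⟨s, hs, rfl⟩ := exists_lev_of_mem_support _ hF
  exact l.isForest_lev hs.2

/-- The length function on the target of a collapse map. -/
def Met.restrict {Γ Δ : PointedGraph} {F : Set Γ.E} (l : Met Γ) (κ : CMap Γ Δ F)
    (hc : Γ.IsCactus) (hF : ∀ e ∈ F, l.1 e = 0) : Met Δ :=
  ⟨fun a => l.1 (κ.inv a), fun a => l.2.1 _, fun D hD hDC => by
    obtain ⟨C, hC, rfl⟩ := κ.exists_preimage_eq hc (l.isForest_of_eq_zero hF) hDC
    refine l.2.2 C (fun e he => ?_) hC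
    by_cases heF : e ∈ F
    · change l.1 e < 1
      rw [hF e heF]
      exact zero_lt_one
    · obtain ⟨a, rfl⟩ := κ.exists_inv heF
      exact hD he⟩

namespace MarkedGraph

variable {n c : ℕ}

/-- A symmetrically marked cactus graph of coweight at most `c`. -/
structure IsSym (m : MarkedGraph n) (c : ℕ) : Prop where
  cac : m.graph.IsCactus
  sym : m.IsSymmetric
  far : m.graph.farCycles.ncard ≤ c

theorem IsSym.isCac {m : MarkedGraph n} (h : m.IsSym c) : m.graph.IsCac n c :=
  ⟨m.reduced, h.cac, m.ncard_cycles h.cac, h.far⟩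

theorem IsSym.isCactusVertex {m : MarkedGraph n} (h : m.IsSym c) : m.vtx.IsCactusVertex c :=
  ⟨m, rfl, h.cac, h.sym, (m.coweight_le_iff h.cac c).2 h.far⟩

theorem IsSym.push {m : MarkedGraph n} (h : m.IsSym c) {Δ : PointedGraph} {F : Set m.graph.E}
    (κ : CMap m.graph Δ F) (hF : m.graph.IsForest F) : (m.push h.cac κ hF).IsSym c :=
  ⟨κ.isCactus h.cac hF, push_isSymmetric h.cac κ hF h.sym,
    (κ.ncard_farCycles_le h.cac hF).trans h.far⟩

theorem IsSym.cls_isCactusVertex {m : MarkedGraph n} (h : m.IsSym c) {F : Set m.graph.E}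
    (hF : m.graph.IsForest F) : (m.cls F).IsCactusVertex c := by
  rw [cls_eq_vtx_push h.cac (CMap.ofCollapse _ F) hF]
  exact (h.push _ hF).isCactusVertex

theorem _root_.CactusSpace.AuterVertex.IsCactusVertex.exists_isSym {v : AuterVertex n}
    (h : v.IsCactusVertex c) : ∃ m : MarkedGraph n, m.vtx = v ∧ m.IsSym c := by
  obtain ⟨m, hm, hc, hs, hw⟩ := h
  exact ⟨m, hm, hc, hs, (m.coweight_le_iff hc c).1 hw⟩

theorem IsSym.precomp {m : MarkedGraph n} (h : m.IsSym c) {φ : MulAut (FreeGroup (Fin n))}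
    (hφ : φ ∈ SAut n) : (m.precomp φ).IsSym c := by
  refine ⟨h.cac, fun T hT i => ?_, h.far⟩
  exact FreeGroup.IsConjGen.map (φ := (collapseHom T).comp m.marking) (h.sym T hT) (hφ i)

theorem cls_precomp {m : MarkedGraph n} (φ : MulAut (FreeGroup (Fin n))) (F : Set m.graph.E) :
    (m.precomp φ).cls F = (m.cls F).act φ := by
  classical
  by_cases h : m.graph.IsCactus ∧ m.graph.IsForest F
  · rw [cls_eq_vtx_push (m := m) h.1 (CMap.ofCollapse _ F) h.2,
      cls_eq_vtx_push (m := m.precomp φ) h.1 (CMap.ofCollapse _ F) h.2]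
    rfl
  · have h1 : m.cls F = m.vtx := dif_neg h
    have h2 : (m.precomp φ).cls F = (m.precomp φ).vtx := dif_neg h
    rw [h1, h2]
    rfl

/-- The point of the complex that is given by a marked metric graph. -/
def point {m : MarkedGraph n} (h : m.IsSym c) (l : Met m.graph) : SigmaK n c :=
  ⟨Finsupp.mapDomain m.cls (bary l.1), by
    classical
    have hsum : ((Finsupp.mapDomain m.cls (bary l.1)).sum fun _ t => t) = 1 := by
      rw [Finsupp.sum_mapDomain_index (fun _ => rfl) (fun _ _ _ => rfl)]
      exact bary_sum l.1
    refine ⟨fun v => ?_, hsum, ⟨?_, ?_⟩, ?_⟩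
    · rw [mapDomain_bary_apply]
      exact measureReal_nonneg
    · rw [Finset.nonempty_iff_ne_empty, Ne, Finsupp.support_eq_empty]
      intro h0
      rw [h0, Finsupp.sum_zero_index] at hsum
      exact zero_ne_one hsum
    · intro u hu v hv _
      obtain ⟨s, hs, rfl⟩ := exists_lev_of_mem_support_mapDomain _ (Finset.mem_coe.1 hu)
      obtain ⟨s', hs', rfl⟩ := exists_lev_of_mem_support_mapDomain _ (Finset.mem_coe.1 hv)
      rcases le_total s s' with h1 | h1
      · exact Or.inl (cls_collapsesTo h.cac (l.isForest_lev hs'.2) (lev_mono _ h1))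
      · exact Or.inr (cls_collapsesTo h.cac (l.isForest_lev hs.2) (lev_mono _ h1))
    · intro v hv
      obtain ⟨s, hs, rfl⟩ := exists_lev_of_mem_support_mapDomain _ hv
      exact h.cls_isCactusVertex (l.isForest_lev hs.2)⟩

/-- A marked metric graph and its image under the collapse of edges of length zero define the same
orbit. -/
theorem mk_point_eq {m m' : MarkedGraph n} (h : m.IsSym c) (h' : m'.IsSym c) {Z : Set m.graph.E}
    (κ : CMap m.graph m'.graph Z) {l : Met m.graph} {l' : Met m'.graph}
    (hZ : ∀ e ∈ Z, l.1 e = 0) (hl : ∀ a, l.1 (κ.inv a) = l'.1 a) :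
    (Quotient.mk _ (point h l) : SigmaQ n c) = Quotient.mk _ (point h' l') := by
  have hZf := l.isForest_of_eq_zero hZ
  -- The pushed marking and that of `m'` are symmetric markings of one graph. After correcting by
  -- `φ`, the points agree at every level, since sublevel sets at positive levels contain `Z`.
  obtain ⟨φ, hφ, -, hm⟩ := exists_act_eq (m := m.push h.cac κ hZf) (m' := m')
    (h.push κ hZf).cac (h.push κ hZf).sym h'.sym (Iso.refl m'.graph)
  rw [Iso.refl_hom, MonoidHom.id_comp] at hm
  refine (Quotient.sound ⟨MulOpposite.op ⟨φ, hφ⟩, Subtype.ext ?_⟩ :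
    (Quotient.mk _ (point h' l') : SigmaQ n c) = Quotient.mk _ (point h l)).symm
  change Finsupp.mapDomain (AuterVertex.act φ) (Finsupp.mapDomain m.cls (bary l.1)) =
    Finsupp.mapDomain m'.cls (bary l'.1)
  rw [← Finsupp.mapDomain_comp]
  refine mapDomain_bary_congr fun s hs => ?_
  rw [cls_of_cmap (m := m.precomp φ) (m' := m') h.cac κ hZf hm (l'.isForest_lev hs.2),
    Function.comp_apply, ← cls_precomp]
  congr 1
  ext e
  by_cases he : e ∈ Z
  · refine ⟨fun _ => Or.inl he, fun _ => ?_⟩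
    change l.1 e < s
    rw [hZ e he]
    exact hs.1
  · obtain ⟨a, rfl⟩ := κ.exists_inv he
    change l.1 (κ.inv a) < s ↔ _
    rw [hl]
    refine ⟨fun h => Or.inr ⟨a, h, rfl⟩, fun h => ?_⟩
    rcases h with h | ⟨b, hb, hba⟩
    · exact absurd h he
    · rw [← κ.inj hba]
      exact hb

/-- In the weak topology, continuity must be checked inside closed simplices. Each piece of a finite
closed cover maps into one of them, where the coordinates are finite sums of the continuous weights.
-/
theorem continuous_point {m : MarkedGraph n} (h : m.IsSym c) : Continuous (point h) := by
  classical
  have := Fintype.ofFinite m.graph.E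
  -- the closed set of length functions whose sublevel sets belong to the chain `A`
  let I := {A : Finset (Set m.graph.E) // A.Nonempty ∧ (∀ F ∈ A, m.graph.IsForest F) ∧
    ∀ F ∈ A, ∀ G ∈ A, F ⊆ G ∨ G ⊆ F}
  let K : I → Set (Met m.graph) := fun A => {l | (bary l.1).support ⊆ A.1}
  have hfin : LocallyFinite K := locallyFinite_of_finite K
  have hcov : ⋃ A, K A = Set.univ := by
    rw [Set.eq_univ_iff_forall]
    intro l
    refine Set.mem_iUnion.2 ⟨⟨(bary l.1).support, ?_, fun F hF => l.isForest_of_mem_support hF,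
      fun F hF G hG => ?_⟩, Finset.Subset.refl _⟩
    · rw [Finset.nonempty_iff_ne_empty, Ne, Finsupp.support_eq_empty]
      intro h0
      have := bary_sum l.1
      rw [h0, Finsupp.sum_zero_index] at this
      exact zero_ne_one this
    · obtain ⟨s, -, rfl⟩ := exists_lev_of_mem_support _ hF
      obtain ⟨s', -, rfl⟩ := exists_lev_of_mem_support _ hG
      exact (le_total s s').imp (lev_mono _) (lev_mono _)
  have hcl : ∀ A, IsClosed (K A) := by
    intro A
    have : K A = ⋂ F ∈ ((A.1 : Set (Set m.graph.E))ᶜ), {l : Met m.graph | levWeight l.1 F = 0} := by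
      ext l
      simp only [K, Set.mem_ofPred_eq, Set.mem_iInter, Set.mem_compl_iff, Finset.mem_coe,
        Finset.subset_iff, Finsupp.mem_support_iff, bary_apply]
      exact forall_congr' fun F => not_imp_comm
    rw [this]
    exact isClosed_biInter fun F _ => isClosed_eq
      ((continuous_levWeight F).comp continuous_subtype_val) continuous_const
  refine hfin.continuous hcov hcl fun A => continuousOn_iff_continuous_domRestrict.2 ?_
  let s := A.1.image m.cls
  have hs : s ∈ (cactusComplex n c).faces := by
    refine ⟨⟨A.2.1.image _, ?_⟩, ?_⟩
    · rw [Finset.coe_image]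
      rintro _ ⟨F, hF, rfl⟩ _ ⟨G, hG, rfl⟩ _
      exact (A.2.2.2 F hF G hG).imp (cls_collapsesTo h.cac (A.2.2.1 G hG))
        (cls_collapsesTo h.cac (A.2.2.1 F hF))
    · intro v hv
      obtain ⟨F, hF, rfl⟩ := Finset.mem_image.1 hv
      exact h.cls_isCactusVertex (A.2.2.1 F hF)
  let S := {x : SigmaK n c // x.1.support ⊆ s}
  let tS : TopologicalSpace S :=
    TopologicalSpace.induced (fun (x : S) (v : AuterVertex n) => x.1.1 v) inferInstance
  let g : K A → S := fun l => ⟨point h l.1, fun v hv => by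
    obtain ⟨F, hF, rfl⟩ := Finset.mem_image.1 (Finsupp.mapDomain_support hv)
    exact Finset.mem_image_of_mem _ (l.2 hF)⟩
  have hg : Continuous g := by
    rw [continuous_induced_rng, continuous_pi_iff]
    intro v
    have hsum : ∀ l : K A, Finsupp.mapDomain m.cls (bary l.1.1) v =
        ∑ F, if m.cls F = v then levWeight l.1.1 F else 0 := fun l => by
      rw [mapDomain_bary_apply, ← bary_sum_ite _ fun F => m.cls F = v]
      exact Finsupp.sum_fintype _ _ fun F => ite_self _
    refine (continuous_congr hsum).2 ?_
    refine continuous_finsetSum _ fun F _ => ?_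
    split_ifs
    · exact (continuous_levWeight F).comp (continuous_subtype_val.comp continuous_subtype_val)
    · exact continuous_const
  have hval : Continuous (Subtype.val : S → SigmaK n c) := by
    rw [continuous_iff_coinduced_le]
    exact le_iSup₂_of_le s hs le_rfl
  exact hval.comp hg

end MarkedGraph

end CactusSpace

namespace CactusSpace

open PointedGraph MeasureTheory

/-! ### The orbit space as a quotient of spaces of metric graphs -/

namespace MarkedGraph

variable {n c : ℕ} {m m' : MarkedGraph n}

theorem exists_cmap_of_cls_eq (hc : m.graph.IsCactus) {F : Set m.graph.E}
    (hF : m.graph.IsForest F) (h : m.cls F = m'.vtx) :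
    ∃ κ : CMap m.graph m'.graph F, κ.hom.comp m.marking = m'.marking := by
  rw [cls_eq_vtx_push hc (CMap.ofCollapse _ F) hF] at h
  obtain ⟨α, hα⟩ := exists_iso_of_vtx_eq h
  have hset : ∀ {G : Set m.graph.E}, G = F → ∀ κ : CMap m.graph m'.graph G,
      κ.hom.comp m.marking = m'.marking →
      ∃ κ : CMap m.graph m'.graph F, κ.hom.comp m.marking = m'.marking := by
    rintro _ rfl κ h
    exact ⟨κ, h⟩
  refine hset ?_ ((CMap.ofCollapse _ F).comp (CMap.ofIso α)) ?_
  · rw [Set.image_empty, Set.union_empty]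
  · rw [CMap.comp_hom, CMap.ofIso_hom, MonoidHom.comp_assoc]
    exact hα

/-- The representative chosen for the smaller graph is irrelevant: it is a target of a collapse map
from `m`, and the next collapse is composed with this map. -/
theorem exists_cls_of_collapsesTo (hc : m.graph.IsCactus) {F : Set m.graph.E}
    (hF : m.graph.IsForest F) {w : AuterVertex n} (h : (m.cls F).CollapsesTo w) :
    ∃ G, F ⊆ G ∧ m.graph.IsForest G ∧ w = m.cls G := by
  obtain ⟨m₁, m₂, h1, rfl, h2⟩ := h
  obtain ⟨κ, hκ⟩ := exists_cmap_of_cls_eq (m' := m₁) hc hF h1.symm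
  obtain ⟨G, hG, μ, hμ⟩ := collapsesTo_iff.1 h2
  have hc₁ := κ.isCactus hc hF
  refine ⟨F ∪ κ.inv '' G, Set.subset_union_left, κ.isForest_union hc hF hG, ?_⟩
  exact (cls_eq_vtx hc₁ μ hG hμ).symm.trans (cls_of_cmap hc κ hF hκ hG)

/-- The number of vertices of the underlying graph. -/
def _root_.CactusSpace.AuterVertex.numVertices : AuterVertex n → ℕ :=
  Quotient.lift (fun m => Nat.card m.graph.V) fun _ _ ⟨α, _⟩ => Nat.card_congr α.vert

theorem numVertices_vtx : m.vtx.numVertices = Nat.card m.graph.V := rfl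

theorem numVertices_cls_lt (hc : m.graph.IsCactus) {F : Set m.graph.E} (hF : m.graph.IsForest F)
    (hne : F.Nonempty) : (m.cls F).numVertices < Nat.card m.graph.V := by
  rw [cls_eq_vtx_push hc (CMap.ofCollapse _ F) hF, numVertices_vtx]
  exact (CMap.ofCollapse _ F).card_lt hF hne

theorem numVertices_cls_le (hc : m.graph.IsCactus) {F : Set m.graph.E} (hF : m.graph.IsForest F) :
    (m.cls F).numVertices ≤ Nat.card m.graph.V := by
  rcases F.eq_empty_or_nonempty with rfl | hne
  · rw [cls_empty hc, numVertices_vtx]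
  · exact (numVertices_cls_lt hc hF hne).le

/-- The vertices of a simplex are the collapses of one graph along a chain of forests. -/
theorem exists_chain_of_mem_faces {s : Finset (AuterVertex n)} (hs : s ∈ (cactusComplex n c).faces) :
    ∃ (m : MarkedGraph n) (F : AuterVertex n → Set m.graph.E), m.IsSym c ∧
      (∀ v ∈ s, m.graph.IsForest (F v) ∧ v = m.cls (F v)) ∧
      ∀ v ∈ s, ∀ w ∈ s, F v ⊆ F w ∨ F w ⊆ F v := by
  classical
  obtain ⟨⟨hne, hch⟩, hv⟩ := hs
  -- A member with the most vertices is the top of the chain, since a nontrivial collapse towards it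
  -- would lower the number of vertices. Injectivity of `cls` then turns collapses into inclusions
  -- of forests.
  obtain ⟨u, hu, hmax⟩ := s.exists_max_image AuterVertex.numVertices hne
  obtain ⟨m, rfl, hm⟩ := (hv u hu).exists_isSym
  have hcls : ∀ v ∈ s, ∃ F, m.graph.IsForest F ∧ v = m.cls F := by
    intro v hvs
    by_cases hvu : v = m.vtx
    · exact ⟨∅, isForest_empty, hvu.trans (cls_empty hm.cac).symm⟩
    · rcases hch hvs hu hvu with h | h
      · obtain ⟨m₁, rfl, hm₁⟩ := (hv v hvs).exists_isSym
        rw [← cls_empty hm₁.cac] at h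
        obtain ⟨G, -, hG, hG'⟩ := exists_cls_of_collapsesTo hm₁.cac isForest_empty h
        rcases G.eq_empty_or_nonempty with rfl | hGn
        · rw [cls_empty hm₁.cac] at hG'
          exact absurd hG'.symm hvu
        · have h1 := numVertices_cls_lt hm₁.cac hG hGn
          rw [← hG'] at h1
          exact absurd (hmax _ hvs) (not_le.2 h1)
      · rw [← cls_empty hm.cac] at h
        obtain ⟨G, -, hG⟩ := exists_cls_of_collapsesTo hm.cac isForest_empty h
        exact ⟨G, hG⟩
  choose! F hF using hcls
  have key : ∀ v ∈ s, ∀ w ∈ s, v.CollapsesTo w → F v ⊆ F w := by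
    intro v hvs w hws h
    rw [(hF v hvs).2] at h
    obtain ⟨G, hvG, hG, hw⟩ := exists_cls_of_collapsesTo hm.cac (hF v hvs).1 h
    rw [(hF w hws).2] at hw
    rwa [cls_injOn hm.cac (hF w hws).1 hG hw]
  refine ⟨m, F, hm, hF, fun v hvs w hws => ?_⟩
  by_cases hvw : v = w
  · exact Or.inl (hvw ▸ subset_rfl)
  · exact (hch hvs hws hvw).imp (key v hvs w hws) (key w hws v hvs)

theorem IsSym.of_vtx (h : m.vtx.IsCactusVertex c) : m.IsSym c := by
  obtain ⟨m', h1, h'⟩ := h.exists_isSym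
  obtain ⟨α, hα⟩ := exists_iso_of_vtx_eq h1
  have hp := h'.push (CMap.ofIso α) isForest_empty
  refine ⟨hp.cac, fun T hT i => ?_, hp.far⟩
  rw [← hα, ← CMap.ofIso_hom]
  exact hp.sym T hT i

end MarkedGraph

variable {n c : ℕ}

/-- A symmetric marking of a cactus graph. -/
abbrev PointedGraph.IsCac.marked {Γ : PointedGraph} (h : Γ.IsCac n c) : MarkedGraph n where
  graph := Γ
  reduced := h.red
  marking := h.exists_marking.choose
  marking_injective := h.exists_marking.choose_spec.1
  marking_range := h.exists_marking.choose_spec.2.1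

theorem PointedGraph.IsCac.marked_isSym {Γ : PointedGraph} (h : Γ.IsCac n c) : h.marked.IsSym c :=
  ⟨h.cac, h.exists_marking.choose_spec.2.2, h.far⟩

/-- The orbit of a metric cactus graph. -/
def tau {Γ : PointedGraph} (h : Γ.IsCac n c) (l : Met Γ) : SigmaQ n c :=
  Quotient.mk _ (MarkedGraph.point h.marked_isSym l)

section tau

variable {Γ Δ : PointedGraph}

theorem mk_point_eq_tau {m : MarkedGraph n} (h : m.IsSym c) (l : Met m.graph) :
    (Quotient.mk _ (MarkedGraph.point h l) : SigmaQ n c) = tau h.isCac l :=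
  MarkedGraph.mk_point_eq h h.isCac.marked_isSym (CMap.ofIso (Iso.refl m.graph))
    (fun _ he => he.elim) fun _ => rfl

theorem tau_eq (h : Γ.IsCac n c) (h' : Δ.IsCac n c) {Z : Set Γ.E} (κ : CMap Γ Δ Z) {l : Met Γ}
    {l' : Met Δ} (hZ : ∀ e ∈ Z, l.1 e = 0) (hl : ∀ a, l.1 (κ.inv a) = l'.1 a) :
    tau h l = tau h' l' :=
  MarkedGraph.mk_point_eq h.marked_isSym h'.marked_isSym κ hZ hl

theorem tau_eq_of_iso (h : Γ.IsCac n c) (h' : Δ.IsCac n c) (α : Iso Γ Δ) {l : Met Γ}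
    {l' : Met Δ} (hl : ∀ e, l'.1 (α.edge e) = l.1 e) : tau h l = tau h' l' :=
  tau_eq h h' (CMap.ofIso α) (fun _ he => he.elim) fun a => by
    refine (hl (α.edge.symm a)).symm.trans ?_
    rw [Equiv.apply_symm_apply]

theorem tau_restrict (h : Γ.IsCac n c) {Z : Set Γ.E} (κ : CMap Γ Δ Z) {l : Met Γ}
    (hZ : ∀ e ∈ Z, l.1 e = 0) :
    tau h l = tau (h.map κ (l.isForest_of_eq_zero hZ)) (l.restrict κ h.cac hZ) :=
  tau_eq _ _ κ hZ fun _ => rfl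

/-- The zero set of a length function may be collapsed. -/
theorem exists_tau_eq_pos (h : Γ.IsCac n c) (l : Met Γ) :
    ∃ (Δ : PointedGraph) (h' : Δ.IsCac n c) (κ : CMap Γ Δ {e | l.1 e = 0}) (l' : Met Δ),
      (∀ e, 0 < l'.1 e) ∧ tau h l = tau h' l' ∧ ∀ e, l'.1 e = l.1 (κ.inv e) := by
  have hZ : ∀ e ∈ {e | l.1 e = 0}, l.1 e = 0 := fun _ he => he
  let κ := CMap.ofCollapse Γ {e | l.1 e = 0}
  exact ⟨_, h.map κ (l.isForest_of_eq_zero hZ), κ, l.restrict κ h.cac hZ,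
    fun e => lt_of_le_of_ne (l.2.1 _).1 fun h0 => κ.inv_notMem e h0.symm,
    tau_restrict h κ hZ, fun _ => rfl⟩

theorem continuous_tau (h : Γ.IsCac n c) : Continuous (tau h) :=
  continuous_quotient_mk'.comp (MarkedGraph.continuous_point h.marked_isSym)

/-- Metric graphs of positive edge lengths are determined by their orbits. -/
theorem exists_iso_of_tau_eq (h : Γ.IsCac n c) (h' : Δ.IsCac n c) {l : Met Γ} {l' : Met Δ}
    (hl : ∀ e, 0 < l.1 e) (hl' : ∀ e, 0 < l'.1 e) (heq : tau h l = tau h' l') :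
    ∃ α : Iso Γ Δ, ∀ e, l'.1 (α.edge e) = l.1 e := by
  classical
  obtain ⟨φ, hφ⟩ := Quotient.exact heq
  have hφ1 := congrArg Subtype.val hφ
  obtain ⟨m', hm', hgr, h1⟩ : ∃ (m' : MarkedGraph n) (_ : m'.IsSym c) (hgr : m'.graph = Δ),
      Finsupp.mapDomain m'.cls (bary fun e => l'.1 (hgr ▸ e)) =
        Finsupp.mapDomain h.marked.cls (bary l.1) := by
    refine ⟨h'.marked.precomp φ.unop.1, h'.marked_isSym.precomp φ.unop.2, rfl, ?_⟩
    refine Eq.trans ?_ hφ1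
    change _ = Finsupp.mapDomain (AuterVertex.act φ.unop.1)
      (Finsupp.mapDomain h'.marked.cls (bary l'.1))
    rw [← Finsupp.mapDomain_comp]
    exact mapDomain_bary_congr fun s hs => MarkedGraph.cls_precomp (m := h'.marked) _ _
  subst hgr
  replace h1 : Finsupp.mapDomain m'.cls (bary l'.1) = Finsupp.mapDomain h.marked.cls (bary l.1) :=
    h1
  -- All small levels have an empty sublevel set when lengths are positive, so the uncollapsed graph
  -- has positive weight.
  have htop : ∀ {m : MarkedGraph n} (hm : m.IsSym c) {l : Met m.graph}, (∀ e, 0 < l.1 e) →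
      m.vtx ∈ (Finsupp.mapDomain m.cls (bary l.1)).support := by
    intro m hm l hl
    have := Fintype.ofFinite m.graph.E
    rw [Finsupp.mem_support_iff, mapDomain_bary_apply]
    have hpos : 0 < levWeight l.1 ∅ := by
      rw [levWeight_eq]
      refine lt_max_of_lt_left (sub_pos.2 ((levLo_lt_iff _ _ _).2 ⟨?_, fun _ he => he.elim⟩))
      refine (Finset.lt_inf'_iff _).2 ?_
      rintro (- | e) -
      · exact zero_lt_one
      · simpa using hl e
    refine (hpos.trans_le (measureReal_mono ?_ ?_)).ne'
    · rintro s ⟨hs, hs'⟩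
      exact ⟨hs, by rw [hs', MarkedGraph.cls_empty hm.cac]⟩
    · exact (lt_of_le_of_lt (measure_mono (t := Set.Ioc (0 : ℝ) 1) fun s hs => hs.1)
        measure_Ioc_lt_top).ne
  have e1 := htop h.marked_isSym hl
  have e2 := htop hm' hl'
  rw [← h1] at e1
  rw [h1] at e2
  obtain ⟨s, hs, hs1⟩ := exists_lev_of_mem_support_mapDomain _ e1
  obtain ⟨s', hs', hs1'⟩ := exists_lev_of_mem_support_mapDomain _ e2
  -- Each of the two uncollapsed graphs is a collapse of the other, so by their numbers of vertices
  -- nothing is collapsed.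
  have hv : h.marked.vtx = m'.vtx := by
    rcases (lev l'.1 s).eq_empty_or_nonempty with h0 | hne
    · rw [← hs1, h0, MarkedGraph.cls_empty hm'.cac]
    · have a1 := MarkedGraph.numVertices_cls_lt hm'.cac (l'.isForest_lev hs.2) hne
      have a2 := MarkedGraph.numVertices_cls_le (m := h.marked) h.cac (l.isForest_lev hs'.2)
      rw [hs1, MarkedGraph.numVertices_vtx] at a1
      rw [hs1', MarkedGraph.numVertices_vtx] at a2
      omega
  obtain ⟨α, hα⟩ := MarkedGraph.exists_iso_of_vtx_eq hv
  refine ⟨α, ?_⟩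
  have hmap : Finsupp.mapDomain m'.cls (bary l'.1) =
      Finsupp.mapDomain h.marked.cls (bary fun e => l'.1 (α.edge e)) := by
    refine mapDomain_bary_congr fun s hs => ?_
    rw [MarkedGraph.cls_of_cmap (m := h.marked) h.cac (CMap.ofIso α) isForest_empty
      (by rw [CMap.ofIso_hom]; exact hα) (l'.isForest_lev hs.2), Set.empty_union]
    congr 1
    ext e
    refine ⟨?_, fun he => ⟨α.edge e, he, α.edge.symm_apply_apply e⟩⟩
    rintro ⟨a, ha, rfl⟩
    change l'.1 (α.edge (α.edge.symm a)) < s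
    rw [Equiv.apply_symm_apply]
    exact ha
  have hfor : ∀ F ∈ (bary fun e => l'.1 (α.edge e)).support, Γ.IsForest F := by
    intro F hF
    obtain ⟨s, hs, rfl⟩ := exists_lev_of_mem_support _ hF
    refine ((CMap.ofIso α).isForest_union h.cac isForest_empty (l'.isForest_lev hs.2)).mono ?_
    exact fun e he => Or.inr ⟨α.edge e, he, α.edge.symm_apply_apply e⟩
  rw [h1] at hmap
  -- All forests involved live in `Γ`, where `cls` is injective, so the weights of forests and hence
  -- the lengths are recovered.
  have hb : bary l.1 = bary fun e => l'.1 (α.edge e) :=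
    Finsupp.mapDomain_injOn {F | Γ.IsForest F}
      (fun F hF G hG h2 => MarkedGraph.cls_injOn (m := h.marked) h.cac hF hG h2)
      (fun F hF => l.isForest_of_mem_support hF) hfor hmap
  intro e
  rw [← bary_sum_notMem (l.2.1 e).1 (l.2.1 e).2, hb]
  exact (bary_sum_notMem (l := fun e => l'.1 (α.edge e)) (l'.2.1 _).1 (l'.2.1 _).2).symm

end tau

end CactusSpace

namespace CactusSpace

open PointedGraph MeasureTheory

variable {n c : ℕ} {Γ Δ : PointedGraph}

/-- The space of metric cactus graphs. -/
abbrev MetSpace (n c : ℕ) : Type 1 := Σ Γ : {Γ : PointedGraph // Γ.IsCac n c}, Met Γ.1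

/-- The map from metric cactus graphs to the orbit space. -/
def tauMap (x : MetSpace n c) : SigmaQ n c := tau x.1.2 x.2

theorem continuous_tauMap : Continuous (tauMap (n := n) (c := c)) :=
  continuous_sigma fun Γ => continuous_tau Γ.2

/-- A section over a closed simplex: the length of an edge is the weight of the forests that miss
it. Writing it as a sum of coordinates over a fixed finite set is what makes the section continuous.
-/
theorem MarkedGraph.exists_continuous_point_eq {s : Finset (AuterVertex n)}
    (hs : s ∈ (cactusComplex n c).faces) :
    ∃ (m : MarkedGraph n) (hm : m.IsSym c)
      (g : {x : SigmaK n c // x.1.support ⊆ s} → Met m.graph),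
      (∀ x, point hm (g x) = x.1) ∧
      ∀ e, ∃ A : Finset (AuterVertex n), ∀ x, (g x).1 e = ∑ v ∈ A, x.1.1 v := by
  classical
  obtain ⟨m, F, hm, hF, hch⟩ := exists_chain_of_mem_faces hs
  have hsum : ∀ x : {x : SigmaK n c // x.1.support ⊆ s}, ∑ v ∈ s, x.1.1 v = 1 := fun x =>
    (Finset.sum_subset x.2 fun v _ hv => Finsupp.notMem_support_iff.1 hv).symm.trans x.1.2.2.1
  have hbary := fun x : {x : SigmaK n c // x.1.support ⊆ s} =>
    bary_of_chain s F (fun v => x.1.1 v) hch (fun v _ => x.1.2.1 v) (hsum x)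
  obtain ⟨u, hu, hmax⟩ := s.exists_max_image (fun v => (F v).ncard) hs.1.1
  have hle : ∀ v ∈ s, F v ⊆ F u := fun v hv => (hch v hv u hu).elim id fun h =>
    (Set.eq_of_subset_of_ncard_le h (hmax v hv)).ge
  let g : {x : SigmaK n c // x.1.support ⊆ s} → Met m.graph := fun x =>
    ⟨fun e => ∑ v ∈ s, if e ∉ F v then x.1.1 v else 0, fun e => ⟨?_, ?_⟩, ?_⟩
  · refine ⟨m, hm, g, fun x => Subtype.ext ?_, fun e => ⟨s.filter fun v => e ∉ F v, fun x => ?_⟩⟩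
    · change Finsupp.mapDomain m.cls (bary fun e => ∑ v ∈ s, if e ∉ F v then x.1.1 v else 0) = _
      rw [hbary x, Finsupp.mapDomain_finsetSum]
      simp only [Finsupp.mapDomain_single]
      rw [Finset.sum_congr rfl fun v hv => by rw [← (hF v hv).2]]
      ext v
      rw [Finsupp.finsetSum_apply]
      simp only [Finsupp.single_apply, Finset.sum_ite_eq']
      by_cases hv : v ∈ s
      · rw [if_pos hv]
      · rw [if_neg hv, Finsupp.notMem_support_iff.1 fun h => hv (x.2 h)]
    · exact (Finset.sum_filter _ _).symm
  · refine Finset.sum_nonneg fun v _ => ?_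
    split_ifs
    exacts [le_rfl, x.1.2.1 v]
  · refine (Finset.sum_le_sum fun v _ => ?_).trans_eq (hsum x)
    split_ifs
    exacts [x.1.2.1 v, le_rfl]
  · refine (hF u hu).1.mono fun e he => ?_
    by_contra heu
    refine ne_of_lt (Set.mem_ofPred_eq ▸ he) (Eq.trans ?_ (hsum x))
    exact Finset.sum_congr rfl fun v hv => if_pos fun h => heu (hle v hv h)

/-- The trace of a set on a closed simplex is the pullback, along the continuous section, of its
trace on one space of metric graphs. So closedness may be tested on metric graphs instead of
simplices. -/
theorem isQuotientMap_tauMap : Topology.IsQuotientMap (tauMap (n := n) (c := c)) := by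
  rw [Topology.isQuotientMap_iff_isClosed]
  constructor
  · intro q
    obtain ⟨x, rfl⟩ := Quotient.exists_rep q
    obtain ⟨m, hm, g, hg, -⟩ := MarkedGraph.exists_continuous_point_eq x.2.2.2
    refine ⟨⟨⟨_, hm.isCac⟩, g ⟨x, Finset.Subset.refl _⟩⟩, ?_⟩
    refine (mk_point_eq_tau hm _).symm.trans ?_
    rw [hg]
  · intro C
    refine ⟨fun hC => hC.preimage continuous_tauMap, fun hC => ?_⟩
    refine isClosed_coinduced.2 ?_
    refine isClosed_iSup_iff.2 fun s => isClosed_iSup_iff.2 fun hs => isClosed_coinduced.2 ?_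
    obtain ⟨m, hm, g, hg, hg'⟩ := MarkedGraph.exists_continuous_point_eq hs
    let S := {x : SigmaK n c // x.1.support ⊆ s}
    let tS : TopologicalSpace S :=
      TopologicalSpace.induced (fun (x : S) (v : AuterVertex n) => x.1.1 v) inferInstance
    have hcont : Continuous g := by
      refine Continuous.subtype_mk (continuous_pi fun e => ?_) _
      obtain ⟨A, hA⟩ := hg' e
      refine (continuous_congr hA).2 (continuous_finsetSum _ fun v _ => ?_)
      exact (continuous_apply v).comp continuous_induced_dom
    have h1 : IsClosed (tau hm.isCac ⁻¹' C) := isClosed_sigma_iff.1 hC ⟨_, hm.isCac⟩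
    have h2 : (Subtype.val : S → SigmaK n c) ⁻¹' (Quotient.mk _ ⁻¹' C) =
        g ⁻¹' (tau hm.isCac ⁻¹' C) := by
      ext x
      change Quotient.mk _ x.1 ∈ C ↔ tau hm.isCac (g x) ∈ C
      rw [← mk_point_eq_tau hm, hg]
    change @IsClosed S tS ((Subtype.val : S → SigmaK n c) ⁻¹' (Quotient.mk _ ⁻¹' C))
    rw [h2]
    exact h1.preimage hcont

theorem exists_tau (q : SigmaQ n c) :
    ∃ (Γ : PointedGraph) (h : Γ.IsCac n c) (l : Met Γ), tau h l = q := by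
  obtain ⟨x, rfl⟩ := isQuotientMap_tauMap.surjective q
  exact ⟨x.1.1, x.1.2, x.2, rfl⟩

theorem exists_tau_pos (q : SigmaQ n c) :
    ∃ (Γ : PointedGraph) (h : Γ.IsCac n c) (l : Met Γ), (∀ e, 0 < l.1 e) ∧ tau h l = q := by
  obtain ⟨Γ, h, l, rfl⟩ := exists_tau q
  obtain ⟨Δ, h', -, l', hl', h1, -⟩ := exists_tau_eq_pos h l
  exact ⟨Δ, h', l', hl', h1.symm⟩

/-! ### Wedging a circle on -/

/-- A collapse map extends to the wedges with a circle. -/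
def PointedGraph.CMap.wedge {F : Set Γ.E} (κ : CMap Γ Δ F) :
    CMap Γ.wedgeLoop Δ.wedgeLoop (some '' F : Set (Option Γ.E)) where
  vert := κ.vert
  inv := Option.map κ.inv
  flip := fun e => e.elim false κ.flip
  surj := κ.surj
  base := κ.base
  vert_eq_iff := fun v w => (κ.vert_eq_iff v w).trans
    ⟨conn_wedge_of fun e he => Set.mem_image_of_mem some he, conn_of_wedge (by
      rintro e ⟨a, ha, hae⟩
      exact (Option.some.inj hae) ▸ ha)⟩
  inj := Option.map_injective κ.inj
  range := by
    ext e
    rcases e with - | e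
    · refine ⟨fun _ => ?_, fun _ => ⟨none, rfl⟩⟩
      rintro ⟨a, -, ha⟩
      exact Option.some_ne_none a ha
    · constructor
      · rintro ⟨a | a, ha⟩ ⟨b, hb, hbe⟩
        · exact Option.some_ne_none e ha.symm
        · obtain rfl := Option.some.inj hbe
          exact κ.inv_notMem a ((Option.some.inj ha).symm ▸ hb)
      · intro he
        obtain ⟨a, rfl⟩ := κ.exists_inv fun h => he ⟨e, h, rfl⟩
        exact ⟨some a, rfl⟩
  src := fun e => by
    rcases e with - | e
    · exact κ.base
    · exact κ.src e
  tgt := fun e => by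
    rcases e with - | e
    · exact κ.base
    · exact κ.tgt e

theorem PointedGraph.CMap.wedge_hom_map {F : Set Γ.E} (κ : CMap Γ Δ F) (g : FreeGroup Γ.E) :
    κ.wedge.hom (FreeGroup.map some g) = FreeGroup.map some (κ.hom g) := by
  have : κ.wedge.hom.comp (FreeGroup.map (some : Γ.E → Option Γ.E)) =
      (FreeGroup.map some).comp κ.hom := by
    refine κ.hom_ext (fun e he => ?_) fun a => ?_
    · rw [MonoidHom.comp_apply, MonoidHom.comp_apply, κ.hom_of_mem he, FreeGroup.map.of, map_one]
      exact κ.wedge.hom_of_mem ⟨e, he, rfl⟩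
    · rw [MonoidHom.comp_apply, MonoidHom.comp_apply, κ.hom_inv, FreeGroup.map.of]
      refine (κ.wedge.hom_inv (some a)).trans ?_
      change (if κ.flip a then _ else _) = _
      split_ifs
      · rw [map_inv, FreeGroup.map.of]
      · rw [FreeGroup.map.of]
  exact DFunLike.congr_fun this g

theorem PointedGraph.CMap.wedge_hom_none {F : Set Γ.E} (κ : CMap Γ Δ F) :
    κ.wedge.hom (FreeGroup.of (none : Option Γ.E)) = FreeGroup.of (none : Option Δ.E) :=
  κ.wedge.hom_inv none

theorem MarkedGraph.IsSym.stab {m : MarkedGraph n} (h : m.IsSym c) : m.stab.IsSym c :=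
  IsSym.of_vtx (AuterVertex.stab_isCactusVertex h.isCactusVertex)

theorem PointedGraph.IsCac.wedge (h : Γ.IsCac n c) : Γ.wedgeLoop.IsCac (n + 1) c :=
  h.marked_isSym.stab.isCac

theorem MarkedGraph.cls_stab {m : MarkedGraph n} (hc : m.graph.IsCactus) {F : Set m.graph.E}
    (hF : m.graph.IsForest F) :
    m.stab.cls (some '' F : Set (Option m.graph.E)) = (m.cls F).stab := by
  let κ := CMap.ofCollapse m.graph F
  rw [cls_eq_vtx_push hc κ hF]
  refine cls_eq_vtx (m := m.stab) (m' := (m.push hc κ hF).stab) hc.wedge κ.wedge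
    (isForest_some hF) ?_
  apply hom_ext_succ
  · ext i
    change κ.wedge.hom (extendMarking m.marking (FreeGroup.map Fin.castSucc (FreeGroup.of i))) =
      extendMarking (κ.hom.comp m.marking) (FreeGroup.map Fin.castSucc (FreeGroup.of i))
    rw [extendMarking_map, extendMarking_map, κ.wedge_hom_map]
    rfl
  · change κ.wedge.hom (extendMarking m.marking (FreeGroup.of (Fin.last n))) =
      extendMarking (κ.hom.comp m.marking) (FreeGroup.of (Fin.last n))
    rw [extendMarking_last, extendMarking_last, κ.wedge_hom_none]

/-- The new loop has length one. -/
def Met.wedge (l : Met Γ) : Met Γ.wedgeLoop :=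
  ⟨fun e => Option.elim e 1 l.1, by
    rintro (- | e)
    · exact ⟨zero_le_one, le_rfl⟩
    · exact l.2.1 e, (isForest_some l.2.2).mono (by
    rintro (- | e) he
    · exact absurd (show (1 : ℝ) < 1 from he) (lt_irrefl 1)
    · exact ⟨e, he, rfl⟩)⟩

/-- A loop of length 1 belongs to no sublevel set at levels `s ≤ 1`, so the chain of forests is
unchanged. -/
theorem iota_tau (h : Γ.IsCac n c) (l : Met Γ) : iota n c (tau h l) = tau h.wedge l.wedge := by
  refine Eq.trans ?_ (mk_point_eq_tau (m := h.marked.stab) h.marked_isSym.stab l.wedge)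
  refine congrArg (Quotient.mk _) (Subtype.ext ?_)
  change Finsupp.mapDomain AuterVertex.stab (Finsupp.mapDomain h.marked.cls (bary l.1)) =
    Finsupp.mapDomain h.marked.stab.cls (bary l.wedge.1)
  rw [← Finsupp.mapDomain_comp]
  refine mapDomain_bary_congr fun s hs => ?_
  refine (MarkedGraph.cls_stab (m := h.marked) h.cac (l.isForest_lev hs.2)).symm.trans ?_
  congr 1
  ext e
  rcases e with - | e
  · refine ⟨?_, fun h => absurd h (not_lt.2 hs.2)⟩
    rintro ⟨a, -, ha⟩
    exact absurd ha (Option.some_ne_none a)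
  · refine ⟨?_, fun h => ⟨e, h, rfl⟩⟩
    rintro ⟨a, ha, hae⟩
    exact (Option.some.inj hae) ▸ ha

end CactusSpace

namespace CactusSpace

open PointedGraph

variable {n c : ℕ} {Γ Δ : PointedGraph}

/-! ### Loops at the basepoint -/

namespace PointedGraph

/-- The edge is a loop at the basepoint. -/
def IsBaseLoop (Γ : PointedGraph) (e : Γ.E) : Prop := Γ.src e = Γ.base ∧ Γ.tgt e = Γ.base

theorem Iso.isBaseLoop (α : Iso Γ Δ) {e : Γ.E} (he : Γ.IsBaseLoop e) :
    Δ.IsBaseLoop (α.edge e) := by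
  refine ⟨?_, ?_⟩
  · rw [α.src_edge, he.1, he.2, ite_self, α.map_base]
  · rw [α.tgt_edge, he.1, he.2, ite_self, α.map_base]

theorem cycles_wedge (Γ : PointedGraph) :
    Γ.wedgeLoop.cycles = insert ({none} : Set (Option Γ.E))
      ((fun C : Set Γ.E => (some '' C : Set (Option Γ.E))) '' Γ.cycles) := by
  ext C
  constructor
  · intro hC
    by_cases hn : (none : Option Γ.E) ∈ C
    · exact Or.inl (eq_loop_of_none_mem hC hn)
    · refine Or.inr ⟨{e | some e ∈ C}, ?_, (eq_image_of_none_notMem hn).symm⟩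
      have h1 : Γ.wedgeLoop.IsReducedCycle C := hC
      rw [eq_image_of_none_notMem hn] at h1
      exact (isReducedCycle_some_iff _).1 h1
  · rintro (rfl | ⟨C, hC, rfl⟩)
    · exact isReducedCycle_loop
    · exact (isReducedCycle_some_iff C).2 hC

theorem image_some_injective :
    Function.Injective fun C : Set Γ.E => (some '' C : Set (Option Γ.E)) :=
  Set.image_injective.2 (Option.some_injective _)

theorem ncard_cycles_wedge (Γ : PointedGraph) :
    Γ.wedgeLoop.cycles.ncard = Γ.cycles.ncard + 1 := by
  rw [cycles_wedge]
  refine (Set.ncard_insert_of_notMem ?_ (Set.toFinite _)).trans ?_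
  · rintro ⟨C, -, hC⟩
    have h1 : (none : Option Γ.E) ∈ (some '' C : Set (Option Γ.E)) := by
      rw [show (some '' C : Set (Option Γ.E)) = {none} from hC]
      rfl
    obtain ⟨a, -, ha⟩ := h1
    exact Option.some_ne_none a ha
  · rw [Set.ncard_image_of_injective _ image_some_injective]

theorem IsCactus.of_wedge (h : Γ.wedgeLoop.IsCactus) : Γ.IsCactus := by
  intro e
  obtain ⟨C, hC, heC⟩ := h.exists_cycle (some e : Option Γ.E)
  have hC' : C ∈ Γ.wedgeLoop.cycles := hC
  rw [cycles_wedge] at hC'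
  rcases hC' with rfl | ⟨C, hC', rfl⟩
  · exact absurd (show (some e : Option Γ.E) = none from heC) (Option.some_ne_none e)
  · obtain ⟨a, ha, hae⟩ := heC
    obtain rfl := Option.some.inj hae
    refine ⟨C, ⟨hC', ha⟩, fun D hD => image_some_injective ?_⟩
    exact h.eq_of_mem ((isReducedCycle_some_iff D).2 hD.1) hC (e := (some a : Option Γ.E))
      ⟨a, hD.2, rfl⟩ ⟨a, ha, rfl⟩

theorem valence_wedge (v : Γ.V) (hv : v ≠ Γ.base) :
    Γ.wedgeLoop.valence Set.univ v = Γ.valence Set.univ v := by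
  classical
  have h1 : (Set.univ : Set (Option Γ.E)) = insert none (some '' Set.univ) := by
    ext e
    cases e <;> simp
  have hn : (none : Option Γ.E) ∉ (some '' Set.univ : Set (Option Γ.E)) := by simp
  have h2 := valence_insert (Γ := Γ.wedgeLoop) hn v
  rw [← h1] at h2
  refine h2.trans ?_
  have h3 : ¬ Γ.wedgeLoop.src (none : Option Γ.E) = v := fun h => hv h.symm
  have h4 : ¬ Γ.wedgeLoop.tgt (none : Option Γ.E) = v := fun h => hv h.symm
  rw [if_neg h3, if_neg h4]
  exact valence_wedge_some Set.univ v

/-- Only the valence of the basepoint can suffer from deleting the loop. As `n ≥ 1`, an edge is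
left, by connectedness one meets the basepoint, and the cycle through it contributes 2. -/
theorem IsCac.of_wedge (hn : 1 ≤ n) (h : Γ.wedgeLoop.IsCac (n + 1) c) : Γ.IsCac n c := by
  have hcac := h.cac.of_wedge
  have hconn : ∀ v w, Γ.Conn Set.univ v w := fun v w =>
    conn_of_wedge (fun _ _ => Set.mem_univ _) (h.red.connected v w)
  have hcard : Γ.cycles.ncard = n := by
    have := Γ.ncard_cycles_wedge
    rw [h.card] at this
    omega
  refine ⟨⟨hconn, ?_, fun v hv => ?_, fun e v w => ?_⟩, hcac, hcard, ?_⟩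
  · have hne : Γ.cycles.Nonempty := by
      rw [← Set.ncard_pos (Set.toFinite _), hcard]
      exact hn
    obtain ⟨C, hC⟩ := hne
    obtain ⟨e, he⟩ := hC.nonempty
    have hex : ∃ a, Γ.src a = Γ.base ∨ Γ.tgt a = Γ.base := by
      by_contra! hno
      have h1 := Conn.mem_iff (W := {Γ.base}) (fun a _ =>
        ⟨fun h => absurd h (hno a).1, fun h => absurd h (hno a).2⟩) (hconn Γ.base (Γ.src e))
      exact (hno e).1 (h1.1 rfl)
    obtain ⟨a, ha⟩ := hex
    obtain ⟨D, hD, haD⟩ := hcac.exists_cycle a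
    rw [← hD.valence_eq haD ha]
    exact valence_mono (Set.subset_univ _) _
  · rw [← valence_wedge v hv]
    exact h.red.other_valence v hv
  · exact conn_of_wedge (S' := ({some e}ᶜ : Set (Option Γ.E)))
      (fun a ha hae => ha (congrArg some hae))
      (h.red.no_separating (some e : Option Γ.E) v w)
  · refine le_trans ?_ h.far
    rw [← Set.ncard_image_of_injective _ (image_some_injective (Γ := Γ))]
    refine Set.ncard_le_ncard ?_ (Set.toFinite _)
    rintro _ ⟨C, ⟨hC, hCb⟩, rfl⟩
    refine ⟨(isReducedCycle_some_iff C).2 hC, ?_⟩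
    rintro ⟨_, ⟨e, he, rfl⟩, hb⟩
    exact hCb ⟨e, he, hb⟩

/-- The graph without the edge `e`. -/
abbrev deleteEdge (Γ : PointedGraph) (e : Γ.E) : PointedGraph where
  V := Γ.V
  E := {a // a ≠ e}
  src := fun a => Γ.src a.1
  tgt := fun a => Γ.tgt a.1
  base := Γ.base

open Classical in
/-- A graph with a loop at the basepoint is a wedge. -/
def deleteIso {e : Γ.E} (he : Γ.IsBaseLoop e) : Iso Γ (Γ.deleteEdge e).wedgeLoop where
  vert := Equiv.refl _
  edge := (Equiv.optionSubtypeNe e).symm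
  flip := fun _ => false
  map_base := rfl
  src_edge := fun a => by
    by_cases h : a = e
    · subst h
      rw [Equiv.optionSubtypeNe_symm_self]
      exact he.1.symm
    · rw [Equiv.optionSubtypeNe_symm_of_ne h]
      rfl
  tgt_edge := fun a => by
    by_cases h : a = e
    · subst h
      rw [Equiv.optionSubtypeNe_symm_self]
      exact he.2.symm
    · rw [Equiv.optionSubtypeNe_symm_of_ne h]
      rfl

theorem IsCac.deleteEdge (hn : 1 ≤ n) (h : Γ.IsCac (n + 1) c) {e : Γ.E} (he : Γ.IsBaseLoop e) :
    (Γ.deleteEdge e).IsCac n c :=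
  .of_wedge hn (h.map (CMap.ofIso (deleteIso he)) isForest_empty)

/-- Isomorphic wedges with a circle have isomorphic factors. -/
def Iso.unwedge (α : Iso Γ.wedgeLoop Δ.wedgeLoop) : Iso Γ Δ where
  vert := α.vert
  edge := Equiv.removeNone α.edge
  flip := fun e => α.flip (some e : Option Γ.E)
  map_base := α.map_base
  src_edge := fun e => by
    have h1 := α.src_edge (some e : Option Γ.E)
    by_cases h : ∃ a, α.edge (some e : Option Γ.E) = some a
    · have h2 := Equiv.removeNone_some α.edge h
      rw [← h2] at h1
      exact h1
    · have h3 : α.edge (some e : Option Γ.E) = none := Option.eq_none_iff_forall_ne_some.2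
        fun a ha => h ⟨a, ha⟩
      -- If `e` goes to the new loop, it is rematched with the image of the other new loop. This
      -- fits because both are loops at the basepoint.
      have h2 := Equiv.removeNone_none α.edge h3
      have h4 := α.src_edge (none : Option Γ.E)
      rw [← h2] at h4
      rw [h3] at h1
      refine Eq.trans ?_ h1
      refine h4.trans ?_
      change α.vert (if _ then Γ.base else Γ.base) = Δ.base
      rw [ite_self]
      exact α.map_base
  tgt_edge := fun e => by
    have h1 := α.tgt_edge (some e : Option Γ.E)
    by_cases h : ∃ a, α.edge (some e : Option Γ.E) = some a
    · have h2 := Equiv.removeNone_some α.edge h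
      rw [← h2] at h1
      exact h1
    · have h3 : α.edge (some e : Option Γ.E) = none := Option.eq_none_iff_forall_ne_some.2
        fun a ha => h ⟨a, ha⟩
      have h2 := Equiv.removeNone_none α.edge h3
      have h4 := α.tgt_edge (none : Option Γ.E)
      rw [← h2] at h4
      rw [h3] at h1
      refine Eq.trans ?_ h1
      refine h4.trans ?_
      change α.vert (if _ then Γ.base else Γ.base) = Δ.base
      rw [ite_self]
      exact α.map_base

end PointedGraph

/-! ### Length functions on wedges and the closed embedding ι. -/

theorem Met.continuous_of {Y : Type*} [TopologicalSpace Y] {g : Y → Met Γ}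
    (h : ∀ e, Continuous fun y => (g y).1 e) : Continuous g :=
  continuous_induced_rng.2 (continuous_pi h)

theorem Met.continuous_length (e : Γ.E) : Continuous fun l : Met Γ => l.1 e :=
  (continuous_apply e).comp continuous_subtype_val

theorem Met.eq_one_of_cycle (l : Met Γ) {C : Set Γ.E} (hC : Γ.IsReducedCycle C) :
    ∃ e ∈ C, l.1 e = 1 := by
  by_contra! h
  exact l.2.2 C (fun e he => lt_of_le_of_ne (l.2.1 e).2 (h e he)) hC

/-- The restriction of a length function to the summand of a wedge. -/
def Met.unwedge (l : Met Γ.wedgeLoop) : Met Γ :=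
  ⟨fun e => l.1 (some e : Option Γ.E), fun e => l.2.1 _, fun C hC hCc =>
    l.2.2 (some '' C : Set (Option Γ.E)) (by
      rintro _ ⟨e, he, rfl⟩
      exact hC he) ((isReducedCycle_some_iff C).2 hCc)⟩

/-- The new loop is a reduced cycle by itself and hence must have length 1. -/
theorem Met.wedge_unwedge (l : Met Γ.wedgeLoop) : l.unwedge.wedge = l := by
  refine Subtype.ext (funext ?_)
  rintro (- | e)
  · obtain ⟨e, rfl, he⟩ := l.eq_one_of_cycle isReducedCycle_loop
    exact he.symm
  · rfl

theorem Met.continuous_wedge : Continuous (Met.wedge (Γ := Γ)) := by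
  refine Met.continuous_of ?_
  rintro (- | e)
  · exact continuous_const
  · exact Met.continuous_length e

theorem Met.continuous_unwedge : Continuous (Met.unwedge (Γ := Γ)) :=
  Met.continuous_of fun e => Met.continuous_length (Γ := Γ.wedgeLoop) (some e)

/-- Transport of length functions along an isomorphism. -/
def Met.congr (l : Met Γ) (hc : Γ.IsCactus) (α : Iso Γ Δ) : Met Δ :=
  l.restrict (CMap.ofIso α) hc fun _ he => he.elim

theorem Met.continuous_congr (hc : Γ.IsCactus) (α : Iso Γ Δ) :
    Continuous fun l : Met Γ => l.congr hc α :=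
  Met.continuous_of fun a => Met.continuous_length ((CMap.ofIso α).inv a)

/-- A metric graph with a loop at the basepoint is in the image of the stabilization map. -/
theorem iota_deleteEdge (hn : 1 ≤ n) (h : Γ.IsCac (n + 1) c) {e : Γ.E} (he : Γ.IsBaseLoop e)
    (l : Met Γ) :
    iota n c (tau (h.deleteEdge hn he) (l.congr h.cac (deleteIso he)).unwedge) = tau h l := by
  rw [iota_tau, Met.wedge_unwedge]
  exact (tau_eq h _ (CMap.ofIso (deleteIso he)) (fun _ he => he.elim) fun _ => rfl).symm

/-- Representatives with positive lengths have isometric wedges. An isometry that mismatches the new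
loops can be corrected, because the edges that trade places all have length 1. -/
theorem iota_injective : Function.Injective (iota n c) := by
  intro q q' hq
  obtain ⟨Γ, h, l, hl, rfl⟩ := exists_tau_pos q
  obtain ⟨Δ, h', l', hl', rfl⟩ := exists_tau_pos q'
  rw [iota_tau, iota_tau] at hq
  have hpos : ∀ {Γ : PointedGraph} {l : Met Γ}, (∀ e, 0 < l.1 e) → ∀ e, 0 < l.wedge.1 e := by
    rintro Γ l hl (- | e)
    · exact zero_lt_one
    · exact hl e
  obtain ⟨α, hα⟩ := exists_iso_of_tau_eq _ _ (hpos hl) (hpos hl') hq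
  refine tau_eq_of_iso h h' α.unwedge fun e => ?_
  have h1 := hα (some e : Option Γ.E)
  change l'.wedge.1 (some (Equiv.removeNone α.edge e) : Option Δ.E) = l.1 e
  by_cases hs : ∃ a, α.edge (some e : Option Γ.E) = some a
  · rw [Equiv.removeNone_some α.edge hs]
    exact h1
  · have h3 : α.edge (some e : Option Γ.E) = none := Option.eq_none_iff_forall_ne_some.2
      fun a ha => hs ⟨a, ha⟩
    rw [Equiv.removeNone_none α.edge h3]
    rw [h3] at h1
    exact (hα (none : Option Γ.E)).trans h1

theorem continuous_iota : Continuous (iota n c) := by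
  rw [isQuotientMap_tauMap.continuous_iff]
  refine continuous_sigma fun Γ => ?_
  change Continuous fun l => iota n c (tau Γ.2 l)
  simp only [iota_tau]
  exact (continuous_tau _).comp Met.continuous_wedge

theorem isClosed_setOf_restrict {F : Set Γ.E} (κ : CMap Γ Δ F) (hc : Γ.IsCactus) {D : Set (Met Δ)}
    (hD : IsClosed D) : IsClosed {l : Met Γ | ∃ hF, l.restrict κ hc hF ∈ D} := by
  let K : Set (Met Γ) := {l | ∀ e ∈ F, l.1 e = 0}
  have hK : IsClosed K := by
    have : K = ⋂ e ∈ F, {l : Met Γ | l.1 e = 0} := by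
      ext l
      simp only [K, Set.mem_iInter, Set.mem_ofPred_eq]
    rw [this]
    exact isClosed_biInter fun e _ => isClosed_eq
      (Met.continuous_length e) continuous_const
  let g : K → Met Δ := fun l => l.1.restrict κ hc l.2
  have hg : Continuous g := Met.continuous_of fun a =>
    (Met.continuous_length (κ.inv a)).comp continuous_subtype_val
  have := hK.isClosedEmbedding_subtypeVal.isClosedMap _ (hD.preimage hg)
  convert this using 1
  ext l
  constructor
  · rintro ⟨hF, hl⟩
    exact ⟨⟨l, hF⟩, hl, rfl⟩
  · rintro ⟨⟨l, hF⟩, hl, rfl⟩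
    exact ⟨hF, hl⟩

/-- A set is closed if it can be detected on collapses by closed conditions. -/
theorem isClosed_of_restrict {A : Set (SigmaQ n c)}
    (D : ∀ {Γ : PointedGraph}, Γ.IsCac n c → Set (Met Γ))
    (hD : ∀ {Γ : PointedGraph} (h : Γ.IsCac n c), IsClosed (D h))
    (hA : ∀ {Γ : PointedGraph} (h : Γ.IsCac n c), ∀ l ∈ D h, tau h l ∈ A)
    (hpos : ∀ {Γ : PointedGraph} (h : Γ.IsCac n c) (l : Met Γ), (∀ e, 0 < l.1 e) →
      tau h l ∈ A → l ∈ D h) : IsClosed A := by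
  rw [← isQuotientMap_tauMap.isClosed_preimage, isClosed_sigma_iff]
  rintro ⟨Γ, h⟩
  -- Membership is tested by collapsing the full zero set, which leaves positive lengths. Letting
  -- `F` run over all forests of zeros does no harm and gives a finite union of closed sets.
  have key : Sigma.mk (⟨Γ, h⟩ : {Γ : PointedGraph // Γ.IsCac n c}) ⁻¹' (tauMap ⁻¹' A) =
      ⋃ F : {F : Set Γ.E // Γ.IsForest F}, {l : Met Γ | ∃ hF,
        l.restrict (CMap.ofCollapse Γ F.1) h.cac hF ∈ D (h.map (CMap.ofCollapse Γ F.1) F.2)} := by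
    ext l
    rw [Set.mem_iUnion]
    constructor
    · intro hl
      let F := {e | l.1 e = 0}
      have hF : ∀ e ∈ F, l.1 e = 0 := fun _ he => he
      refine ⟨⟨F, l.isForest_of_eq_zero hF⟩, hF, hpos _ _ (fun e => ?_) ?_⟩
      · exact lt_of_le_of_ne (l.2.1 _).1 fun h0 =>
          (CMap.ofCollapse Γ F).inv_notMem e h0.symm
      · exact (tau_restrict h (CMap.ofCollapse Γ F) hF) ▸ hl
    · rintro ⟨⟨F, hFf⟩, hF, hl⟩
      change tau h l ∈ A
      rw [tau_restrict h (CMap.ofCollapse Γ F) hF]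
      exact hA _ _ hl
  rw [key]
  exact isClosed_iUnion_of_finite fun F => isClosed_setOf_restrict _ _ (hD _)

theorem exists_baseLoop_of_mem_range (h : Γ.IsCac (n + 1) c) {l : Met Γ} (hl : ∀ e, 0 < l.1 e)
    (hr : tau h l ∈ Set.range (iota n c)) : ∃ e, Γ.IsBaseLoop e := by
  obtain ⟨q, hq⟩ := hr
  obtain ⟨Δ, h', l', hl', rfl⟩ := exists_tau_pos q
  rw [iota_tau] at hq
  obtain ⟨α, -⟩ := exists_iso_of_tau_eq _ _ (by
    rintro (- | e)
    · exact zero_lt_one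
    · exact hl' e) hl hq
  exact ⟨_, α.isBaseLoop (e := (none : Option Δ.E)) ⟨rfl, rfl⟩⟩

/-- For positive lengths, a point of the image has a loop at the basepoint, and deleting any such
loop gives its only preimage. Asking that some deletion lies in `C` is a finite union of closed
conditions. -/
theorem isClosedMap_iota (hn : 1 ≤ n) : IsClosedMap (iota n c) := by
  intro C hC
  refine isClosed_of_restrict (fun {Γ} h => ⋃ e : {e : Γ.E // Γ.IsBaseLoop e},
    {l | tau (h.deleteEdge hn e.2) (l.congr h.cac (deleteIso e.2)).unwedge ∈ C}) ?_ ?_ ?_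
  · intro Γ h
    exact isClosed_iUnion_of_finite fun e => hC.preimage ((continuous_tau _).comp
      (Met.continuous_unwedge.comp (Met.continuous_congr _ _)))
  · intro Γ h l hl
    obtain ⟨e, he⟩ := Set.mem_iUnion.1 hl
    exact ⟨_, he, iota_deleteEdge hn h e.2 l⟩
  · intro Γ h l hl hmem
    obtain ⟨e, he⟩ := exists_baseLoop_of_mem_range h hl (Set.image_subset_range _ _ hmem)
    refine Set.mem_iUnion.2 ⟨⟨e, he⟩, ?_⟩
    rw [← iota_deleteEdge hn h he l] at hmem
    exact (iota_injective.mem_set_image).1 hmem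

theorem isClosedEmbedding_iota (hn : 1 ≤ n) : Topology.IsClosedEmbedding (iota n c) :=
  .of_continuous_injective_isClosedMap continuous_iota iota_injective (isClosedMap_iota hn)

end CactusSpace

namespace CactusSpace

open PointedGraph

variable {n c : ℕ} {Γ Δ : PointedGraph}

/-! ### Cycles through the basepoint and the coweight -/

namespace PointedGraph

/-- A vertex `u` other than the basepoint lies on a second cycle, which misses the basepoint because
two cycles share at most one vertex. Different pairs of a cycle and a vertex on it give different
second cycles. -/
theorem mul_weight_le (h : Γ.IsCac n c) {j : ℕ}
    (hj : ∀ C, Γ.IsReducedCycle C → Γ.On C Γ.base →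
      ∃ u : Fin j → Γ.V, Function.Injective u ∧ ∀ i, Γ.On C (u i) ∧ u i ≠ Γ.base) :
    Γ.weight * j ≤ c := by
  let B := {C : Set Γ.E | Γ.IsReducedCycle C ∧ Γ.On C Γ.base}
  have hD : ∀ x : B × Fin j, ∃ D : Γ.farCycles,
      D.1 ≠ x.1.1 ∧ Γ.On D.1 ((hj x.1.1 x.1.2.1 x.1.2.2).choose x.2) := by
    rintro ⟨⟨C, hC, hCb⟩, i⟩
    obtain ⟨hu, hub⟩ := (hj C hC hCb).choose_spec.2 i
    obtain ⟨D, hD, hDC, hDu⟩ := h.cac.exists_ne_cycle hC hu (h.red.other_valence _ hub)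
    exact ⟨⟨D, hD, fun hDb => hub (h.cac.eq_of_on_of_on hD hC hDC hDu hDb hu hCb)⟩, hDC, hDu⟩
  choose D hDC hDu using hD
  refine le_trans ?_ h.far
  have hinj : Function.Injective D := by
    rintro ⟨⟨C, hC, hCb⟩, i⟩ ⟨⟨C', hC', hCb'⟩, i'⟩ heq
    have hu := (hj C hC hCb).choose_spec.2 i
    have hu' := (hj C' hC' hCb').choose_spec.2 i'
    have h1 := hDu ⟨⟨C, hC, hCb⟩, i⟩
    have h2 := hDu ⟨⟨C', hC', hCb'⟩, i'⟩
    have h3 := hDC ⟨⟨C, hC, hCb⟩, i⟩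
    rw [← heq] at h2
    set E := D ⟨⟨C, hC, hCb⟩, i⟩
    by_cases hCC : C = C'
    · subst hCC
      have := (hj C hC hCb).choose_spec.1
        (h.cac.eq_of_on_of_on E.2.1 hC h3 h1 h2 hu.1 hu'.1)
      subst this
      rfl
    -- If two cycles through the basepoint shared their second cycle `E`, then `C'` and `E` would
    -- join the basepoint to another vertex of `C` outside `C`.
    · refine absurd (h.cac.eq_of_conn_compl hC hCb hu.1 ?_).symm hu.2
      refine Conn.trans (v := (hj C' hC' hCb').choose i')
        ((hC'.conn_on hCb' hu'.1).mono fun e he heC => ?_)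
        ((E.2.1.conn_on h2 h1).mono fun e he heC => ?_)
      · exact hCC (h.cac.eq_of_mem hC hC' heC he)
      · exact h3 (h.cac.eq_of_mem E.2.1 hC he heC)
  have := Nat.card_le_card_of_injective D hinj
  rwa [Nat.card_prod, Nat.card_fin] at this

/-- The edges are different and have the same ends, one of which is the basepoint. -/
def Par (Γ : PointedGraph) (e e' : Γ.E) : Prop :=
  e ≠ e' ∧ ((Γ.src e = Γ.src e' ∧ Γ.tgt e = Γ.tgt e') ∨ (Γ.src e = Γ.tgt e' ∧ Γ.tgt e = Γ.src e')) ∧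
    (Γ.src e = Γ.base ∨ Γ.tgt e = Γ.base)

theorem exists_end_ne_base {e : Γ.E} (he : Γ.src e = Γ.base ∨ Γ.tgt e = Γ.base)
    (hl : ¬ Γ.IsBaseLoop e) : ∃ v, v ≠ Γ.base ∧ (Γ.src e = v ∨ Γ.tgt e = v) ∧
      ((Γ.src e = Γ.base ∧ Γ.tgt e = v) ∨ (Γ.src e = v ∧ Γ.tgt e = Γ.base)) := by
  by_cases h : Γ.src e = Γ.base
  · exact ⟨Γ.tgt e, fun h' => hl ⟨h, h'⟩, Or.inr rfl, Or.inl ⟨h, rfl⟩⟩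
  · exact ⟨Γ.src e, h, Or.inl rfl, Or.inr ⟨rfl, he.resolve_left h⟩⟩

theorem exists_baseLoop (h : Γ.IsCac n c) (hn : 2 * c < n) : ∃ e, Γ.IsBaseLoop e := by
  by_contra! hno
  have h1 := mul_weight_le h (j := 1) fun C _ ⟨e, he, heb⟩ => by
    obtain ⟨v, hv, hev, -⟩ := exists_end_ne_base heb (hno e)
    exact ⟨fun _ => v, fun _ _ _ => Subsingleton.elim _ _, fun _ => ⟨⟨e, he, hev⟩, hv⟩⟩
  have h2 := Γ.weight_add_ncard_farCycles
  have h3 := h.card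
  have h4 := h.far
  omega

/-- Otherwise the two edges at the basepoint of each cycle through it have different other ends, so
w and f, the numbers of cycles through and off the basepoint, satisfy 2w ≤ c and f ≤ c, whence 2n ≤
3c. -/
theorem exists_par (h : Γ.IsCac n c) (hn : 3 * c < 2 * n) (hno : ∀ e, ¬ Γ.IsBaseLoop e) :
    ∃ e e', Γ.Par e e' := by
  classical
  by_contra! hp
  have h1 := mul_weight_le h (j := 2) fun C hC ⟨e, he, heb⟩ => by
    obtain ⟨v, hv, hev, hev'⟩ := exists_end_ne_base heb (hno e)
    have hval := hC.valence_eq he heb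
    have hins := valence_insert (Γ := Γ) (S := C \ {e}) (e := e) (fun h => h.2 rfl) Γ.base
    rw [Set.insert_sdiff_singleton, Set.insert_eq_of_mem he, hval] at hins
    have hpos : 0 < Γ.valence (C \ {e}) Γ.base := by
      have : ¬ (Γ.src e = Γ.base ∧ Γ.tgt e = Γ.base) := hno e
      split_ifs at hins <;> first | omega | exact absurd ⟨‹_›, ‹_›⟩ this
    obtain ⟨e', ⟨he', hne⟩, heb'⟩ := valence_pos_iff.1 hpos
    obtain ⟨v', hv', hev2, hev2'⟩ := exists_end_ne_base heb' (hno e')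
    have hvv : v ≠ v' := by
      rintro rfl
      refine hp e e' ⟨fun h => hne h.symm, ?_, heb⟩
      rcases hev' with ⟨a, b⟩ | ⟨a, b⟩ <;> rcases hev2' with ⟨a', b'⟩ | ⟨a', b'⟩
      · exact Or.inl ⟨a.trans a'.symm, b.trans b'.symm⟩
      · exact Or.inr ⟨a.trans b'.symm, b.trans a'.symm⟩
      · exact Or.inr ⟨a.trans b'.symm, b.trans a'.symm⟩
      · exact Or.inl ⟨a.trans a'.symm, b.trans b'.symm⟩
    refine ⟨![v, v'], ?_, ?_⟩
    · intro i j hij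
      fin_cases i <;> fin_cases j <;> first | rfl | exact absurd hij hvv | exact absurd hij.symm hvv
    · intro i
      fin_cases i
      · exact ⟨⟨e, he, hev⟩, hv⟩
      · exact ⟨⟨e', he', hev2⟩, hv'⟩
  have h2 := Γ.weight_add_ncard_farCycles
  have h3 := h.card
  have h4 := h.far
  omega

/-- A vertex is determined by two cycles through it. -/
theorem card_vertices_le (h : Γ.IsCac n c) : Nat.card Γ.V ≤ n * n + 1 := by
  classical
  have := Fintype.ofFinite Γ.V
  have hC : ∀ v : {v // v ≠ Γ.base}, ∃ x : Γ.cycles × Γ.cycles,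
      x.1.1 ≠ x.2.1 ∧ Γ.On x.1.1 v.1 ∧ Γ.On x.2.1 v.1 := by
    rintro ⟨v, hv⟩
    obtain ⟨C, hC, hCv⟩ := h.red.exists_cycle_on h.cac v
    obtain ⟨D, hD, hDC, hDv⟩ := h.cac.exists_ne_cycle hC hCv (h.red.other_valence v hv)
    exact ⟨⟨⟨D, hD⟩, ⟨C, hC⟩⟩, hDC, hDv, hCv⟩
  choose f hf using hC
  have hinj : Function.Injective f := fun v w hvw => by
    have h1 := hf v
    have h2 := hf w
    rw [← hvw] at h2
    exact Subtype.ext (h.cac.eq_of_on_of_on (f v).1.2 (f v).2.2 h1.1 h1.2.1 h2.2.1 h1.2.2 h2.2.2)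
  have h1 := Nat.card_le_card_of_injective f hinj
  rw [Nat.card_prod, show Nat.card Γ.cycles = n from h.card] at h1
  rw [Nat.card_eq_fintype_card] at h1 ⊢
  rw [Fintype.card_subtype_compl, Fintype.card_subtype_eq] at h1
  omega

end PointedGraph

theorem isHomeomorph_iota (hn : 1 ≤ n) (hc : 2 * c < n + 1) : IsHomeomorph (iota n c) := by
  refine isHomeomorph_iff_continuous_isClosedMap_bijective.2
    ⟨continuous_iota, isClosedMap_iota hn, iota_injective, fun q => ?_⟩
  obtain ⟨Γ, h, l, rfl⟩ := exists_tau q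
  obtain ⟨e, he⟩ := exists_baseLoop h hc
  exact ⟨_, iota_deleteEdge hn h he l⟩

end CactusSpace

namespace CactusSpace

open PointedGraph

variable {n c : ℕ} {Γ Δ : PointedGraph}

/-! ### Pairs of parallel edges at the basepoint -/

namespace PointedGraph

theorem Par.symm {e e' : Γ.E} (h : Γ.Par e e') : Γ.Par e' e := by
  obtain ⟨h1, h2 | h2, h3⟩ := h
  · exact ⟨h1.symm, Or.inl ⟨h2.1.symm, h2.2.symm⟩, by rwa [← h2.1, ← h2.2]⟩
  · exact ⟨h1.symm, Or.inr ⟨h2.2.symm, h2.1.symm⟩, by rwa [← h2.1, ← h2.2, or_comm]⟩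

theorem Par.isReducedCycle (hno : ∀ e, ¬ Γ.IsBaseLoop e) {e e' : Γ.E} (h : Γ.Par e e') :
    Γ.IsReducedCycle {e, e'} := by
  obtain ⟨h1, h2, h3⟩ := h
  have hconn : Γ.Conn {e'} (Γ.src e) (Γ.tgt e) := by
    have h4 : Γ.Conn {e'} (Γ.src e') (Γ.tgt e') := .edge rfl
    rcases h2 with ⟨a, b⟩ | ⟨a, b⟩
    · rwa [a, b]
    · rw [a, b]
      exact h4.symm
  obtain ⟨C, hC, heC, hCs⟩ := exists_isReducedCycle (S := {e'}) h1 hconn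
  have he'C : e' ∈ C := by
    by_contra hn
    have hCe : C ⊆ {e} := fun x hx => (hCs hx).elim id fun h => absurd (h ▸ hx) hn
    have h5 := (hC.conn_diff heC).map_eq id fun x hx => absurd (hCe hx.1) hx.2
    have h6 : Γ.src e = Γ.tgt e := h5
    rcases h3 with h3 | h3
    · exact hno e ⟨h3, h6 ▸ h3⟩
    · exact hno e ⟨h6.trans h3, h3⟩
  have : C = {e, e'} := by
    refine Set.Subset.antisymm hCs ?_
    rintro x (rfl | rfl)
    exacts [heC, he'C]
  exact this ▸ hC

open Classical in
/-- The other edge of a pair of parallel edges at the basepoint; the other edges are fixed. -/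
def star (Γ : PointedGraph) (e : Γ.E) : Γ.E := if h : ∃ e', Γ.Par e e' then h.choose else e

theorem par_star {e : Γ.E} (h : Γ.star e ≠ e) : Γ.Par e (Γ.star e) := by
  unfold star at h ⊢
  split_ifs at h ⊢ with h1
  · exact h1.choose_spec
  · exact absurd rfl h

/-- A parallel pair is a reduced cycle, and `e` lies on only one. So the arbitrary choice in `star`
is no choice. -/
theorem star_eq_of_par (hc : Γ.IsCactus) (hno : ∀ e, ¬ Γ.IsBaseLoop e) {e e' : Γ.E}
    (h : Γ.Par e e') : Γ.star e = e' := by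
  have hex : ∃ e', Γ.Par e e' := ⟨e', h⟩
  have h1 : Γ.Par e (Γ.star e) := by
    unfold star
    rw [dif_pos hex]
    exact hex.choose_spec
  have h2 := hc.eq_of_mem (h1.isReducedCycle hno) (h.isReducedCycle hno) (Or.inl rfl) (Or.inl rfl)
  have h3 : Γ.star e ∈ ({e, e'} : Set Γ.E) := h2 ▸ Or.inr rfl
  exact h3.resolve_left h1.1.symm

theorem star_star (hc : Γ.IsCactus) (hno : ∀ e, ¬ Γ.IsBaseLoop e) (e : Γ.E) :
    Γ.star (Γ.star e) = e := by
  by_cases h : Γ.star e = e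
  · rw [h, h]
  · exact star_eq_of_par hc hno (par_star h).symm

theorem Iso.par (α : Iso Γ Δ) {e e' : Γ.E} (h : Γ.Par e e') :
    Δ.Par (α.edge e) (α.edge e') := by
  obtain ⟨h1, h2, h3⟩ := h
  refine ⟨fun h => h1 (α.edge.injective h), ?_, ?_⟩
  · rw [α.src_edge, α.src_edge, α.tgt_edge, α.tgt_edge]
    rcases h2 with ⟨a, b⟩ | ⟨a, b⟩ <;> cases α.flip e <;> cases α.flip e' <;> simp [a, b]
  · rw [α.src_edge, α.tgt_edge, ← α.map_base]
    cases α.flip e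
    · exact h3.imp (congrArg α.vert) (congrArg α.vert)
    · exact h3.symm.imp (congrArg α.vert) (congrArg α.vert)

theorem Iso.star_edge (α : Iso Γ Δ) (hc' : Δ.IsCactus) (hno' : ∀ e, ¬ Δ.IsBaseLoop e) (e : Γ.E) :
    Δ.star (α.edge e) = α.edge (Γ.star e) := by
  by_cases h : Γ.star e = e
  · rw [h]
    by_contra h1
    have h2 := α.symm.par (par_star h1)
    have h3 : Γ.Par e (α.edge.symm (Δ.star (α.edge e))) := by
      have : α.symm.edge (α.edge e) = e := α.edge.symm_apply_apply e
      rwa [this] at h2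
    have hex : ∃ e', Γ.Par e e' := ⟨_, h3⟩
    refine hex.choose_spec.1 ?_
    unfold star at h
    rw [dif_pos hex] at h
    exact h.symm
  · exact star_eq_of_par hc' hno' (α.par (par_star h))

open Classical in
/-- The automorphism that interchanges some of the pairs of parallel edges. -/
def swap (hc : Γ.IsCactus) (hno : ∀ e, ¬ Γ.IsBaseLoop e) (P : Set Γ.E)
    (hP : ∀ e ∈ P, Γ.star e ∈ P) : Iso Γ Γ where
  vert := Equiv.refl _
  edge := Function.Involutive.toPerm (fun e => if e ∈ P then Γ.star e else e) fun e => by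
    by_cases h : e ∈ P
    · simp only [if_pos h, if_pos (hP e h)]
      exact star_star hc hno e
    · simp only [if_neg h]
  flip := fun e => !decide (Γ.src (if e ∈ P then Γ.star e else e) = Γ.src e)
  map_base := rfl
  src_edge := fun e => by
    change Γ.src (if e ∈ P then Γ.star e else e) = if _ then Γ.tgt e else Γ.src e
    by_cases h : Γ.src (if e ∈ P then Γ.star e else e) = Γ.src e
    · simp [h]
    · have hP : e ∈ P := by
        by_contra hn
        exact h (by rw [if_neg hn])
      rw [if_pos hP] at h ⊢
      have hne : Γ.star e ≠ e := fun h' => h (by rw [h'])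
      simp only [h, decide_false, Bool.not_false, if_true]
      exact ((par_star hne).2.1.resolve_left fun h' => h h'.1.symm).2.symm
  tgt_edge := fun e => by
    change Γ.tgt (if e ∈ P then Γ.star e else e) = if _ then Γ.src e else Γ.tgt e
    by_cases hP : e ∈ P
    · rw [if_pos hP]
      by_cases hne : Γ.star e = e
      · simp [hne]
      · rcases (par_star hne).2.1 with ⟨a, b⟩ | ⟨a, b⟩
        · simp [← a, ← b]
        · by_cases h : Γ.src (Γ.star e) = Γ.src e
          · simp only [h, decide_true, Bool.not_true]
            rw [← a, b, h]
            rfl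
          · simp only [h, decide_false, Bool.not_false, if_true]
            exact a.symm
    · simp [hP]

theorem swap_edge (hc : Γ.IsCactus) (hno : ∀ e, ¬ Γ.IsBaseLoop e) {P : Set Γ.E}
    (hP : ∀ e ∈ P, Γ.star e ∈ P) {e : Γ.E} (he : e ∈ P) :
    (swap hc hno P hP).edge e = Γ.star e := if_pos he

theorem swap_edge_of_notMem (hc : Γ.IsCactus) (hno : ∀ e, ¬ Γ.IsBaseLoop e) {P : Set Γ.E}
    (hP : ∀ e ∈ P, Γ.star e ∈ P) {e : Γ.E} (he : e ∉ P) :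
    (swap hc hno P hP).edge e = e := if_neg he

/-- The set contains exactly one edge of each pair of parallel edges at the basepoint. -/
structure IsChoice (Γ : PointedGraph) (B : Set Γ.E) : Prop where
  notMem : ∀ e ∈ B, Γ.star e ≠ e
  star_mem_iff : ∀ e, Γ.star e ≠ e → (Γ.star e ∈ B ↔ e ∉ B)

/-- Number the edges and take the one with the smaller number from each pair. -/
theorem exists_isChoice (hc : Γ.IsCactus) (hno : ∀ e, ¬ Γ.IsBaseLoop e) : ∃ B, Γ.IsChoice B := by
  obtain ⟨f, hf⟩ := Countable.exists_injective_nat Γ.E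
  refine ⟨{e | f e < f (Γ.star e)}, fun e he h => ?_, fun e he => ?_⟩
  · have he' : f e < f (Γ.star e) := he
    rw [h] at he'
    exact lt_irrefl _ he'
  · change f (Γ.star e) < f (Γ.star (Γ.star e)) ↔ ¬ f e < f (Γ.star e)
    rw [star_star hc hno, not_lt]
    exact ⟨fun h => h.le, fun h => lt_of_le_of_ne h fun h' => he (hf h')⟩

end PointedGraph

/-! ### Flowing to smaller graphs -/

section Flow

variable {X Y : Type}

open Classical in
/-- The point from which lengths flow away. -/
def source (B : Set X) (e : X) : ℝ := if e ∈ B then 2 else 1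

theorem one_le_source (B : Set X) (e : X) : 1 ≤ source B e := by
  unfold source
  split_ifs <;> norm_num

theorem source_pos (B : Set X) (e : X) : 0 < source B e := zero_lt_one.trans_le (one_le_source B e)

/-- The inverse of the time at which the flow reaches a length function with a zero. -/
def rate [Finite X] (B : Set X) (m : X → ℝ) : ℝ :=
  let _ := Fintype.ofFinite X
  (Finset.univ : Finset (Option X)).sup' ⟨none, Finset.mem_univ _⟩
    -- The extra entry 1/2 keeps the rate positive. It is harmless as soon as `B` has an element
    -- `b`, because `m b ≤ 1` and the source value 2 give at least 1/2 there.
    fun o => o.elim (1 / 2) fun e => 1 - m e / source B e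

/-- The length function `m` flows away from `source B` until some length is zero. -/
def flow [Finite X] (B : Set X) (m : X → ℝ) (t : ℝ) (e : X) : ℝ :=
  source B e + (1 - t + t * (rate B m)⁻¹) * (m e - source B e)

variable [Finite X] [Finite Y] {B : Set X} {m : X → ℝ} {t : ℝ}

theorem rate_le_iff {x : ℝ} :
    rate B m ≤ x ↔ 1 / 2 ≤ x ∧ ∀ e, 1 - m e / source B e ≤ x := by
  let _ := Fintype.ofFinite X
  refine (Finset.sup'_le_iff (s := (Finset.univ : Finset (Option X))) ⟨none, Finset.mem_univ _⟩ _).trans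
    ⟨fun h => ⟨h none (Finset.mem_univ _), fun e => h (some e) (Finset.mem_univ _)⟩, ?_⟩
  rintro ⟨h1, h2⟩ (- | e) -
  exacts [h1, h2 e]

theorem half_le_rate : 1 / 2 ≤ rate B m := (rate_le_iff.1 le_rfl).1

theorem rate_pos : 0 < rate B m := lt_of_lt_of_le (by norm_num) half_le_rate

theorem le_rate (e : X) : 1 - m e / source B e ≤ rate B m := (rate_le_iff.1 le_rfl).2 e

theorem rate_le_one (h0 : ∀ e, 0 ≤ m e) : rate B m ≤ 1 :=
  rate_le_iff.2 ⟨by norm_num, fun e => sub_le_self _ (div_nonneg (h0 e) (source_pos B e).le)⟩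

theorem rate_eq_one (h0 : ∀ e, 0 ≤ m e) {e : X} (he : m e = 0) : rate B m = 1 := by
  refine le_antisymm (rate_le_one h0) ?_
  have := le_rate (B := B) (m := m) e
  rwa [he, zero_div, sub_zero] at this

theorem exists_rate_eq (h1 : ∀ e, m e ≤ 1) {b : X} (hb : b ∈ B) :
    ∃ e, 1 - m e / source B e = rate B m := by
  let _ := Fintype.ofFinite X
  obtain ⟨o, -, ho⟩ := Finset.exists_mem_eq_sup' (s := (Finset.univ : Finset (Option X)))
    ⟨none, Finset.mem_univ _⟩ fun o => o.elim (1 / 2) fun e => 1 - m e / source B e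
  rcases o with - | e
  · refine ⟨b, le_antisymm (le_rate b) ?_⟩
    refine (show rate B m ≤ 1 / 2 from ho.le).trans ?_
    rw [source, if_pos hb]
    have := h1 b
    linarith
  · exact ⟨e, ho.symm⟩

/-- The distance from the source is scaled by a factor between 1, where `m` is, and the inverse of
the rate, where the first length vanishes. -/
theorem one_le_speed (h0 : ∀ e, 0 ≤ m e) (ht0 : 0 ≤ t) : 1 ≤ 1 - t + t * (rate B m)⁻¹ := by
  have h1 : 1 ≤ (rate B m)⁻¹ := (one_le_inv₀ rate_pos).2 (rate_le_one h0)
  nlinarith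

theorem speed_mul_rate_le (h0 : ∀ e, 0 ≤ m e) (ht1 : t ≤ 1) :
    (1 - t + t * (rate B m)⁻¹) * rate B m ≤ 1 := by
  rw [add_mul, mul_assoc, inv_mul_cancel₀ rate_pos.ne']
  nlinarith [rate_le_one (B := B) h0]

theorem flow_nonneg (h0 : ∀ e, 0 ≤ m e) (ht0 : 0 ≤ t) (ht1 : t ≤ 1) (e : X) :
    0 ≤ flow B m t e := by
  have hs := source_pos B e
  have h1 := one_le_speed (B := B) h0 ht0
  have h2 := speed_mul_rate_le (B := B) h0 ht1
  unfold flow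
  set s := 1 - t + t * (rate B m)⁻¹
  have h3 : s * (1 - m e / source B e) ≤ 1 :=
    (mul_le_mul_of_nonneg_left (le_rate e) (zero_le_one.trans h1)).trans h2
  have h4 : s * (m e - source B e) = -(source B e * (s * (1 - m e / source B e))) := by
    field_simp
    ring
  rw [h4]
  nlinarith

theorem flow_le (h0 : ∀ e, 0 ≤ m e) (h1 : ∀ e, m e ≤ 1) (ht0 : 0 ≤ t) (e : X) :
    flow B m t e ≤ m e := by
  have h2 := one_le_speed (B := B) h0 ht0
  have h3 := one_le_source B e
  have h4 := h1 e
  unfold flow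
  nlinarith

theorem flow_eq_one {e : X} (he : e ∉ B) (hm : m e = 1) : flow B m t e = 1 := by
  rw [flow, source, if_neg he, hm, sub_self, mul_zero, add_zero]

theorem flow_zero : flow B m 0 = m := by
  funext e
  rw [flow]
  ring

theorem flow_of_eq_zero (h0 : ∀ e, 0 ≤ m e) {e : X} (he : m e = 0) : flow B m t = m := by
  funext a
  rw [flow, rate_eq_one h0 he]
  ring

theorem exists_flow_one_eq_zero (h1 : ∀ e, m e ≤ 1) {b : X} (hb : b ∈ B) :
    ∃ e, flow B m 1 e = 0 := by
  obtain ⟨e, he⟩ := exists_rate_eq h1 hb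
  refine ⟨e, ?_⟩
  have hr := rate_pos (B := B) (m := m)
  rw [flow, sub_self, zero_add, one_mul]
  have h2 : m e - source B e = -(source B e * rate B m) := by
    rw [← he]
    have := (source_pos B e).ne'
    field_simp
    ring
  rw [h2]
  field_simp
  ring

theorem flow_equiv {B' : Set Y} {m' : Y → ℝ} (β : X ≃ Y) (hB : ∀ e, β e ∈ B' ↔ e ∈ B)
    (hm : ∀ e, m' (β e) = m e) (e : X) : flow B' m' t (β e) = flow B m t e := by
  have hs : ∀ e, source B' (β e) = source B e := fun e => by
    by_cases h : e ∈ B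
    · rw [source, source, if_pos h, if_pos ((hB e).2 h)]
    · rw [source, source, if_neg h, if_neg fun h' => h ((hB e).1 h')]
  have hr : rate B' m' = rate B m := by
    refine eq_of_forall_ge_iff fun x => ?_
    rw [rate_le_iff, rate_le_iff, β.forall_congr_left]
    refine and_congr_right fun _ => forall_congr' fun y => ?_
    have h1 := hs (β.symm y)
    have h2 := hm (β.symm y)
    rw [Equiv.apply_symm_apply] at h1 h2
    rw [h1, h2]
  rw [flow, flow, hs, hm, hr]

theorem continuous_rate (B : Set X) : Continuous fun m : X → ℝ => rate B m := by
  let _ := Fintype.ofFinite X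
  refine Continuous.finset_sup'_apply (s := (Finset.univ : Finset (Option X)))
    ⟨none, Finset.mem_univ _⟩ fun o _ => ?_
  rcases o with - | e
  · exact continuous_const
  · exact continuous_const.sub ((continuous_apply e).div_const _)

theorem continuous_flow (B : Set X) (e : X) :
    Continuous fun p : (X → ℝ) × ℝ => flow B p.1 p.2 e := by
  have h1 : Continuous fun p : (X → ℝ) × ℝ => (rate B p.1)⁻¹ :=
    ((continuous_rate B).comp continuous_fst).inv₀ fun p => rate_pos.ne'
  have h2 : Continuous fun p : (X → ℝ) × ℝ => p.1 e := (continuous_apply e).comp continuous_fst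
  exact continuous_const.add (((continuous_const.sub continuous_snd).add
    (continuous_snd.mul h1)).mul (h2.sub continuous_const))

end Flow

end CactusSpace

/-! ### Sorting parallel edges and the flow on metric graphs. -/

namespace CactusSpace

open PointedGraph

variable {n c : ℕ} {Γ Δ : PointedGraph}

namespace PointedGraph

open Classical in
/-- The lengths of parallel edges at the basepoint, sorted such that the edges in `B` are the
shorter ones. -/
def fold (B : Set Γ.E) (l : Γ.E → ℝ) (e : Γ.E) : ℝ :=
  if e ∈ B then min (l e) (l (Γ.star e)) else max (l e) (l (Γ.star e))

theorem fold_of_notMem {B : Set Γ.E} {l : Γ.E → ℝ} {e : Γ.E} (he : e ∉ B) :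
    fold B l e = max (l e) (l (Γ.star e)) := if_neg he

theorem fold_cases (hc : Γ.IsCactus) (hno : ∀ e, ¬ Γ.IsBaseLoop e) {B : Set Γ.E}
    (hB : Γ.IsChoice B) (l : Γ.E → ℝ) (e : Γ.E) :
    (fold B l e = l e ∧ fold B l (Γ.star e) = l (Γ.star e)) ∨
      (fold B l e = l (Γ.star e) ∧ fold B l (Γ.star e) = l e) := by
  by_cases h : Γ.star e = e
  · refine Or.inl ?_
    rw [h, and_self, fold_of_notMem fun he => hB.notMem e he h, h, max_self]
  · have h1 := hB.star_mem_iff e h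
    unfold fold
    rw [star_star hc hno]
    by_cases he : e ∈ B
    · rw [if_pos he, if_neg fun h' => h1.1 h' he]
      rcases le_total (l e) (l (Γ.star e)) with h2 | h2
      · exact Or.inl ⟨min_eq_left h2, max_eq_left h2⟩
      · exact Or.inr ⟨min_eq_right h2, max_eq_right h2⟩
    · rw [if_neg he, if_pos (h1.2 he)]
      rcases le_total (l e) (l (Γ.star e)) with h2 | h2
      · exact Or.inr ⟨max_eq_right h2, min_eq_right h2⟩
      · exact Or.inl ⟨max_eq_left h2, min_eq_left h2⟩

theorem continuous_fold (B : Set Γ.E) : Continuous fun l : Γ.E → ℝ => fold B l := by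
  refine continuous_pi fun e => ?_
  unfold fold
  split_ifs
  · exact (continuous_apply e).min (continuous_apply _)
  · exact (continuous_apply e).max (continuous_apply _)

end PointedGraph

theorem Met.fold_mem (l : Met Γ) (B : Set Γ.E) (e : Γ.E) :
    0 ≤ fold B l.1 e ∧ fold B l.1 e ≤ 1 := by
  unfold fold
  have h1 := l.2.1 e
  have h2 := l.2.1 (Γ.star e)
  split_ifs
  · exact ⟨le_min h1.1 h2.1, (min_le_left _ _).trans h1.2⟩
  · exact ⟨h1.1.trans (le_max_left _ _), max_le h1.2 h2.2⟩

/-- The flow on metric graphs without loops at the basepoint. -/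
def Met.flow (hc : Γ.IsCactus) (hno : ∀ e, ¬ Γ.IsBaseLoop e) {B : Set Γ.E} (hB : Γ.IsChoice B)
    (l : Met Γ) (t : unitInterval) : Met Γ :=
  ⟨CactusSpace.flow B (fold B l.1) t, fun e =>
    ⟨flow_nonneg (fun e => (l.fold_mem B e).1) t.2.1 t.2.2 e,
      (flow_le (fun e => (l.fold_mem B e).1) (fun e => (l.fold_mem B e).2) t.2.1 e).trans
        (l.fold_mem B e).2⟩, by
    intro C hCs hC
    -- Edges outside `B` of sorted length 1 do not move, their source value being 1. If the edge of
    -- length 1 on a cycle is in `B`, the cycle is a parallel pair and sorting gives the length 1 to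
    -- the partner.
    have key : ∀ x ∈ C, x ∉ B → l.1 x = 1 ∨ l.1 (Γ.star x) = 1 → False := by
      intro x hx hxB h1
      have h2 : fold B l.1 x = 1 := by
        refine le_antisymm (l.fold_mem B x).2 ?_
        rw [fold_of_notMem hxB]
        exact h1.elim (fun h => le_max_of_le_left h.ge) fun h => le_max_of_le_right h.ge
      exact ne_of_lt (show _ < (1 : ℝ) from hCs hx) (flow_eq_one hxB h2)
    obtain ⟨e, he, he1⟩ := l.eq_one_of_cycle hC
    by_cases heB : e ∈ B
    · have hne := hB.notMem e heB
      have hCe := hc.eq_of_mem hC ((par_star hne).isReducedCycle hno) he (Or.inl rfl)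
      refine key (Γ.star e) (hCe ▸ Or.inr rfl) (fun h => (hB.star_mem_iff e hne).1 h heB) ?_
      rw [star_star hc hno]
      exact Or.inr he1
    · exact key e he heB (Or.inl he1)⟩

section

variable (h : Γ.IsCac n c) (h' : Δ.IsCac n c) (hno : ∀ e, ¬ Γ.IsBaseLoop e)
  (hno' : ∀ e, ¬ Δ.IsBaseLoop e) {B : Set Γ.E} (hB : Γ.IsChoice B) {B' : Set Δ.E}
  (hB' : Δ.IsChoice B')

/-- Sorting interchanges the lengths in some parallel pairs, and an automorphism of the graph does
the same. -/
theorem tau_eq_of_fold {l l' : Met Γ} (hl : l'.1 = fold B l.1) (hB : Γ.IsChoice B)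
    (hno : ∀ e, ¬ Γ.IsBaseLoop e) : tau h l' = tau h l := by
  let P : Set Γ.E := {e | fold B l.1 e ≠ l.1 e}
  have hswap : ∀ e ∈ P, fold B l.1 e = l.1 (Γ.star e) ∧ fold B l.1 (Γ.star e) = l.1 e := by
    intro e he
    exact (fold_cases h.cac hno hB l.1 e).resolve_left fun h => he h.1
  have hP : ∀ e ∈ P, Γ.star e ∈ P := by
    intro e he h1
    obtain ⟨h2, h3⟩ := hswap e he
    exact he (h2.trans (h1.symm.trans h3))
  refine (tau_eq_of_iso h h (swap h.cac hno P hP) fun e => ?_).symm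
  rw [hl]
  by_cases he : e ∈ P
  · rw [swap_edge h.cac hno hP he]
    exact (hswap e he).2
  · rw [swap_edge_of_notMem h.cac hno hP he]
    exact not_not.1 he

theorem tau_flow_zero (l : Met Γ) : tau h (l.flow h.cac hno hB 0) = tau h l :=
  tau_eq_of_fold h flow_zero hB hno

theorem tau_flow_of_eq_zero (l : Met Γ) (t : unitInterval) {e : Γ.E} (he : l.1 e = 0) :
    tau h (l.flow h.cac hno hB t) = tau h l := by
  refine tau_eq_of_fold h ?_ hB hno
  have h0 : fold B l.1 e = 0 ∨ fold B l.1 (Γ.star e) = 0 :=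
    (fold_cases h.cac hno hB l.1 e).imp (fun h => h.1.trans he) fun h => h.2.trans he
  rcases h0 with h0 | h0
  · exact flow_of_eq_zero (fun e => (l.fold_mem B e).1) h0
  · exact flow_of_eq_zero (fun e => (l.fold_mem B e).1) h0

theorem exists_flow_one (l : Met Γ) {e e' : Γ.E} (hp : Γ.Par e e') :
    ∃ a, (l.flow h.cac hno hB 1).1 a = 0 := by
  have hne : Γ.star e ≠ e := by
    rw [star_eq_of_par h.cac hno hp]
    exact hp.1.symm
  have hb : ∃ b, b ∈ B := by
    by_cases he : e ∈ B
    · exact ⟨e, he⟩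
    · exact ⟨_, (hB.star_mem_iff e hne).2 he⟩
  obtain ⟨b, hb⟩ := hb
  exact exists_flow_one_eq_zero (fun e => (l.fold_mem B e).2) hb

/-- The flow does not depend on the choice of `B` in the orbit space: `P` collects the pairs on
which `α` does not match the two choices, and interchanging these pairs first yields an isomorphism
that does. -/
theorem tau_flow_eq {l : Met Γ} {l' : Met Δ} (α : Iso Γ Δ) (hα : ∀ e, l'.1 (α.edge e) = l.1 e)
    (t : unitInterval) :
    tau h (l.flow h.cac hno hB t) = tau h' (l'.flow h'.cac hno' hB' t) := by
  have hstar := α.star_edge h'.cac hno'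
  have hss := star_star h.cac hno
  let P : Set Γ.E := {e | ¬ (α.edge e ∈ B' ↔ e ∈ B)}
  have hne : ∀ e ∈ P, Γ.star e ≠ e := by
    intro e he h1
    refine he ⟨fun h2 => absurd ?_ (hB'.notMem _ h2), fun h2 => absurd h1 (hB.notMem _ h2)⟩
    rw [hstar, h1]
  have hiff : ∀ e, Γ.star e ≠ e → (α.edge (Γ.star e) ∈ B' ↔ α.edge e ∉ B') := by
    intro e he
    rw [← hstar]
    refine hB'.star_mem_iff _ ?_
    rw [hstar]
    exact fun h => he (α.edge.injective h)
  have hP : ∀ e ∈ P, Γ.star e ∈ P := by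
    intro e he h1
    rw [hiff e (hne e he), hB.star_mem_iff e (hne e he)] at h1
    exact he (not_iff_not.1 h1)
  let β := (swap h.cac hno P hP).trans α
  have hβ : ∀ e, (β.edge e = α.edge e ∧ e ∉ P) ∨ (β.edge e = α.edge (Γ.star e) ∧ e ∈ P) := by
    intro e
    by_cases he : e ∈ P
    · exact Or.inr ⟨congrArg α.edge (swap_edge h.cac hno hP he), he⟩
    · exact Or.inl ⟨congrArg α.edge (swap_edge_of_notMem h.cac hno hP he), he⟩
  have hβB : ∀ e, β.edge e ∈ B' ↔ e ∈ B := by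
    intro e
    rcases hβ e with ⟨h1, he⟩ | ⟨h1, he⟩
    · rw [h1]
      exact not_not.1 he
    · rw [h1, hiff e (hne e he)]
      have he' : ¬ (α.edge e ∈ B' ↔ e ∈ B) := he
      tauto
  refine tau_eq_of_iso h h' β fun e => flow_equiv β.edge hβB (fun e => ?_) e
  have hpair : (l'.1 (β.edge e) = l.1 e ∧ l'.1 (Δ.star (β.edge e)) = l.1 (Γ.star e)) ∨
      (l'.1 (β.edge e) = l.1 (Γ.star e) ∧ l'.1 (Δ.star (β.edge e)) = l.1 e) := by
    rcases hβ e with ⟨h1, -⟩ | ⟨h1, -⟩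
    · rw [h1, hstar, hα, hα]
      exact Or.inl ⟨rfl, rfl⟩
    · rw [h1, hstar, hα, hα, hss]
      exact Or.inr ⟨rfl, rfl⟩
  have hb := hβB e
  by_cases he : e ∈ B
  · rw [fold, fold, if_pos he, if_pos (hb.2 he)]
    rcases hpair with ⟨h1, h2⟩ | ⟨h1, h2⟩
    · rw [h1, h2]
    · rw [h1, h2, min_comm]
  · rw [fold, fold, if_neg he, if_neg (mt hb.1 he)]
    rcases hpair with ⟨h1, h2⟩ | ⟨h1, h2⟩
    · rw [h1, h2]
    · rw [h1, h2, max_comm]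

theorem continuous_met_flow (hc : Γ.IsCactus) :
    Continuous fun p : Met Γ × unitInterval => p.1.flow hc hno hB p.2 := by
  refine Met.continuous_of fun e => ?_
  exact (continuous_flow B e).comp
    (((continuous_fold B).comp (continuous_subtype_val.comp continuous_fst)).prodMk
      (continuous_subtype_val.comp continuous_snd))

end

/-! ### The filtration by the number of vertices -/

/-- The orbits of metric graphs with at most `k` vertices. -/
def small (n c k : ℕ) : Set (SigmaQ n c) :=
  {q | ∃ (Γ : PointedGraph) (h : Γ.IsCac n c) (l : Met Γ), tau h l = q ∧ Nat.card Γ.V ≤ k}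

/-- Among the representatives of a point, those with positive lengths have the fewest vertices,
being collapses of all others up to isometry. -/
theorem card_le_of_tau_mem_small {k : ℕ} (h : Γ.IsCac n c) {l : Met Γ} (hl : ∀ e, 0 < l.1 e)
    (hs : tau h l ∈ small n c k) : Nat.card Γ.V ≤ k := by
  obtain ⟨Δ, h', l', h1, h2⟩ := hs
  obtain ⟨Θ, h'', κ, l'', hl'', h3, -⟩ := exists_tau_eq_pos h' l'
  obtain ⟨α, -⟩ := exists_iso_of_tau_eq h h'' hl hl'' (h1.symm.trans h3)
  rw [Nat.card_congr α.vert]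
  exact (Nat.card_le_card_of_surjective _ κ.surj).trans h2

theorem tau_mem_small {k : ℕ} (h : Γ.IsCac n c) {l : Met Γ} (hk : Nat.card Γ.V ≤ k + 1) {e : Γ.E}
    (he : l.1 e = 0) : tau h l ∈ small n c k := by
  obtain ⟨Θ, h', κ, l', -, h1, -⟩ := exists_tau_eq_pos h l
  refine ⟨Θ, h', l', h1.symm, Nat.lt_succ_iff.1 (lt_of_lt_of_le ?_ hk)⟩
  exact κ.card_lt (l.isForest_of_eq_zero fun _ he => he) ⟨e, he⟩

theorem isClosed_small (n c k : ℕ) : IsClosed (small n c k) :=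
  isClosed_of_restrict (fun {Γ} _ => {_l | Nat.card Γ.V ≤ k}) (fun _ => isClosed_const)
    (fun h l hl => ⟨_, h, l, rfl, hl⟩) fun h _ hl hs => card_le_of_tau_mem_small h hl hs

theorem small_zero : small n c 0 = ∅ := by
  rw [Set.eq_empty_iff_forall_notMem]
  rintro q ⟨Γ, -, -, -, h⟩
  have : Nonempty Γ.V := ⟨Γ.base⟩
  exact absurd h (not_le.2 Nat.card_pos)

theorem small_eq_univ : small n c (n * n + 1) = Set.univ := by
  rw [Set.eq_univ_iff_forall]
  intro q
  obtain ⟨Γ, h, l, rfl⟩ := exists_tau q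
  exact ⟨Γ, h, l, rfl, card_vertices_le h⟩

theorem small_mono (k : ℕ) : small n c k ⊆ small n c (k + 1) := by
  rintro q ⟨Γ, h, l, rfl, hk⟩
  exact ⟨Γ, h, l, rfl, hk.trans (Nat.le_succ k)⟩

/-- The image of the stabilization map together with the orbits of metric graphs with at most `k`
vertices. -/
def stage (n c k : ℕ) : Set (SigmaQ (n + 1) c) := Set.range (iota n c) ∪ small (n + 1) c k

theorem isClosed_stage (hn : 1 ≤ n) (c k : ℕ) : IsClosed (stage n c k) :=
  (isClosedEmbedding_iota hn).isClosed_range.union (isClosed_small _ _ _)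

theorem stage_mono (k : ℕ) : stage n c k ⊆ stage n c (k + 1) :=
  Set.union_subset_union_right _ (small_mono k)

/-- Graphs with exactly `k + 1` vertices. -/
abbrev Cell (n c k : ℕ) : Type 1 :=
  {Γ : PointedGraph // Γ.IsCac (n + 1) c ∧ Nat.card Γ.V = k + 1}

/-- The pieces from which the next stage is glued. -/
abbrev Pieces (n c k : ℕ) : Type 1 := stage n c k ⊕ Σ Γ : Cell n c k, Met Γ.1

theorem tau_mem_stage {k : ℕ} (Γ : Cell n c k) (l : Met Γ.1) :
    tau Γ.2.1 l ∈ stage n c (k + 1) := Or.inr ⟨_, Γ.2.1, l, rfl, Γ.2.2.le⟩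

def glue (n c k : ℕ) : C(Pieces n c k, stage n c (k + 1)) where
  toFun := Sum.elim (fun x => ⟨x.1, stage_mono k x.2⟩) fun x => ⟨tau x.1.2.1 x.2, tau_mem_stage _ _⟩
  continuous_toFun := (continuous_subtype_val.subtype_mk _).sumElim
    (continuous_sigma fun Γ => (continuous_tau Γ.2.1).subtype_mk _)

/-- A point of the new stage outside the old one, represented with positive lengths, has exactly `k
+ 1` vertices. So closedness is tested on the old stage and on the cells alone. -/
theorem isQuotientMap_glue (hn : 1 ≤ n) (c k : ℕ) : Topology.IsQuotientMap (glue n c k) := by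
  classical
  rw [Topology.isQuotientMap_iff_isClosed]
  constructor
  · rintro ⟨q, hq⟩
    by_cases hk : q ∈ stage n c k
    · exact ⟨Sum.inl ⟨q, hk⟩, rfl⟩
    · rcases hq with hq | ⟨Γ, h, l, rfl, hl⟩
      · exact absurd (Or.inl hq) hk
      · refine ⟨Sum.inr ⟨⟨Γ, h, le_antisymm hl (Nat.lt_of_not_le fun h1 => hk ?_)⟩, l⟩, rfl⟩
        exact Or.inr ⟨Γ, h, l, rfl, h1⟩
  · intro C
    refine ⟨fun hC => hC.preimage (glue n c k).continuous, fun hC => ?_⟩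
    obtain ⟨hC1, hC2⟩ := isClosed_sum_iff.1 hC
    let A : Set (SigmaQ (n + 1) c) := Subtype.val '' C
    have hA1 : IsClosed (A ∩ stage n c k) := by
      have := (isClosed_stage hn c k).isClosedEmbedding_subtypeVal.isClosedMap _ hC1
      convert this using 1
      ext q
      constructor
      · rintro ⟨⟨x, hx, rfl⟩, hq⟩
        exact ⟨⟨x.1, hq⟩, hx, rfl⟩
      · rintro ⟨x, hx, rfl⟩
        exact ⟨⟨_, hx, rfl⟩, x.2⟩
    have hA : IsClosed A := by
      refine isClosed_of_restrict (fun {Γ} h => {l | tau h l ∈ A ∩ stage n c k} ∪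
        {l | tau h l ∈ A ∧ Nat.card Γ.V = k + 1}) ?_ ?_ ?_
      · intro Γ h
        refine (hA1.preimage (continuous_tau h)).union ?_
        by_cases hk : Nat.card Γ.V = k + 1
        · have h2 := isClosed_sigma_iff.1 hC2 ⟨Γ, h, hk⟩
          convert h2 using 1
          ext l
          constructor
          · rintro ⟨⟨x, hx, hxl⟩, -⟩
            have : x = ⟨tau h l, tau_mem_stage (⟨Γ, h, hk⟩ : Cell n c k) l⟩ := Subtype.ext hxl
            rw [this] at hx
            exact hx
          · exact fun hl => ⟨⟨_, hl, rfl⟩, hk⟩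
        · convert isClosed_empty using 1
          ext l
          exact ⟨fun h => hk h.2, fun h => h.elim⟩
      · rintro Γ h l (hl | hl)
        exacts [hl.1, hl.1]
      · intro Γ h l hl hlA
        by_cases hk : tau h l ∈ stage n c k
        · exact Or.inl ⟨hlA, hk⟩
        · refine Or.inr ⟨hlA, ?_⟩
          obtain ⟨x, -, hx⟩ := hlA
          rcases x.2 with h1 | h1
          · exact absurd (Or.inl (hx ▸ h1)) hk
          · rw [hx] at h1
            refine le_antisymm (card_le_of_tau_mem_small h hl h1) (Nat.lt_of_not_le fun h2 => hk ?_)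
            exact Or.inr ⟨Γ, h, l, rfl, h2⟩
    have := hA.preimage (continuous_subtype_val (p := (· ∈ stage n c (k + 1))))
    rwa [Set.preimage_image_eq _ Subtype.val_injective] at this

end CactusSpace

/-! ### Deformation retractions between the stages. -/

namespace CactusSpace

open PointedGraph

variable {n c k : ℕ} {Γ Δ : PointedGraph}

open Classical in
/-- The homotopy on one cell: metric graphs without loops at the basepoint flow to smaller ones. -/
def cellHomotopy (h : Γ.IsCac n c) (p : Met Γ × unitInterval) : SigmaQ n c :=
  if hno : ∀ e, ¬ Γ.IsBaseLoop e then
    tau h (p.1.flow h.cac hno (exists_isChoice h.cac hno).choose_spec p.2)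
  else tau h p.1

theorem cellHomotopy_of_not (h : Γ.IsCac n c) (p : Met Γ × unitInterval)
    (hno : ¬ ∀ e, ¬ Γ.IsBaseLoop e) : cellHomotopy h p = tau h p.1 := dif_neg hno

theorem cellHomotopy_of (h : Γ.IsCac n c) (p : Met Γ × unitInterval)
    (hno : ∀ e, ¬ Γ.IsBaseLoop e) : cellHomotopy h p =
      tau h (p.1.flow h.cac hno (exists_isChoice h.cac hno).choose_spec p.2) := dif_pos hno

theorem continuous_cellHomotopy (h : Γ.IsCac n c) : Continuous (cellHomotopy h) := by
  by_cases hno : ∀ e, ¬ Γ.IsBaseLoop e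
  · refine (continuous_congr fun p => cellHomotopy_of h p hno).2 ?_
    exact (continuous_tau h).comp (continuous_met_flow hno _ h.cac)
  · refine (continuous_congr fun p => cellHomotopy_of_not h p hno).2 ?_
    exact (continuous_tau h).comp continuous_fst

theorem cellHomotopy_zero (h : Γ.IsCac n c) (l : Met Γ) : cellHomotopy h (l, 0) = tau h l := by
  by_cases hno : ∀ e, ¬ Γ.IsBaseLoop e
  · rw [cellHomotopy_of h _ hno]
    exact tau_flow_zero h hno _ l
  · exact cellHomotopy_of_not h _ hno

theorem cellHomotopy_of_eq_zero (h : Γ.IsCac n c) (l : Met Γ) (t : unitInterval) {e : Γ.E}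
    (he : l.1 e = 0) : cellHomotopy h (l, t) = tau h l := by
  by_cases hno : ∀ e, ¬ Γ.IsBaseLoop e
  · rw [cellHomotopy_of h _ hno]
    exact tau_flow_of_eq_zero h hno _ l t he
  · exact cellHomotopy_of_not h _ hno

/-- A point of the old stage with positive lengths and `k + 1` vertices can only be in the image of
ι, so it has a loop at the basepoint, where the homotopy is constant. If a length vanishes, the flow
stands still. -/
theorem cellHomotopy_of_mem (h : Γ.IsCac (n + 1) c) (hk : Nat.card Γ.V = k + 1) (l : Met Γ)
    (t : unitInterval) (hl : tau h l ∈ stage n c k) : cellHomotopy h (l, t) = tau h l := by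
  by_cases hpos : ∀ e, 0 < l.1 e
  · rcases hl with hl | hl
    · obtain ⟨e, he⟩ := exists_baseLoop_of_mem_range h hpos hl
      exact cellHomotopy_of_not h _ fun hno => hno e he
    · have := card_le_of_tau_mem_small h hpos hl
      omega
  · push Not at hpos
    obtain ⟨e, he⟩ := hpos
    exact cellHomotopy_of_eq_zero h l t (le_antisymm he (l.2.1 e).1)

theorem cellHomotopy_congr (h : Γ.IsCac (n + 1) c) (h' : Δ.IsCac (n + 1) c)
    (hk : Nat.card Γ.V = k + 1) (hk' : Nat.card Δ.V = k + 1) {l : Met Γ} {l' : Met Δ}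
    (heq : tau h l = tau h' l') (t : unitInterval) :
    cellHomotopy h (l, t) = cellHomotopy h' (l', t) := by
  by_cases hs : tau h l ∈ stage n c k
  · rw [cellHomotopy_of_mem h hk l t hs, cellHomotopy_of_mem h' hk' l' t (heq ▸ hs), heq]
  · have hpos : ∀ {Γ : PointedGraph} (h : Γ.IsCac (n + 1) c) (_ : Nat.card Γ.V = k + 1) {l : Met Γ},
        tau h l ∉ stage n c k → ∀ e, 0 < l.1 e := by
      intro Γ h hk l hs e
      exact lt_of_le_of_ne (l.2.1 e).1 fun h0 => hs (Or.inr (tau_mem_small h hk.le h0.symm))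
    obtain ⟨α, hα⟩ := exists_iso_of_tau_eq h h' (hpos h hk hs) (hpos h' hk' (heq ▸ hs)) heq
    by_cases hno : ∀ e, ¬ Γ.IsBaseLoop e
    · have hno' : ∀ e, ¬ Δ.IsBaseLoop e := fun e he => hno _ (α.symm.isBaseLoop he)
      rw [cellHomotopy_of h _ hno, cellHomotopy_of h' _ hno']
      exact tau_flow_eq h h' hno hno' _ _ α hα t
    · have hno' : ¬ ∀ e, ¬ Δ.IsBaseLoop e := fun hno' => hno fun e he => hno' _ (α.isBaseLoop he)
      rw [cellHomotopy_of_not h _ hno, cellHomotopy_of_not h' _ hno']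
      exact heq

theorem cellHomotopy_mem (h : Γ.IsCac (n + 1) c) (hk : Nat.card Γ.V = k + 1)
    (p : Met Γ × unitInterval) : cellHomotopy h p ∈ stage n c (k + 1) := by
  by_cases hno : ∀ e, ¬ Γ.IsBaseLoop e
  · rw [cellHomotopy_of h _ hno]
    exact Or.inr ⟨_, h, _, rfl, hk.le⟩
  · rw [cellHomotopy_of_not h _ hno]
    exact Or.inr ⟨_, h, _, rfl, hk.le⟩

/-- The only use of the bound on `c` here is the parallel pair: it makes the choice nonempty, so the
flow ends at a length function with a zero. -/
theorem cellHomotopy_one_mem (hn : 1 ≤ n) (hc : 3 * c < 2 * (n + 1)) (h : Γ.IsCac (n + 1) c)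
    (hk : Nat.card Γ.V = k + 1) (l : Met Γ) : cellHomotopy h (l, 1) ∈ stage n c k := by
  by_cases hno : ∀ e, ¬ Γ.IsBaseLoop e
  · rw [cellHomotopy_of h _ hno]
    obtain ⟨e, e', hp⟩ := exists_par h hc hno
    obtain ⟨a, ha⟩ := exists_flow_one h hno (exists_isChoice h.cac hno).choose_spec l hp
    exact Or.inr (tau_mem_small h hk.le ha)
  · rw [cellHomotopy_of_not h _ hno]
    push Not at hno
    obtain ⟨e, he⟩ := hno
    exact Or.inl ⟨_, iota_deleteEdge hn h he l⟩

/-- The homotopy on the pieces. -/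
def piecesHomotopy (n c k : ℕ) : C(Pieces n c k, C(unitInterval, stage n c (k + 1))) where
  toFun := Sum.elim (fun x => ContinuousMap.const _ ⟨x.1, stage_mono k x.2⟩) fun x =>
    ⟨fun t => ⟨cellHomotopy x.1.2.1 (x.2, t), cellHomotopy_mem x.1.2.1 x.1.2.2 _⟩,
      ((continuous_cellHomotopy x.1.2.1).comp (Continuous.prodMk_right x.2)).subtype_mk _⟩
  continuous_toFun := by
    refine Continuous.sumElim ?_ (continuous_sigma fun Γ => ?_)
    · exact ContinuousMap.continuous_of_continuous_uncurry _
        ((continuous_subtype_val.comp continuous_fst).subtype_mk _)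
    · exact ContinuousMap.continuous_of_continuous_uncurry _
        ((continuous_cellHomotopy Γ.2.1).subtype_mk _)

theorem piecesHomotopy_congr {x y : Pieces n c k} (h : glue n c k x = glue n c k y) :
    piecesHomotopy n c k x = piecesHomotopy n c k y := by
  ext t
  have h1 := congrArg Subtype.val h
  rcases x with x | ⟨Γ, l⟩ <;> rcases y with y | ⟨Δ, l'⟩
  · exact h1
  · have h2 : x.1 = tau Δ.2.1 l' := h1
    exact h2.trans (cellHomotopy_of_mem Δ.2.1 Δ.2.2 l' t (h2 ▸ x.2)).symm
  · have h2 : tau Γ.2.1 l = y.1 := h1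
    exact (cellHomotopy_of_mem Γ.2.1 Γ.2.2 l t (h2 ▸ y.2)).trans h2
  · exact cellHomotopy_congr Γ.2.1 Δ.2.1 Γ.2.2 Δ.2.2 h1 t

theorem exists_homotopyEquiv_stage_succ (hn : 1 ≤ n) (hc : 3 * c < 2 * (n + 1)) (k : ℕ) :
    ∃ h : ContinuousMap.HomotopyEquiv (stage n c k) (stage n c (k + 1)),
      ∀ x, (h x).1 = x.1 := by
  -- A curried homotopy descends along the quotient map directly, so the product of that map with
  -- the interval need not be a quotient map. The result is a strong deformation retraction.
  let G : C(stage n c (k + 1), C(unitInterval, stage n c (k + 1))) :=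
    (isQuotientMap_glue hn c k).lift (piecesHomotopy n c k) fun _ _ => piecesHomotopy_congr
  have hG : ∀ x, G (glue n c k x) = piecesHomotopy n c k x := fun x =>
    DFunLike.congr_fun ((isQuotientMap_glue hn c k).lift_comp (piecesHomotopy n c k)
      fun _ _ => piecesHomotopy_congr) x
  have hG0 : ∀ x, G x 0 = x := by
    intro x
    obtain ⟨y, rfl⟩ := (isQuotientMap_glue hn c k).surjective x
    rw [hG]
    rcases y with y | ⟨Γ, l⟩
    · rfl
    · exact Subtype.ext (cellHomotopy_zero Γ.2.1 l)
  have hG1 : ∀ x, (G x 1).1 ∈ stage n c k := by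
    intro x
    obtain ⟨y, rfl⟩ := (isQuotientMap_glue hn c k).surjective x
    rw [hG]
    rcases y with y | ⟨Γ, l⟩
    · exact y.2
    · exact cellHomotopy_one_mem hn hc Γ.2.1 Γ.2.2 l
  let i : C(stage n c k, stage n c (k + 1)) :=
    ⟨fun x => ⟨x.1, stage_mono k x.2⟩, continuous_subtype_val.subtype_mk _⟩
  have hGi : ∀ x t, G (i x) t = i x := fun x t => DFunLike.congr_fun (hG (Sum.inl x)) t
  let r : C(stage n c (k + 1), stage n c k) :=
    ⟨fun x => ⟨(G x 1).1, hG1 x⟩, (continuous_subtype_val.comp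
      ((continuous_eval_const (1 : unitInterval)).comp G.continuous)).subtype_mk _⟩
  refine ⟨⟨i, r, ?_, ?_⟩, fun x => rfl⟩
  · have : r.comp i = ContinuousMap.id _ :=
      ContinuousMap.ext fun x =>
      Subtype.ext (show (G (i x) 1).1 = x.1 from congrArg Subtype.val (hGi x 1))
    rw [this]
  · refine ContinuousMap.Homotopic.symm ⟨⟨⟨fun p => G p.2 p.1, ?_⟩, hG0, fun x => rfl⟩⟩
    exact (ContinuousMap.continuous_uncurry_of_continuous G).comp continuous_swap

theorem exists_homotopyEquiv_stage (hn : 1 ≤ n) (hc : 3 * c < 2 * (n + 1)) (k : ℕ) :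
    ∃ h : ContinuousMap.HomotopyEquiv (SigmaQ n c) (stage n c k), ∀ x, (h x).1 = iota n c x := by
  induction k with
  | zero =>
    -- No graph has zero vertices, so the filtration starts with the image of ι, which ι identifies
    -- with its source.
    have h0 : Set.range (iota n c) = stage n c 0 := by
      rw [stage, small_zero, Set.union_empty]
    exact ⟨((isClosedEmbedding_iota hn).isEmbedding.toHomeomorph.trans
      (Homeomorph.setCongr h0)).toHomotopyEquiv, fun x => rfl⟩
  | succ k ih =>
    obtain ⟨h, hh⟩ := ih
    obtain ⟨h', hh'⟩ := exists_homotopyEquiv_stage_succ hn hc k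
    exact ⟨h.trans h', fun x => (hh' (h x)).trans (hh x)⟩

theorem exists_homotopyEquiv_iota (hn : 1 ≤ n) (hc : 3 * c < 2 * (n + 1)) :
    ∃ h : ContinuousMap.HomotopyEquiv (SigmaQ n c) (SigmaQ (n + 1) c), ⇑h = iota n c := by
  obtain ⟨h, hh⟩ := exists_homotopyEquiv_stage hn hc ((n + 1) * (n + 1) + 1)
  have huniv : stage n c ((n + 1) * (n + 1) + 1) = Set.univ := by
    rw [stage, small_eq_univ, Set.union_univ]
  exact ⟨h.trans ((Homeomorph.setCongr huniv).trans (Homeomorph.Set.univ _)).toHomotopyEquiv,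
    funext hh⟩

end CactusSpace

end

theorem mainTheorem4 (n c : ℕ) (hn : 1 ≤ n) :
    Topology.IsEmbedding (CactusSpace.iota n c) ∧
    (2 * c < n + 1 → IsHomeomorph (CactusSpace.iota n c)) ∧
    (3 * (c : ℝ) / 2 < n + 1 →
      ∃ h : ContinuousMap.HomotopyEquiv (CactusSpace.SigmaQ n c) (CactusSpace.SigmaQ (n + 1) c),
        ⇑h = CactusSpace.iota n c) := by
  refine ⟨(CactusSpace.isClosedEmbedding_iota hn).isEmbedding, CactusSpace.isHomeomorph_iota hn,
    fun h => CactusSpace.exists_homotopyEquiv_iota hn ?_⟩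
  -- Clearing the denominator turns the bound into one between natural numbers.
  have h1 : (3 * c : ℝ) < 2 * (n + 1) := by linarith
  exact_mod_cast h1
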